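/- **Setting.** Fix a countably infinite set of labels, countably many type variables $\alpha$, field variables $\theta$ and row variables $\rho$ (each $\rho$ is defined on a cofinite set $\mathrm{def}(\rho)$ of labels), a set $\mathbb B$ of basic types and an interpretation of each $b\in\mathbb B$ as a set $\mathbb B(b)$ of constants, such that $\mathbb B$ is effectively encoded and emptiness of $\bigcap_{b\in P}\mathbb B(b)\setminus\bigcup_{b\in N}\mathbb B(b)$ is computable from the finite lists $P,N$ (automatic if $\mathbb B$ is finite). *Types* are the regular, contractive (every infinite branch crosses infinitely many arrow or record constructors), well-kinded terms produced coinductively by $$t ::= \alpha \mid b \mid t\to t \mid \{\ell_1=\tau_1,\dots,\ell_n=\tau_n \mid tl\}\mid t\vee t\mid \neg t\mid \mathbb 0,\qquad \tau ::= \theta\mid t\mid\bot\mid\tau\vee\tau\mid\neg\tau\mid \mathbb 0,$$ where the $\ell_i$ are distinct, the tail $tl$ is "closed", "open", or a row variable $\rho$ with $\mathrm{def}(\rho)$ equal to the set of labels other than $\ell_1,\dots,\ell_n$. For a record type $R$, $R(\ell_i)=\tau_i$, and for other labels $R(\ell)=\bot$ if $R$ is closed and $R(\ell)=\mathbb 1\vee\bot$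 otherwise ($\mathbb 1=\neg\mathbb 0$). The domain $D$ consists of the finite elements $d$ generated by: constants $c^V$; finite relations $\{(d_1,\omega_1),\dots,(d_n,\omega_n)\}^V$ with $\omega_i\in D\cup\{\Omega\}$; and records $(r^{V'})^{V}$, where $r$ maps finitely many labels to elements of $D\cup\{\bot^W\}$ and all others to $\bot^\emptyset$; here $V,V',W$ are finite sets of variables. Membership is given by: $c^V\in b$ iff $c\in\mathbb B(b)$; a relation is in $t_1\to t_2$ iff $d_i\in t_1$ implies $\omega_i\in t_2$ for all $i$ ($\Omega$ is in no type); a record is in $R$ iff its value at every label $\ell$ is in $R(\ell)$ and, when the tail of $R$ is $\rho$, $\rho\in V'$; an element is in a type or field variable iff the variable is in its tag $V$ (or $W$); $\bot^W\in\bot$; $\vee,\neg,\mathbb 0$ are union, complement (in $D$ for types, in $D\cup\{\bot^W\}$ for field-types) and the empty set; there are no other memberships. Subtyping $t_1\le t_2$ means that every $d\in D$ in $t_1$ is in $t_2$. Types are given to algorithms by finite systems of equations $x_i=\,$(one layer of the grammar over the unknowns). **The procedure $\Phi$.** A record problem is a positive record part $R_\circ$ (its fields for a finite list of labels, and a tail,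 open or closed), a finite set $V_p$ of row variables and a finite list $N$ of record types. $\Phi(R_\circ,V_p,\emptyset)$ is false. $\Phi(R_\circ,V_p,\{R\}\cup N)$: if the tail of $R$ is open, or equals that of $R_\circ$, or is in $V_p$, then it is true iff for every label $\ell$ of the list the field-type $R_\circ(\ell)\wedge\neg R(\ell)$ is empty or $\Phi$ is true with $R_\circ(\ell)$ replaced by $R_\circ(\ell)\wedge\neg R(\ell)$ and with negative part $N$; otherwise it is $\Phi(R_\circ,V_p,N)$. The monomorphic procedure $\Phi_{\mathrm{mono}}$ is the same for open and closed tails only, without $V_p$. The cost of a run counts calls, tail comparisons (up to $|V_p|+2$ for $\Phi$, $2$ for $\Phi_{\mathrm{mono}}$, for each call with nonempty negative part) and field-emptiness tests. **Theorem.** 1. Any two types are given by two unknowns of one finite system of equations, and subtyping is decidable: there is a total computable function that, for all systems and unknowns $x_i,x_j$ denoting types $t_1,t_2$, answers whether $t_1\le t_2$. 2. The following algorithm terminates on all such inputs and decides $t_1\le t_2$. It tests $t_1\wedge\neg t_2$ for emptiness: a goal already under test is taken to be empty; otherwise its DNF is computed and each clause is empty iff a type variable occurs in it with both signs, or its basic,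 arrow and record parts are all empty. An arrow part is tested with the set-theoretic decomposition: for some negative $s\to s'$ and all splittings of the positive arrows $t_i\to t_i'$ into $P',P''$, either $s\wedge\bigwedge_{P'}\neg t_i$ is empty, or $P''\ne\emptyset$ and $\bigwedge_{P''}t_i'\wedge\neg s'$ is empty. A record part is tested by intersecting the positive record types into $R_\circ$ and the set $V_p$ of their row variables, checking whether some field of $R_\circ$ is empty and otherwise running $\Phi$ on the negative ones. Field-type goals are put in DNF, and a clause is empty iff a field variable occurs in it with both signs or it contains neither $\bot$ nor a value. A part is empty when a positive atom of another sort occurs in the clause. 3. The record procedure has the same order of complexity as the monomorphic one. (a) On monomorphic inputs ($V_p=\emptyset$, tails open or closed) $\Phi$ and $\Phi_{\mathrm{mono}}$ have the same results and costs. (b) For all $R_\circ$'s tail, $V_p$ and $N$ there are open/closed tails for $R_\circ$ and the members of $N$ such that, with the same fields and whatever the field tests answer and cost, a terminating run of $\Phi$ with cost $c$ is matched by a run of $\Phi_{\mathrm{mono}}$ with the same result and cost $c'$, with $c'\le c\le(|V_p|+1)c'$. (c) With unit-cost field tests with arbitrary answers, let $W(s)$ and $W_{\mathrm{mono}}(s)$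 be the maximal costs over inputs for which the number of labels plus $|N|$ plus $|V_p|$ is at most $s$. Then $W_{\mathrm{mono}}(s)\le W(s)\le K\,W_{\mathrm{mono}}(s)<\infty$ for a constant $K$ and all $s$. -/

import Mathlib

namespace RowTypes

/-! ### Types

Labels and the variables of each of the three sorts (type, field, row) are natural numbers;
`B` is the set of basic types. -/

/-- The tail of a record type: closed, open, or a row variable. -/
inductive Tail where
  | closed
  | opened
  | row (ρ : ℕ)
  deriving DecidableEq

/-- One layer of the grammar of types and field-types, with subterms in `X`:
types `t ::= 𝟘 | t ∨ t | ¬t | α | b | t → t | {ℓ = τ, …, ℓ = τ | tail}` and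
field-types `τ ::= 𝟘 | τ ∨ τ | ¬τ | θ | ⊥ | t`.
The inclusion of types into field-types is the explicit constructor `ofType`, so that the
negation of a type (relative to all values) and the negation of a field-type (relative to all
values and `⊥`) are never confused. -/
inductive Node (B X : Type) where
  | empty
  | or (x y : X)
  | neg (x : X)
  | tvar (α : ℕ)
  | basic (b : B)
  | arrow (x y : X)
  | record (fields : List (ℕ × X)) (tail : Tail)
  | fvar (θ : ℕ)
  | undef
  | ofType (x : X)

namespace Node

variable {B X Y : Type}

/-- The immediate subterms. -/
def subterms : Node B X → List X
  | or x y => [x, y]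
  | neg x => [x]
  | arrow x y => [x, y]
  | record fs _ => fs.map Prod.snd
  | ofType x => [x]
  | _ => []

def map (f : X → Y) : Node B X → Node B Y
  | empty => empty
  | or x y => or (f x) (f y)
  | neg x => neg (f x)
  | tvar α => tvar α
  | basic b => basic b
  | arrow x y => arrow (f x) (f y)
  | record fs tl => record (fs.map fun p => (p.1, f p.2)) tl
  | fvar θ => fvar θ
  | undef => undef
  | ofType x => ofType (f x)

/-- The type constructors proper: arrows and records. -/
def IsConstructor : Node B X → Prop
  | arrow _ _ => True
  | record _ _ => True
  | _ => False

end Node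

/-- The grammar as a polynomial functor: a shape is a layer whose subterms are forgotten. -/
inductive Shape (B : Type) where
  | empty
  | or
  | neg
  | tvar (α : ℕ)
  | basic (b : B)
  | arrow
  | record (labels : List ℕ) (tail : Tail)
  | fvar (θ : ℕ)
  | undef
  | ofType

def Shape.arity {B : Type} : Shape B → ℕ
  | or => 2
  | neg => 1
  | arrow => 2
  | record ls _ => ls.length
  | ofType => 1
  | _ => 0

def grammar (B : Type) : PFunctor := ⟨Shape B, fun s => Fin s.arity⟩

def Node.toObj {B X : Type} : Node B X → (grammar B).Obj X
  | .empty => ⟨.empty, Fin.elim0⟩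
  | .or x y => ⟨.or, ![x, y]⟩
  | .neg x => ⟨.neg, ![x]⟩
  | .tvar α => ⟨.tvar α, Fin.elim0⟩
  | .basic b => ⟨.basic b, Fin.elim0⟩
  | .arrow x y => ⟨.arrow, ![x, y]⟩
  | .record fs tl => ⟨.record (fs.map Prod.fst) tl,
      fun k => (fs.get (Fin.cast (List.length_map (as := fs) Prod.fst) k)).2⟩
  | .fvar θ => ⟨.fvar θ, Fin.elim0⟩
  | .undef => ⟨.undef, Fin.elim0⟩
  | .ofType x => ⟨.ofType, ![x]⟩

def Node.ofObj {B X : Type} : (grammar B).Obj X → Node B X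
  | ⟨.empty, _⟩ => .empty
  | ⟨.or, f⟩ => .or (f (0 : Fin 2)) (f (1 : Fin 2))
  | ⟨.neg, f⟩ => .neg (f (0 : Fin 1))
  | ⟨.tvar α, _⟩ => .tvar α
  | ⟨.basic b, _⟩ => .basic b
  | ⟨.arrow, f⟩ => .arrow (f (0 : Fin 2)) (f (1 : Fin 2))
  | ⟨.record ls tl, f⟩ => .record (List.ofFn fun k : Fin ls.length => (ls.get k, f k)) tl
  | ⟨.fvar θ, _⟩ => .fvar θ
  | ⟨.undef, _⟩ => .undef
  | ⟨.ofType, f⟩ => .ofType (f (0 : Fin 1))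

/-- The possibly infinite terms produced coinductively by the grammar. -/
def Term (B : Type) : Type := (grammar B).M

namespace Term

variable {B : Type}

/-- The outermost layer of a term. -/
def node (t : Term B) : Node B (Term B) := Node.ofObj (PFunctor.M.dest t)

/-- The term with a given outermost layer. -/
def mk (n : Node B (Term B)) : Term B := PFunctor.M.mk n.toObj

theorem ofObj_toObj {X : Type} (n : Node B X) : Node.ofObj n.toObj = n := by
  cases n <;> try rfl
  case record fs tl =>
    simp only [Node.toObj, Node.ofObj, Node.record.injEq, and_true]
    apply List.ext_get
    · simp
    · intro k h1 h2
      simp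

theorem node_mk (n : Node B (Term B)) : (mk n).node = n := ofObj_toObj n

/-- `s` is an immediate subterm of `t`. -/
def Child (s t : Term B) : Prop := s ∈ t.node.subterms

/-- `s` is a subterm of `t`. -/
def Subterm (s t : Term B) : Prop := Relation.ReflTransGen Child s t

/-- Regularity: there are finitely many distinct subterms. -/
def Regular (t : Term B) : Prop := {s | Subterm s t}.Finite

/-- Contractivity: every infinite branch goes through infinitely many type constructors. -/
def Contractive (t : Term B) : Prop :=
  ∀ branch : ℕ → Term B, branch 0 = t → (∀ n, Child (branch (n + 1)) (branch n)) →
    ∀ n, ∃ m, n ≤ m ∧ (branch m).node.IsConstructor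

end Term

/-- The kinds of types and of field-types. -/
inductive Kind where
  | type
  | field

/-- The kinding rules, read as: a term with outermost layer `n` may have kind `k`, provided
its subterms have the kinds demanded by `R`. The row variable `ρ` is defined on all the labels
except those of the finite set `off ρ`; hence it can only be the tail of a record type
whose explicit labels are exactly those of `off ρ`. -/
def KindRule {B X : Type} (off : ℕ → Finset ℕ) (R : Kind → X → Prop) : Kind → Node B X → Prop
  | _, .empty => True
  | k, .or x y => R k x ∧ R k y
  | k, .neg x => R k x
  | .type, .tvar _ => True
  | .type, .basic _ => True
  | .type, .arrow x y => R .type x ∧ R .type y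
  | .type, .record fs tl =>
      (fs.map Prod.fst).Nodup ∧ (∀ p ∈ fs, R .field p.2) ∧
        (∀ ρ, tl = .row ρ → off ρ = (fs.map Prod.fst).toFinset)
  | .field, .fvar _ => True
  | .field, .undef => True
  | .field, .ofType x => R .type x
  | _, _ => False

/-- Well-kindedness of infinite terms, by the coinductive reading of the kinding rules. -/
def HasKind {B : Type} (off : ℕ → Finset ℕ) (k : Kind) (t : Term B) : Prop :=
  ∃ R : Kind → Term B → Prop, R k t ∧ ∀ k' t', R k' t' → KindRule off R k' t'.node

/-- The types: regular, contractive terms of kind `type`. -/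
structure IsType {B : Type} (off : ℕ → Finset ℕ) (t : Term B) : Prop where
  regular : t.Regular
  contractive : t.Contractive
  kinded : HasKind off .type t

/-! ### The interpretation of types -/

/-- The variables that can tag an element of the domain. -/
inductive Var where
  | ty (α : ℕ)
  | fld (θ : ℕ)
  | row (ρ : ℕ)
  deriving DecidableEq

mutual

/-- The domain of values over the set `C` of constants. Every element carries a finite set `V`
of variables. A function value is a finite relation
`{(arg 0, res 0), …, (arg (n-1), res (n-1))}`. A record value is a row, tagged by `Vr`, that
maps the labels in the finite set `L` as given by `val` and any other label to the
untagged `⊥`. -/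
inductive Dom (C : Type) : Type where
  | const (c : C) (V : Finset Var)
  | func (n : ℕ) (arg : Fin n → Dom C) (res : Fin n → DomOmega C) (V : Finset Var)
  | record (L : Finset ℕ) (val : {ℓ // ℓ ∈ L} → DomUndef C) (Vr : Finset Var) (V : Finset Var)

/-- Values, and the tagged element `⊥` of absent fields. -/
inductive DomUndef (C : Type) : Type where
  | val (d : Dom C)
  | undef (V : Finset Var)

/-- Values, and the type error `Ω`. -/
inductive DomOmega (C : Type) : Type where
  | val (d : Dom C)
  | omega

end

def Dom.tag {C : Type} : Dom C → Finset Var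
  | .const _ V => V
  | .func _ _ _ V => V
  | .record _ _ _ V => V

/-- Set-theoretic reading of the connectives. `Sat v true t` says that `t` holds, and
`Sat v false t` that `t` does not hold, when `v` interprets the subterms of `t` that are not
connectives. -/
inductive Sat {B : Type} (v : Node B (Term B) → Prop) : Bool → Term B → Prop
  | empty {t} : t.node = .empty → Sat v false t
  | neg {t x b} : t.node = .neg x → Sat v b x → Sat v (!b) t
  | or_left {t x y} : t.node = .or x y → Sat v true x → Sat v true t
  | or_right {t x y} : t.node = .or x y → Sat v true y → Sat v true t
  | or_false {t x y} : t.node = .or x y → Sat v false x → Sat v false y → Sat v false t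
  | atom {t} : (t.node ≠ .empty ∧ (∀ x, t.node ≠ .neg x) ∧ ∀ x y, t.node ≠ .or x y) →
      v t.node → Sat v true t
  | atom_false {t} : (t.node ≠ .empty ∧ (∀ x, t.node ≠ .neg x) ∧ ∀ x y, t.node ≠ .or x y) →
      ¬ v t.node → Sat v false t

def Term.undef {B : Type} : Term B := .mk .undef

def Term.any {B : Type} : Term B := .mk (.neg (.mk .empty))

/-- The field-type `𝟙 ∨ ⊥`. -/
def Term.anyOrUndef {B : Type} : Term B := .mk (.or (.mk (.ofType .any)) .undef)

/-- The field-type `R(ℓ)` that a record type gives to the label `ℓ`. -/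
def fieldOf {B : Type} (fs : List (ℕ × Term B)) (tl : Tail) (ℓ : ℕ) : Term B :=
  match fs.lookup ℓ, tl with
  | some τ, _ => τ
  | none, .closed => .undef
  | none, _ => .anyOrUndef

/-- Membership of the tagged element `⊥` in a field-type. -/
def MemBot {B : Type} (V : Finset Var) (τ : Term B) : Prop :=
  Sat (fun n => match n with
    | .undef => True
    | .fvar θ => Var.fld θ ∈ V
    | _ => False) true τ

section Membership

variable {B C : Type} (interp : B → Set C)

mutual

/-- `Mem interp d t`: the value `d` belongs to the type `t`. -/
def Mem : Dom C → Term B → Prop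
  | .const c V, t => Sat (fun n => match n with
      | .tvar α => Var.ty α ∈ V
      | .basic b => c ∈ interp b
      | _ => False) true t
  | .func n arg res V, t => Sat (fun m => match m with
      | .tvar α => Var.ty α ∈ V
      | .arrow x y => ∀ i : Fin n, Mem (arg i) x → MemOmega (res i) y
      | _ => False) true t
  | .record L val Vr V, t => Sat (fun n => match n with
      | .tvar α => Var.ty α ∈ V
      | .record fs tl =>
          (∀ ℓ : {ℓ // ℓ ∈ L}, MemUndef (val ℓ) (fieldOf fs tl ℓ)) ∧
          (∀ ℓ, ℓ ∉ L → MemBot ∅ (fieldOf fs tl ℓ)) ∧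
          (∀ ρ, tl = .row ρ → Var.row ρ ∈ Vr)
      | _ => False) true t

/-- Membership in a field-type. -/
def MemUndef : DomUndef C → Term B → Prop
  | .val d, τ => Sat (fun n => match n with
      | .ofType x => Mem d x
      | .fvar θ => Var.fld θ ∈ d.tag
      | _ => False) true τ
  | .undef V, τ => MemBot V τ

/-- Membership of the result of a function in a type; `Ω` belongs to no type. -/
def MemOmega : DomOmega C → Term B → Prop
  | .val d, t => Mem d t
  | .omega, _ => False

end

/-- Subtyping: containment of the interpretations. -/
def IsSubtype (t₁ t₂ : Term B) : Prop := ∀ d : Dom C, Mem interp d t₁ → Mem interp d t₂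

end Membership

/-! ### Finite presentations of regular terms -/

/-- A finite system of equations `xᵢ = nᵢ`, one for each entry `nᵢ` of the list, in the unknowns
`x₀, x₁, …`. -/
abbrev System (B : Type) := List (Node B ℕ)

/-- The right-hand side of the equation for the unknown `xᵢ`; an unknown without
equation stands for `𝟘`. -/
def System.at {B : Type} (S : System B) (i : ℕ) : Node B ℕ := S.getD i .empty

/-- The solution of the system at the unknown `xᵢ`. -/
def System.unfold {B : Type} (S : System B) : ℕ → Term B :=
  PFunctor.M.corec fun i => (S.at i).toObj

theorem Node.ofObj_map {B X Y : Type} (f : X → Y) (o : (grammar B).Obj X) :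
    Node.ofObj ((grammar B).map f o) = (Node.ofObj o).map f := by
  obtain ⟨s, g⟩ := o
  cases s <;> try rfl
  case record ls tl =>
    simp only [Node.ofObj, Node.map, PFunctor.map, List.map_ofFn]
    rfl

/-- The unfolding is a solution of the system. -/
theorem System.node_unfold {B : Type} (S : System B) (i : ℕ) :
    (S.unfold i).node = (S.at i).map S.unfold :=
  (congrArg Node.ofObj (PFunctor.M.dest_corec (fun i => (S.at i).toObj) i)).trans <|
    (Node.ofObj_map _ _).trans (congrArg _ (Term.ofObj_toObj _))

def Tail.equiv : Tail ≃ Option (Option ℕ) where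
  toFun
    | .closed => none
    | .opened => some none
    | .row ρ => some (some ρ)
  invFun
    | none => .closed
    | some none => .opened
    | some (some ρ) => .row ρ
  left_inv t := by cases t <;> rfl
  right_inv o := by rcases o with _ | _ | _ <;> rfl

instance : Primcodable Tail := Primcodable.ofEquiv _ Tail.equiv

def Node.equiv (B X : Type) : Node B X ≃
    (((Unit ⊕ (X × X)) ⊕ (X ⊕ ℕ)) ⊕ (B ⊕ (X × X))) ⊕
      (((List (ℕ × X) × Tail) ⊕ ℕ) ⊕ (Unit ⊕ X)) where
  toFun
    | .empty => .inl (.inl (.inl (.inl ())))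
    | .or x y => .inl (.inl (.inl (.inr (x, y))))
    | .neg x => .inl (.inl (.inr (.inl x)))
    | .tvar α => .inl (.inl (.inr (.inr α)))
    | .basic b => .inl (.inr (.inl b))
    | .arrow x y => .inl (.inr (.inr (x, y)))
    | .record fs tl => .inr (.inl (.inl (fs, tl)))
    | .fvar θ => .inr (.inl (.inr θ))
    | .undef => .inr (.inr (.inl ()))
    | .ofType x => .inr (.inr (.inr x))
  invFun
    | .inl (.inl (.inl (.inl ()))) => .empty
    | .inl (.inl (.inl (.inr (x, y)))) => .or x y
    | .inl (.inl (.inr (.inl x))) => .neg x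
    | .inl (.inl (.inr (.inr α))) => .tvar α
    | .inl (.inr (.inl b)) => .basic b
    | .inl (.inr (.inr (x, y))) => .arrow x y
    | .inr (.inl (.inl (fs, tl))) => .record fs tl
    | .inr (.inl (.inr θ)) => .fvar θ
    | .inr (.inr (.inl ())) => .undef
    | .inr (.inr (.inr x)) => .ofType x
  left_inv n := by cases n <;> rfl
  right_inv s := by
    rcases s with (((_ | ⟨_, _⟩) | (_ | _)) | (_ | ⟨_, _⟩)) | ((⟨_, _⟩ | _) | (_ | _)) <;> rfl

instance {B X : Type} [Primcodable B] [Primcodable X] : Primcodable (Node B X) :=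
  Primcodable.ofEquiv _ (Node.equiv B X)

/-! ### The algorithm -/

/-- A run of a procedure: its result and the number of elementary steps it took, or `none` when
the bound on the depth of recursion was hit. -/
abbrev Run (α : Type) := Option (α × ℕ)

namespace Run

/-- Charge `n` steps. -/
def tick {α : Type} (n : ℕ) (x : Run α) : Run α := x.map fun p => (p.1, n + p.2)

/-- The constant `b`, at no cost. -/
def ret (b : Bool) : Run Bool := some (b, 0)

/-- Disjunction, evaluated from left to right; the right-hand side is run only if needed. -/
def or (x y : Run Bool) : Run Bool :=
  x.bind fun p => if p.1 then x else y.tick p.2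

/-- Conjunction, evaluated from left to right; the right-hand side is run only if needed. -/
def and (x y : Run Bool) : Run Bool :=
  x.bind fun p => if p.1 then y.tick p.2 else x

def all {α : Type} (l : List α) (f : α → Run Bool) : Run Bool :=
  l.foldr (fun a r => (f a).and r) (ret true)

def any {α : Type} (l : List α) (f : α → Run Bool) : Run Bool :=
  l.foldr (fun a r => (f a).or r) (ret false)

end Run

/-- A literal: an unknown (`true`) or the negation of an unknown (`false`). -/
abbrev Lit := Bool × ℕ

/-- Conjunction of two disjunctive normal forms. -/
def meet {α : Type} (D E : List (List α)) : List (List α) :=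
  D.flatMap fun c => E.map fun c' => c ++ c'

section Algorithm

variable {B : Type} (S : System B) (emp : List B × List B → Bool)

/-- Disjunctive normal form of a literal: a list of clauses, each a list of literals on unknowns
that are not defined by a connective. The first argument bounds the nesting of connectives;
for contractive terms, the number of equations plus one suffices. -/
def dnfLit : ℕ → Lit → List (List Lit)
  | 0, _ => []
  | n + 1, (p, i) =>
    match S.at i, p with
    | .empty, true => []
    | .empty, false => [[]]
    | .neg j, p => dnfLit n (!p, j)
    | .or j k, true => dnfLit n (true, j) ++ dnfLit n (true, k)
    | .or j k, false => meet (dnfLit n (false, j)) (dnfLit n (false, k))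
    | _, p => [[(p, i)]]

/-- Disjunctive normal form of a conjunction of literals. -/
def dnf (g : List Lit) : List (List Lit) :=
  g.foldr (fun l D => meet (dnfLit S (S.length + 1) l) D) [[]]

/-- The number of literals of a disjunctive normal form, plus one for every clause. -/
def dnfSize {α : Type} (D : List (List α)) : ℕ := (D.map fun c => c.length + 1).sum

/-- A field of a record type in a system: `𝟙 ∨ ⊥`, `⊥`, or the field-type of an unknown. -/
inductive Fld where
  | top
  | absent
  | ref (i : ℕ)
  deriving DecidableEq

/-- A conjunction of possibly negated fields. -/
abbrev FldGoal := List (Bool × Fld)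

def dnfFldLit : Bool × Fld → List FldGoal
  | (true, .top) => [[]]
  | (false, .top) => []
  | (p, .absent) => [[(p, .absent)]]
  | (p, .ref i) => (dnfLit S (S.length + 1) (p, i)).map fun c => c.map fun l => (l.1, .ref l.2)

def dnfFld (g : FldGoal) : List FldGoal :=
  g.foldr (fun l D => meet (dnfFldLit S l) D) [[]]

/-- The field variables occurring in a clause with sign `p`. -/
def fvarsOf (p : Bool) (c : FldGoal) : List ℕ := c.filterMap fun l =>
  match l.2 with
  | .ref i => match S.at i with
    | .fvar θ => if l.1 = p then some θ else none
    | _ => none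
  | _ => none

/-- Does `⊥` occur in a clause with sign `p`? -/
def undefIn (p : Bool) (c : FldGoal) : Bool := c.any fun l =>
  match l.2 with
  | .ref i => match S.at i with
    | .undef => l.1 == p
    | _ => false
  | .absent => l.1 == p
  | .top => false

/-- The literals of a clause on unknowns standing for types. -/
def typesOf (c : FldGoal) : List Lit := c.filterMap fun l =>
  match l.2 with
  | .ref i => match S.at i with
    | .ofType j => some (l.1, j)
    | _ => none
  | _ => none

/-- Emptiness of a conjunction of fields, relative to a test `test` for the emptiness of a
conjunction of types. A clause is empty if a field variable occurs in it with both signs,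
or if it contains neither `⊥` nor any value. -/
def fldEmpty (test : List Lit → Run Bool) (g : FldGoal) : Run Bool :=
  Run.tick (1 + dnfSize (dnfFld S g)) <| Run.all (dnfFld S g) fun c =>
    Run.or (Run.ret ((fvarsOf S true c).any fun θ => θ ∈ fvarsOf S false c)) <|
    Run.and (Run.ret (undefIn S false c || (typesOf S c).any fun l => l.1)) <|
    Run.or (Run.ret (undefIn S true c)) (test (typesOf S c))

/-- The procedure `Φ`. The record types are given by the list of their fields for the same list
of labels and by their tail. `R` and `tl` are the fields, already intersected, and the tail (closed
or open) of a conjunction of record types; `Vp` lists the row variables occurring as tails in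
that conjunction; the third argument lists the record types of the negative part.
`test` tests a conjunction of fields for emptiness. Each call costs one step, and the condition on
the tails costs one step for each tail with which the tail at hand may have to be compared. -/
def phi (test : FldGoal → Run Bool) (tl : Tail) (Vp : List ℕ) :
    List (List Fld × Tail) → List FldGoal → Run Bool
  | [], _ => Run.tick 1 (Run.ret false)
  | (Q, tl') :: N, R => Run.tick (3 + Vp.length) <|
      if tl' = .opened ∨ tl' = tl ∨ ∃ ρ ∈ Vp, tl' = .row ρ then
        Run.all (List.range R.length) fun k =>
          let g := R.getD k [] ++ [(false, Q.getD k .top)]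
          Run.or (test g) (phi test tl Vp N (R.set k g))
      else phi test tl Vp N R

/-- The procedure `Φ` for monomorphic record types, whose tails are either open (`true`) or closed
(`false`). -/
def phiMono (test : FldGoal → Run Bool) (opn : Bool) :
    List (List Fld × Bool) → List FldGoal → Run Bool
  | [], _ => Run.tick 1 (Run.ret false)
  | (Q, opn') :: N, R => Run.tick 3 <|
      if opn' = true ∨ opn' = opn then
        Run.all (List.range R.length) fun k =>
          let g := R.getD k [] ++ [(false, Q.getD k .top)]
          Run.or (test g) (phiMono test opn N (R.set k g))
      else phiMono test opn N R

/-- A record type in a system. -/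
abbrev Rec := List (ℕ × ℕ) × Tail

/-- The field of a record type for the label `ℓ`. -/
def Rec.fieldAt (R : Rec) (ℓ : ℕ) : Fld :=
  match R.1.lookup ℓ, R.2 with
  | some i, _ => .ref i
  | none, .closed => .absent
  | none, _ => .top

/-- Emptiness of the conjunction of the record types in `P` and of the negations of those in `N`:
the positive part is turned into one record type, whose fields are tested for emptiness,
and a list of row variables; then `Φ` is run. -/
def recordEmpty (test : List Lit → Run Bool) (P N : List Rec) : Run Bool :=
  let L : List ℕ := ((P ++ N).flatMap fun R => R.1.map Prod.fst).dedup
  let R₀ : List FldGoal := L.map fun ℓ => P.map fun R => (true, R.fieldAt ℓ)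
  let tl : Tail := if P.any fun R => R.2 = .closed then .closed else .opened
  let Vp : List ℕ := (P.filterMap fun R => match R.2 with
    | .row ρ => some ρ
    | _ => none).dedup
  let N₀ : List (List Fld × Tail) := N.map fun R => (L.map R.fieldAt, R.2)
  Run.or (Run.any R₀ (fldEmpty S test)) (phi (fldEmpty S test) tl Vp N₀ R₀)

/-- All the ways of splitting a list in two. -/
def splits {α : Type} : List α → List (List α × List α)
  | [] => [([], [])]
  | a :: l => (splits l).flatMap fun p => [(a :: p.1, p.2), (p.1, a :: p.2)]

/-- Emptiness of the conjunction of the arrow types in `P` and of the negations of those in `N`. -/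
def arrowEmpty (test : List Lit → Run Bool) (P N : List (ℕ × ℕ)) : Run Bool :=
  Run.any N fun a => Run.all (splits P) fun p =>
    Run.or (Run.tick 1 (test ((true, a.1) :: p.1.map fun q => (false, q.1)))) <|
    Run.and (Run.ret (!p.2.isEmpty))
      (Run.tick 1 (test ((false, a.2) :: p.2.map fun q => (true, q.2))))

/-- The layers that occur in a clause with sign `p`. -/
def nodesOf (p : Bool) (c : List Lit) : List (Node B ℕ) :=
  (c.filter fun l => l.1 = p).map fun l => S.at l.2

def tvarsOf (ns : List (Node B ℕ)) : List ℕ := ns.filterMap fun n => match n with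
  | .tvar α => some α
  | _ => none

def basicsOf (ns : List (Node B ℕ)) : List B := ns.filterMap fun n => match n with
  | .basic b => some b
  | _ => none

def arrowsOf (ns : List (Node B ℕ)) : List (ℕ × ℕ) := ns.filterMap fun n => match n with
  | .arrow i j => some (i, j)
  | _ => none

def recordsOf (ns : List (Node B ℕ)) : List Rec := ns.filterMap fun n => match n with
  | .record fs tl => some (fs, tl)
  | _ => none

/-- Emptiness of a clause of a disjunctive normal form of types: either a type variable occurs with
both signs, or the clause contains no constant, no function and no record. -/
def clauseEmpty (test : List Lit → Run Bool) (c : List Lit) : Run Bool :=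
  let P := nodesOf S true c
  let N := nodesOf S false c
  let hasB := !(basicsOf P).isEmpty
  let hasA := !(arrowsOf P).isEmpty
  let hasR := !(recordsOf P).isEmpty
  Run.or (Run.ret ((tvarsOf P).any fun α => α ∈ tvarsOf N)) <|
  Run.and (Run.ret (hasA || hasR || emp (basicsOf P, basicsOf N))) <|
  Run.and (Run.or (Run.ret (hasB || hasR)) (arrowEmpty test (arrowsOf P) (arrowsOf N)))
    (Run.or (Run.ret (hasB || hasA)) (recordEmpty S test (recordsOf P) (recordsOf N)))

/-- Emptiness of a conjunction `g` of literals, where the first argument bounds the depth of the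
recursion and `hyps` lists the conjunctions that are assumed to be empty because they are being
tested. -/
def typeEmpty : ℕ → List (List Lit) → List Lit → Run Bool
  | 0, _, _ => none
  | n + 1, hyps, g =>
    Run.tick (1 + hyps.length) <|
      if ∃ h ∈ hyps, (∀ l ∈ h, l ∈ g) ∧ ∀ l ∈ g, l ∈ h then Run.ret true
      else Run.tick (dnfSize (dnf S g)) <|
        Run.all (dnf S g) (clauseEmpty S emp (typeEmpty n (g :: hyps)))

/-- The subtyping algorithm on the types that the system assigns to the unknowns `xᵢ` and `xⱼ`:
test the emptiness of `xᵢ ∧ ¬xⱼ`. -/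
def subtypeAlg (n i j : ℕ) : Run Bool := typeEmpty S emp n [] [(true, i), (false, j)]

end Algorithm

/-! ### Worst-case costs of the record procedures -/

/-- The test that asks an oracle, at unit cost. -/
def oracleTest (o : FldGoal → Bool) (g : FldGoal) : Run Bool := some (o g, 1)

/-- The number of steps of a run (all runs with an oracle terminate). -/
def Run.cost {α : Type} (r : Run α) : ℕ := (r.map Prod.snd).getD 0

/-- The worst-case cost of `Φ` on inputs of size `s`: the number of labels plus the number of
negative record types plus the number of positive row variables is at most `s`. -/
noncomputable def worstPhi (s : ℕ) : ℕ∞ :=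
  ⨆ (o : FldGoal → Bool) (tl : Tail) (Vp : List ℕ) (N : List (List Fld × Tail))
    (R : List FldGoal) (_ : R.length + N.length + Vp.length ≤ s)
    (_ : tl = .closed ∨ tl = .opened) (_ : ∀ Q ∈ N, Q.1.length = R.length),
    ((phi (oracleTest o) tl Vp N R).cost : ℕ∞)

/-- The worst-case cost of the monomorphic procedure on inputs of size `s`. -/
noncomputable def worstPhiMono (s : ℕ) : ℕ∞ :=
  ⨆ (o : FldGoal → Bool) (opn : Bool) (N : List (List Fld × Bool))
    (R : List FldGoal) (_ : R.length + N.length ≤ s) (_ : ∀ Q ∈ N, Q.1.length = R.length),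
    ((phiMono (oracleTest o) opn N R).cost : ℕ∞)

/-- An open or closed tail. -/
def Tail.ofBool : Bool → Tail
  | true => .opened
  | false => .closed

end RowTypes

open RowTypes

namespace RowTypes

/-! ### Costs of the record procedures -/

-- Decidability. A regular term has finitely many subterms, so two types can be presented by one
-- finite system; the solution of a system is unique because infinite terms form a final coalgebra.
-- In a contractive term, connectives are nested at most as deeply as there are equations, since a
-- longer chain would repeat an unknown and produce an infinite branch without constructors. Hence
-- the bounded normal-form computation `dnfLit` is exact, and on such terms the two polarities of
-- `Sat` are complementary.
--
-- The answers of the algorithm are checked in two directions. An answer "nonempty" never rests on a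
-- goal assumed empty, so a witness is built by induction on the depth of recursion
-- (`typeEmpty_complete`). An answer "empty" may be circular. It is justified by induction on the
-- height of values (`typeEmpty_sound`): a clause at height `h + 1` depends on its subgoals only at
-- height `h`, where the goals under test may already be taken as empty. Every value is finite, so
-- all heights are covered.
--
-- The steps of the two inductions treat the sorts of atoms apart. For arrows, the negative atoms
-- are independent, because a finite relation can collect one refuting pair for each of them, with
-- `Ω` as the result when no positive arrow constrains it. For records, only the finitely many
-- explicit labels matter. A negative type with a row variable outside `Vp` is avoided by leaving
-- that variable out of the tag, and a closed one against an open positive part is avoided by a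
-- value at one fresh label. The other negative types must each be refuted at a listed label, and
-- `Φ` searches for the choice of labels. Tags take care of variables: the positive ones are put in,
-- the others left out.
--
-- Termination: nested goals are pairwise distinct sets of literals over the finitely many unknowns
-- of the system, so beyond some depth the run no longer depends on the depth bound
-- (`exists_typeEmpty`). This holds for every system, so an unbounded search for a sufficient depth
-- is a total computable function. Since the procedures take other procedures as arguments,
-- computability is proved by realizability: `Effective` functions act on codes, are closed under
-- abstraction, application and recursion, and coincide with computable ones on encoded types.
--
-- Costs. Replacing the tails that pass the test of `Φ` by open ones, and the others by closed ones,
-- yields a monomorphic run with the same shape; a call costs `3 + v` instead of `3`. For the worst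
-- cases, a recurrence bounds `Φ` from above, and an oracle that forces the full search bounds the
-- monomorphic procedure from below. With at least two labels, one more negative type doubles the
-- cost, so it outweighs one more row variable, which counts the same in the input size. With fewer
-- labels `Φ` does not branch, and its cost is below the exponential cost of monomorphic inputs with
-- two labels.

theorem phi_ofBool (test : FldGoal → Run Bool) (opn : Bool) (N : List (List Fld × Bool))
    (R : List FldGoal) :
    phi test (Tail.ofBool opn) [] (N.map fun Q => (Q.1, Tail.ofBool Q.2)) R =
      phiMono test opn N R := by
  induction N generalizing R with
  | nil => rfl
  | cons Q N ih =>
    obtain ⟨Q, o⟩ := Q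
    simp only [List.map_cons, phi, phiMono, ih]
    cases o <;> cases opn <;> simp [Tail.ofBool]

/-- If `x` terminates, then so does `y`, with the same result and with a cost that is
smaller by a factor of at most `v + 1`. -/
def CostLe (v : ℕ) (x y : Run Bool) : Prop :=
  ∀ b c, x = some (b, c) → ∃ c', y = some (b, c') ∧ c' ≤ c ∧ c ≤ (v + 1) * c'

namespace CostLe

variable {v : ℕ} {x x' y y' : Run Bool}

theorem refl (x : Run Bool) : CostLe v x x := fun _ c h =>
  ⟨c, h, le_rfl, Nat.le_mul_of_pos_left _ (Nat.succ_pos _)⟩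

theorem tick {a a' : ℕ} (h₁ : a' ≤ a) (h₂ : a ≤ (v + 1) * a') (h : CostLe v x y) :
    CostLe v (x.tick a) (y.tick a') := by
  intro b c hx
  rcases x with _ | ⟨b₀, c₀⟩
  · simp [Run.tick] at hx
  · obtain ⟨c', hy, h₃, h₄⟩ := h b₀ c₀ rfl
    simp only [Run.tick, Option.map_some, Option.some.injEq, Prod.mk.injEq] at hx
    obtain ⟨rfl, rfl⟩ := hx
    exact ⟨a' + c', by simp [hy, Run.tick], by omega, by rw [mul_add]; omega⟩

/-- The results of `x` and `y` coincide, so both disjunctions take the same branch and the costs add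
up on both sides. -/
theorem or (h : CostLe v x y) (h' : CostLe v x' y') : CostLe v (x.or x') (y.or y') := by
  rcases x with _ | ⟨b₀, c₀⟩
  · intro b c hx
    simp [Run.or] at hx
  · obtain ⟨c', rfl, h₃, h₄⟩ := h b₀ c₀ rfl
    cases b₀
    · exact h'.tick h₃ h₄
    · exact h

theorem and (h : CostLe v x y) (h' : CostLe v x' y') : CostLe v (x.and x') (y.and y') := by
  rcases x with _ | ⟨b₀, c₀⟩
  · intro b c hx
    simp [Run.and] at hx
  · obtain ⟨c', rfl, h₃, h₄⟩ := h b₀ c₀ rfl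
    cases b₀
    · exact h
    · exact h'.tick h₃ h₄

theorem all {α : Type} {f f' : α → Run Bool} (l : List α) (h : ∀ a, CostLe v (f a) (f' a)) :
    CostLe v (Run.all l f) (Run.all l f') := by
  induction l with
  | nil => exact refl _
  | cons a l ih => exact (h a).and ih

end CostLe

/-- `Φ` behaves as the monomorphic procedure where the tails that pass the test of `Φ`
are replaced by open tails and the other ones by closed tails. -/
theorem costLe_phi_phiMono (test : FldGoal → Run Bool) (tl : Tail) (Vp : List ℕ)
    (N : List (List Fld × Tail)) (R : List FldGoal) :
    CostLe Vp.length (phi test tl Vp N R) (phiMono test true (N.map fun Q =>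
      (Q.1, decide (Q.2 = .opened ∨ Q.2 = tl ∨ ∃ ρ ∈ Vp, Q.2 = .row ρ))) R) := by
  induction N generalizing R with
  | nil => exact CostLe.refl _
  | cons Q N ih =>
    obtain ⟨Q, tl'⟩ := Q
    simp only [List.map_cons, phi, phiMono]
    -- One call costs `3 + v` against `3`, and `3 + v ≤ (v + 1) * 3`.
    refine CostLe.tick (by omega) (by rw [add_mul]; omega) ?_
    by_cases h : tl' = .opened ∨ tl' = tl ∨ ∃ ρ ∈ Vp, tl' = .row ρ
    · rw [if_pos h, if_pos (by simp [h])]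
      exact CostLe.all _ fun k => (CostLe.refl _).or (ih _)
    · rw [if_neg h, if_neg (by simp [h])]
      exact ih _

/-- `x` terminates at cost at most `M`. -/
def CostBound (M : ℕ) (x : Run Bool) : Prop := ∃ b c, x = some (b, c) ∧ c ≤ M

namespace CostBound

variable {M M' : ℕ} {x y : Run Bool}

theorem mono (h : CostBound M x) (hM : M ≤ M') : CostBound M' x := by
  obtain ⟨b, c, h, hc⟩ := h
  exact ⟨b, c, h, hc.trans hM⟩

theorem tick (a : ℕ) (h : CostBound M x) : CostBound (a + M) (x.tick a) := by
  obtain ⟨b, c, rfl, hc⟩ := h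
  exact ⟨b, a + c, rfl, by omega⟩

theorem or (h : CostBound M x) (h' : CostBound M' y) : CostBound (M + M') (x.or y) := by
  obtain ⟨b, c, rfl, hc⟩ := h
  cases b
  · exact (h'.tick c).mono (by omega)
  · exact ⟨true, c, rfl, by omega⟩

theorem and (h : CostBound M x) (h' : CostBound M' y) : CostBound (M + M') (x.and y) := by
  obtain ⟨b, c, rfl, hc⟩ := h
  cases b
  · exact ⟨false, c, rfl, by omega⟩
  · exact (h'.tick c).mono (by omega)

theorem all {α : Type} {f : α → Run Bool} (l : List α) (h : ∀ a, CostBound M (f a)) :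
    CostBound (l.length * M) (Run.all l f) := by
  induction l with
  | nil => exact ⟨true, 0, rfl, Nat.zero_le _⟩
  | cons a l ih => exact ((h a).and ih).mono (by rw [List.length_cons, add_mul]; omega)

theorem cost_le (h : CostBound M x) : x.cost ≤ M := by
  obtain ⟨b, c, rfl, hc⟩ := h
  exact hc

end CostBound

/-- A bound on the cost of `Φ` with unit-cost field tests, for `n` labels, `v` row variables and
`m` negative record types. -/
def phiBound (n v : ℕ) : ℕ → ℕ
  | 0 => 1
  -- The maximum with `1` covers a negative type that fails the tail test: it causes one recursive
  -- call even when there are no labels.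
  | m + 1 => 3 + v + n + max n 1 * phiBound n v m

theorem costBound_phi (o : FldGoal → Bool) (tl : Tail) (Vp : List ℕ)
    (N : List (List Fld × Tail)) (R : List FldGoal) :
    CostBound (phiBound R.length Vp.length N.length) (phi (oracleTest o) tl Vp N R) := by
  induction N generalizing R with
  | nil => exact ⟨false, 1, rfl, le_rfl⟩
  | cons Q N ih =>
    obtain ⟨Q, tl'⟩ := Q
    simp only [phi, List.length_cons, phiBound]
    rw [add_assoc _ R.length]
    refine CostBound.tick _ ?_
    split
    · have h := CostBound.all (M := 1 + phiBound R.length Vp.length N.length)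
        (List.range R.length) (f := fun k =>
          (oracleTest o (R.getD k [] ++ [(false, Q.getD k .top)])).or
            (phi (oracleTest o) tl Vp N
              (R.set k (R.getD k [] ++ [(false, Q.getD k .top)])))) fun k => by
          refine CostBound.or ⟨_, 1, rfl, le_rfl⟩ ?_
          have := ih (R.set k (R.getD k [] ++ [(false, Q.getD k .top)]))
          rwa [List.length_set] at this
      refine h.mono ?_
      rw [List.length_range, mul_add, mul_one]
      exact Nat.add_le_add_left (Nat.mul_le_mul_right _ (le_max_left _ _)) _
    · refine (ih R).mono ?_
      have := Nat.mul_le_mul_right (phiBound R.length Vp.length N.length)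
        (le_max_right R.length 1)
      omega

/-- The number `v` enters the recurrence only through the additive term, and `3 + v + n ≤ 2 ^ v * (3
+ n)`; the recurrence is affine, so the factor passes through it. -/
theorem phiBound_le_pow_mul (n v m : ℕ) : phiBound n v m ≤ 2 ^ v * phiBound n 0 m := by
  have hv : v + 1 ≤ 2 ^ v := Nat.lt_two_pow_self
  induction m with
  | zero => simp only [phiBound]; omega
  | succ m ih =>
    simp only [phiBound]
    have h₁ : 3 + v + n ≤ 2 ^ v * (3 + 0 + n) := by nlinarith
    have h₂ := Nat.mul_le_mul_left (max n 1) ih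
    calc _ ≤ 2 ^ v * (3 + 0 + n) + max n 1 * (2 ^ v * phiBound n 0 m) := by omega
      _ = _ := by ring

/-- With two labels or more, each further negative type at least doubles the bound. The factor lost
to `v` row variables is thus repaid by `v` negative types, which weigh the same in the input size.
-/
theorem pow_mul_phiBound_le {n : ℕ} (hn : 2 ≤ n) (v m : ℕ) :
    2 ^ v * phiBound n 0 m ≤ phiBound n 0 (m + v) := by
  induction v with
  | zero => simp
  | succ v ih =>
    have h : 2 ≤ max n 1 := hn.trans (le_max_left _ _)
    have := Nat.mul_le_mul_right (phiBound n 0 (m + v)) h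
    rw [← add_assoc, phiBound, pow_succ, mul_right_comm]
    omega

/-- With at most one label the search does not branch, and the bound grows linearly in the number of
negative types. -/
theorem phiBound_le_of_le_one {n : ℕ} (hn : n ≤ 1) (v m : ℕ) :
    phiBound n v m ≤ (4 + v) * (m + 1) := by
  have h : max n 1 = 1 := max_eq_right hn
  induction m with
  | zero => simp only [phiBound]; omega
  | succ m ih =>
    rw [phiBound, h, mul_add _ (m + 1)]
    omega

theorem phiBound_mono {n n' m m' : ℕ} (v : ℕ) (hn : n ≤ n') (hm : m ≤ m') :
    phiBound n v m ≤ phiBound n' v m' := by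
  have h₁ : ∀ m, phiBound n v m ≤ phiBound n' v m := by
    intro m
    induction m with
    | zero => exact le_rfl
    | succ m ih =>
      have : max n 1 ≤ max n' 1 := max_le_max hn le_rfl
      have := Nat.mul_le_mul this ih
      simp only [phiBound]
      omega
  have h₂ : Monotone (phiBound n' v) := monotone_nat_of_le_succ fun m => by
    have := Nat.mul_le_mul_right (phiBound n' v m) (le_max_right n' 1)
    simp only [phiBound]
    omega
  exact (h₁ m).trans (h₂ hm)

/-- The cost of a run of the monomorphic procedure for `n` labels and `m + 1` negative record types
where the last field tests succeed and all other ones fail. -/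
def lateCost (n : ℕ) : ℕ → ℕ
  | 0 => 3 + n
  | m + 1 => 3 + n * (1 + lateCost n m)

/-- The two recurrences are the same; they differ only at the last negative type, where the bound
also counts one terminal call per label. -/
theorem phiBound_le_lateCost {n : ℕ} (hn : 1 ≤ n) (m : ℕ) :
    phiBound n 0 (m + 1) ≤ 2 * lateCost n m := by
  have h : max n 1 = n := max_eq_left hn
  induction m with
  | zero => simp only [phiBound, lateCost, h]; omega
  | succ m ih =>
    rw [phiBound, h, lateCost]
    have := Nat.mul_le_mul_left n ih
    rw [show 2 * (3 + n * (1 + lateCost n m)) = 6 + 2 * n + n * (2 * lateCost n m) by ring]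
    omega

/-- The oracle that gives a positive answer on the last negative record type only. -/
def lateOracle (g : FldGoal) : Bool := g.getLast? = some (false, .ref 0)

def lateInput (n m : ℕ) : List (List Fld × Bool) :=
  List.replicate m (List.replicate n .top, true) ++ [(List.replicate n (.ref 0), true)]

theorem Run.all_of_forall {α : Type} {f : α → Run Bool} {c : ℕ} (l : List α)
    (h : ∀ a ∈ l, f a = some (true, c)) : Run.all l f = some (true, l.length * c) := by
  induction l with
  | nil => simp [Run.all, Run.ret]
  | cons a l ih =>
    have := ih fun a ha => h a (List.mem_cons_of_mem _ ha)
    simp only [Run.all, List.foldr_cons] at this ⊢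
    rw [this, h a List.mem_cons_self]
    simp only [Run.and, Run.tick, Option.bind_some, if_true, Option.map_some, List.length_cons]
    rw [add_mul, one_mul, add_comm]

/-- Before the last type every field test fails, so the recursive call is made, and every recursive
call succeeds, so the next label is tried. Nothing is cut short and the whole search tree is
visited. -/
theorem phiMono_lateInput (m : ℕ) (R : List FldGoal) :
    phiMono (oracleTest lateOracle) true (lateInput R.length m) R =
      some (true, lateCost R.length m) := by
  induction m generalizing R with
  | zero =>
    simp only [lateInput, List.replicate_zero, List.nil_append, phiMono, true_or, if_true]
    rw [Run.all_of_forall (c := 1)]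
    · simp [Run.tick, lateCost]
    · intro k hk
      have hk : k < R.length := List.mem_range.1 hk
      simp [oracleTest, lateOracle, Run.or, hk]
  | succ m ih =>
    rw [lateInput, List.replicate_succ, List.cons_append, phiMono, if_pos (Or.inl rfl),
      Run.all_of_forall (c := 1 + lateCost R.length m)]
    · simp [Run.tick, lateCost]
    · intro k hk
      have hk : k < R.length := List.mem_range.1 hk
      have := ih (R.set k (R.getD k [] ++ [(false, (List.replicate R.length Fld.top).getD k .top)]))
      simp only [List.length_set, lateInput] at this
      dsimp only
      rw [this]
      simp [oracleTest, lateOracle, Run.or, hk, Run.tick]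

theorem lateCost_le_worstPhiMono {n m s : ℕ} (h : n + (m + 1) ≤ s) :
    (lateCost n m : ℕ∞) ≤ worstPhiMono s := by
  have hl := phiMono_lateInput m (List.replicate n [])
  rw [List.length_replicate] at hl
  unfold worstPhiMono
  refine le_iSup_of_le lateOracle <| le_iSup_of_le true <| le_iSup_of_le (lateInput n m) <|
    le_iSup_of_le (List.replicate n []) <| le_iSup_of_le (by simpa [lateInput] using h) <|
    le_iSup_of_le ?_ ?_
  · intro Q hQ
    simp only [lateInput, List.mem_append, List.mem_replicate, List.mem_singleton] at hQ
    rcases hQ with ⟨_, rfl⟩ | rfl <;> simp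
  · rw [hl]
    rfl

theorem one_le_worstPhiMono (s : ℕ) : 1 ≤ worstPhiMono s := by
  unfold worstPhiMono
  refine le_iSup_of_le lateOracle <| le_iSup_of_le true <| le_iSup_of_le [] <|
    le_iSup_of_le [] <| le_iSup_of_le (by simp) <| le_iSup_of_le (by simp) ?_
  exact le_rfl

theorem pow_le_lateCost (m : ℕ) : 2 ^ (m + 1) ≤ lateCost 2 m := by
  induction m with
  | zero => simp [lateCost]
  | succ m ih =>
    rw [pow_succ, lateCost]
    omega

/-- For `s ≥ 3` the bound comes from two labels and `s - 2` negative types; for smaller `s` a single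
step suffices, as `2 ^ s ≤ 4`. -/
theorem pow_le_worstPhiMono (s : ℕ) : (2 ^ s : ℕ) ≤ 4 * worstPhiMono s := by
  rcases Nat.lt_or_ge s 3 with hs | hs
  · have h : 2 ^ s ≤ 4 := by
      interval_cases s <;> norm_num
    calc ((2 ^ s : ℕ) : ℕ∞) ≤ 4 * 1 := by exact_mod_cast h
      _ ≤ _ := by gcongr; exact one_le_worstPhiMono s
  · obtain ⟨t, rfl⟩ : ∃ t, s = t + 3 := ⟨s - 3, by omega⟩
    calc ((2 ^ (t + 3) : ℕ) : ℕ∞) = 4 * (2 ^ (t + 1) : ℕ) := by norm_cast; ring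
      _ ≤ 4 * (lateCost 2 t : ℕ) := by gcongr; exact_mod_cast pow_le_lateCost t
      _ ≤ _ := by gcongr; exact lateCost_le_worstPhiMono (by omega)

/-- For `n ≤ 1` the linear bound is at most `4 * 2 ^ s`, and `2 ^ s` is at most four times the
monomorphic worst case, whence `16`. For `n ≥ 2` the row variables are traded for negative types,
and the late input with those types still fits in the size `s`. -/
theorem phiBound_le_worstPhiMono {n m v s : ℕ} (h : n + m + v ≤ s) :
    (phiBound n v m : ℕ∞) ≤ 16 * worstPhiMono s := by
  have hW := one_le_worstPhiMono s
  rcases Nat.lt_or_ge n 2 with hn | hn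
  · have h₁ : phiBound n v m ≤ 4 * 2 ^ s := by
      refine (phiBound_le_of_le_one (by omega) v m).trans ?_
      have hv : v + 1 ≤ 2 ^ v := Nat.lt_two_pow_self
      have hm : m + 1 ≤ 2 ^ m := Nat.lt_two_pow_self
      calc (4 + v) * (m + 1) ≤ (4 * 2 ^ v) * 2 ^ m := Nat.mul_le_mul (by omega) hm
        _ = 4 * 2 ^ (v + m) := by ring
        _ ≤ _ := by gcongr <;> omega
    calc (phiBound n v m : ℕ∞) ≤ 4 * (2 ^ s : ℕ) := by exact_mod_cast h₁
      _ ≤ 4 * (4 * worstPhiMono s) := by gcongr; exact pow_le_worstPhiMono s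
      _ = _ := by rw [← mul_assoc]; norm_num
  · rcases m with _ | m
    · calc ((phiBound n v 0 : ℕ) : ℕ∞) ≤ 16 * 1 := by norm_num [phiBound]
        _ ≤ _ := by gcongr
    · have h₁ : phiBound n v (m + 1) ≤ 16 * lateCost n (m + v) := by
        have := (phiBound_le_pow_mul n v (m + 1)).trans (pow_mul_phiBound_le hn v (m + 1))
        rw [show m + 1 + v = m + v + 1 by omega] at this
        have := phiBound_le_lateCost (n := n) (by omega) (m + v)
        omega
      calc (phiBound n v (m + 1) : ℕ∞) ≤ 16 * (lateCost n (m + v) : ℕ) := by exact_mod_cast h₁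
        _ ≤ _ := by gcongr; exact lateCost_le_worstPhiMono (by omega)

theorem worstPhi_le (s : ℕ) : worstPhi s ≤ 16 * worstPhiMono s :=
  iSup_le fun o => iSup_le fun tl => iSup_le fun Vp => iSup_le fun N => iSup_le fun R =>
    iSup_le fun h => iSup_le fun _ => iSup_le fun _ =>
      (Nat.cast_le.2 (costBound_phi o tl Vp N R).cost_le).trans (phiBound_le_worstPhiMono h)

theorem worstPhiMono_le (s : ℕ) : worstPhiMono s ≤ worstPhi s := by
  refine iSup_le fun o => iSup_le fun opn => iSup_le fun N => iSup_le fun R => iSup_le fun h =>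
    iSup_le fun h' => ?_
  unfold worstPhi
  rw [← phi_ofBool]
  refine le_iSup_of_le o <| le_iSup_of_le (Tail.ofBool opn) <| le_iSup_of_le [] <|
    le_iSup_of_le (N.map fun Q => (Q.1, Tail.ofBool Q.2)) <| le_iSup_of_le R <|
    le_iSup_of_le (by simpa using h) <| le_iSup_of_le (by cases opn <;> simp [Tail.ofBool]) <|
    le_iSup_of_le ?_ le_rfl
  intro Q hQ
  obtain ⟨Q', hQ', rfl⟩ := List.mem_map.1 hQ
  exact h' Q' hQ'

theorem worstPhiMono_ne_top (s : ℕ) : worstPhiMono s ≠ ⊤ := by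
  refine ne_top_of_le_ne_top (ENat.natCast_ne_top (phiBound s 0 s)) ?_
  refine iSup_le fun o => iSup_le fun opn => iSup_le fun N => iSup_le fun R => iSup_le fun h =>
    iSup_le fun _ => ?_
  rw [← phi_ofBool]
  have := (costBound_phi o (Tail.ofBool opn) [] (N.map fun Q => (Q.1, Tail.ofBool Q.2)) R).cost_le
  rw [List.length_map] at this
  exact_mod_cast this.trans (phiBound_mono 0 (by omega) (by omega))

/-! ### Presentations of regular terms -/

theorem Node.toObj_ofObj {B X : Type} (o : (grammar B).Obj X) : (Node.ofObj o).toObj = o := by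
  obtain ⟨s, f⟩ := o
  cases s
  case record ls tl =>
    simp only [Node.ofObj, Node.toObj]
    have h : (List.ofFn fun k : Fin ls.length => (ls.get k, f k)).map Prod.fst = ls := by
      rw [List.map_ofFn]
      exact List.ofFn_get ls
    -- The rebuilt list has the labels `ls` only up to a propositional equality. Generalizing the
    -- list of fields allows `subst` to remove the dependency of the arity on it.
    have key : ∀ (fs : List (ℕ × X)) (h : fs.map Prod.fst = ls),
        (∀ k : Fin fs.length, (fs.get k).2 = f (Fin.cast (m := ls.length) (by rw [← h, List.length_map]) k)) →
        (⟨.record (fs.map Prod.fst) tl,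
          fun k => (fs.get (Fin.cast (List.length_map (as := fs) Prod.fst) k)).2⟩ :
            (grammar B).Obj X) = ⟨.record ls tl, f⟩ := by
      intro fs h hf
      subst h
      congr 1
      funext k
      exact hf _
    refine key _ h fun k => ?_
    simp
    rfl
  all_goals
    simp only [Node.ofObj, Node.toObj]
    congr 1
    funext k
    first
      | exact k.elim0
      | (fin_cases k <;> rfl)

theorem Term.dest_eq {B : Type} (t : Term B) : PFunctor.M.dest t = t.node.toObj :=
  (Node.toObj_ofObj _).symm

theorem Node.toObj_map {B X Y : Type} (f : X → Y) (n : Node B X) :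
    (n.map f).toObj = (grammar B).map f n.toObj := by
  rw [← Node.toObj_ofObj ((grammar B).map f n.toObj), Node.ofObj_map, Term.ofObj_toObj]

/-- Infinite terms form the final coalgebra of the grammar, so a system has only one solution. This
turns a family of terms that satisfies the equations into the unfolding. -/
theorem System.unfold_unique {B : Type} (S : System B) (f : ℕ → Term B)
    (h : ∀ i, (f i).node = (S.at i).map f) : f = S.unfold :=
  PFunctor.M.corec_unique _ _ fun i => by
    rw [Term.dest_eq, h, Node.toObj_map]
    rfl

theorem Node.map_id' {B X : Type} (f : X → X) (n : Node B X) (h : ∀ x ∈ n.subterms, f x = x) :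
    n.map f = n := by
  cases n <;> simp_all [Node.map, Node.subterms]
  case record fs tl =>
    conv_rhs => rw [← List.map_id fs]
    exact List.map_congr_left fun p hp => by rw [h p.2 p.1 hp]; rfl

theorem Node.map_map {B X Y Z : Type} (f : X → Y) (g : Y → Z) (n : Node B X) :
    (n.map f).map g = n.map (g ∘ f) := by
  cases n <;> simp [Node.map]

/-- A finite set of terms closed under subterms is presented by a finite system. -/
theorem exists_system {B : Type} (l : List (Term B))
    (h : ∀ t ∈ l, ∀ s, s.Child t → s ∈ l) :
    ∃ S : System B, ∀ t ∈ l, ∃ i, S.unfold i = t := by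
  classical
  -- The unknown `i` stands for the `i`-th term of the list. Beyond the list the default is `𝟘`, in
  -- accordance with the convention on unknowns without equation.
  let f : ℕ → Term B := fun i => l.getD i (.mk .empty)
  let S : System B := l.map fun t => t.node.map fun s => l.idxOf s
  have hf : ∀ s ∈ l, f (l.idxOf s) = s := fun s hs => by
    simp [f, List.getElem?_idxOf hs]
  have hS : f = S.unfold := by
    refine S.unfold_unique f fun i => ?_
    rcases Nat.lt_or_ge i l.length with hi | hi
    · have h₁ : f i = l[i] := by simp [f, hi]
      have h₂ : S.at i = (l[i]).node.map fun s => l.idxOf s := by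
        simp [System.at, S, hi]
      rw [h₁, h₂, Node.map_map]
      exact (Node.map_id' _ _ fun s hs => hf s (h _ (List.getElem_mem hi) s hs)).symm
    · have h₁ : f i = .mk .empty := by simp [f, hi]
      have h₂ : S.at i = .empty := by
        simp [System.at, S, hi]
      rw [h₁, h₂, Term.node_mk]
      rfl
  exact ⟨S, fun t ht => ⟨l.idxOf t, by rw [← hS, hf t ht]⟩⟩

theorem exists_presentation {B : Type} {t₁ t₂ : Term B} (h₁ : t₁.Regular) (h₂ : t₂.Regular) :
    ∃ (S : System B) (i j : ℕ), S.unfold i = t₁ ∧ S.unfold j = t₂ := by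
  obtain ⟨S, hS⟩ := exists_system (h₁.union h₂).toFinset.toList <| by
    intro t ht s hs
    simp only [Finset.mem_toList, Set.Finite.mem_toFinset, Set.mem_union, Set.mem_ofPred_eq]
      at ht ⊢
    exact ht.imp (fun h => .head hs h) (fun h => .head hs h)
  obtain ⟨i, hi⟩ := hS t₁ (by simpa using Or.inl .refl)
  obtain ⟨j, hj⟩ := hS t₂ (by simpa using Or.inr .refl)
  exact ⟨S, i, j, hi, hj⟩

/-! ### Connectives -/

section Sat

variable {B : Type} {v : Node B (Term B) → Prop} {t x y : Term B}

theorem sat_empty (h : t.node = .empty) : ¬ Sat v true t := by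
  intro hs
  generalize hb : true = b at hs
  cases hs <;> simp_all

theorem sat_false_empty (h : t.node = .empty) : Sat v false t := .empty h

theorem sat_neg (h : t.node = .neg x) (b : Bool) : Sat v b t ↔ Sat v (!b) x := by
  refine ⟨fun hs => ?_, fun hs => by simpa using Sat.neg h hs⟩
  cases hs <;> simp_all

theorem sat_or (h : t.node = .or x y) : Sat v true t ↔ Sat v true x ∨ Sat v true y := by
  refine ⟨fun hs => ?_, fun hs => hs.elim (.or_left h) (.or_right h)⟩
  generalize hb : true = b at hs
  cases hs <;> simp_all

theorem sat_false_or (h : t.node = .or x y) : Sat v false t ↔ Sat v false x ∧ Sat v false y := by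
  refine ⟨fun hs => ?_, fun hs => .or_false h hs.1 hs.2⟩
  generalize hb : false = b at hs
  cases hs <;> simp_all

/-- A layer that is not a connective. -/
def Node.IsAtom {X : Type} (n : Node B X) : Prop :=
  n ≠ .empty ∧ (∀ x, n ≠ .neg x) ∧ ∀ x y, n ≠ .or x y

theorem Node.IsAtom.map {X Y : Type} {n : Node B X} (h : n.IsAtom) (f : X → Y) :
    (n.map f).IsAtom := by
  cases n <;> simp_all [Node.IsAtom, Node.map]

theorem sat_atom (h : t.node.IsAtom) : Sat v true t ↔ v t.node := by
  refine ⟨fun hs => ?_, .atom h⟩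
  generalize hb : true = b at hs
  cases hs <;> simp_all [Node.IsAtom]

theorem sat_false_atom (h : t.node.IsAtom) : Sat v false t ↔ ¬ v t.node := by
  refine ⟨fun hs => ?_, .atom_false h⟩
  generalize hb : false = b at hs
  cases hs <;> simp_all [Node.IsAtom]

end Sat

-- Nesting of connectives in systems of equations

section System

variable {B : Type} (S : System B)

/-- The unknown `i` unfolds to fewer than `n` nested connectives. -/
def ConnDepth : ℕ → ℕ → Prop
  | 0, _ => False
  | n + 1, i => match S.at i with
    | .neg j => ConnDepth n j
    | .or j k => ConnDepth n j ∧ ConnDepth n k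
    | _ => True

/-- The unknown `j` occurs in the connective that defines the unknown `i`. -/
def Conn (i j : ℕ) : Prop :=
  S.at i = .neg j ∨ (∃ k, S.at i = .or j k) ∨ ∃ k, S.at i = .or k j

variable {S}

theorem Conn.lt_length {i j : ℕ} (h : Conn S i j) : i < S.length := by
  by_contra hi
  have : S.at i = .empty := by simp [System.at, not_lt.1 hi]
  simp [Conn, this] at h

theorem Conn.child {i j : ℕ} (h : Conn S i j) : (S.unfold j).Child (S.unfold i) := by
  unfold Term.Child
  rw [System.node_unfold]
  rcases h with h | ⟨k, h⟩ | ⟨k, h⟩ <;> simp [h, Node.map, Node.subterms]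

theorem Conn.not_isConstructor {i j : ℕ} (h : Conn S i j) :
    ¬ (S.unfold i).node.IsConstructor := by
  rw [System.node_unfold]
  rcases h with h | ⟨k, h⟩ | ⟨k, h⟩ <;> simp [h, Node.map, Node.IsConstructor]

/-- At each connective one of the operands must exceed the remaining depth; following it gives `n`
steps through connectives. Values of `p` beyond `n` are arbitrary. -/
theorem exists_path_of_not_connDepth {n i : ℕ} (h : ¬ ConnDepth S n i) :
    ∃ p : ℕ → ℕ, p 0 = i ∧ ∀ m < n, Conn S (p m) (p (m + 1)) := by
  induction n generalizing i with
  | zero => exact ⟨fun _ => i, rfl, by simp⟩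
  | succ n ih =>
    obtain ⟨j, hij, hj⟩ : ∃ j, Conn S i j ∧ ¬ ConnDepth S n j := by
      unfold ConnDepth at h
      split at h
      · exact ⟨_, .inl ‹_›, h⟩
      · rcases not_and_or.1 h with h | h
        · exact ⟨_, .inr (.inl ⟨_, ‹_›⟩), h⟩
        · exact ⟨_, .inr (.inr ⟨_, ‹_›⟩), h⟩
      · exact absurd trivial h
    obtain ⟨p, rfl, hp⟩ := ih hj
    refine ⟨fun m => m.casesOn i p, rfl, fun m hm => ?_⟩
    cases m with
    | zero => exact hij
    | succ m => exact hp m (by omega)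

/-- In a contractive term, connectives are nested at most as deeply as there are equations. -/
theorem connDepth_of_contractive {i : ℕ} (h : (S.unfold i).Contractive) :
    ConnDepth S (S.length + 1) i := by
  by_contra hd
  obtain ⟨p, rfl, hp⟩ := exists_path_of_not_connDepth hd
  obtain ⟨a, b, hab, hb, hpab⟩ : ∃ a b, a < b ∧ b < S.length + 1 ∧ p a = p b := by
    obtain ⟨a, b, hne, he⟩ := Fintype.exists_ne_map_eq_of_card_lt
      (fun m : Fin (S.length + 1) => (⟨p m, (hp m m.2).lt_length⟩ : Fin S.length)) (by simp)
    have he : p a = p b := congrArg Fin.val he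
    rcases lt_or_gt_of_ne hne with h | h
    · exact ⟨a, b, h, b.2, he⟩
    · exact ⟨b, a, h, a.2, he.symm⟩
  -- The index runs through `0, …, b - 1` and then returns to `a` instead of reaching `b`, since `p
  -- a = p b`. The path `p ∘ r` is infinite and meets connectives only.
  let r : ℕ → ℕ := fun m => Nat.rec 0 (fun _ q => if q + 1 = b then a else q + 1) m
  have hr : ∀ m, r (m + 1) = if r m + 1 = b then a else r m + 1 := fun m => rfl
  have hrb : ∀ m, r m < b := by
    intro m
    induction m with
    | zero => exact Nat.zero_lt_of_lt hab
    | succ m ih => rw [hr]; split <;> omega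
  have hc : ∀ m, Conn S (p (r m)) (p (r (m + 1))) := by
    intro m
    have := hp (r m) ((hrb m).trans hb)
    rw [hr]
    split
    · rwa [hpab, ← ‹_ = b›]
    · exact this
  obtain ⟨m, -, hm⟩ := h (fun m => S.unfold (p (r m))) rfl (fun m => (hc m).child) 0
  exact (hc m).not_isConstructor hm

/-- The two polarities are defined inductively, so on an infinite nest such as `t = ¬t` neither
would be derivable. Bounded nesting allows an induction that makes each the complement of the other.
-/
theorem sat_false_iff (v : Node B (Term B) → Prop) {n i : ℕ} (h : ConnDepth S n i) :
    Sat v false (S.unfold i) ↔ ¬ Sat v true (S.unfold i) := by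
  induction n generalizing i with
  | zero => exact h.elim
  | succ n ih =>
    have hn := S.node_unfold i
    unfold ConnDepth at h
    split at h
    · rename_i j hj
      rw [hj] at hn
      rw [sat_neg hn, sat_neg hn, Bool.not_false, Bool.not_true, ih h, not_not]
    · rename_i j k hj
      rw [hj] at hn
      rw [sat_false_or hn, sat_or hn, ih h.1, ih h.2, not_or]
    · rename_i h₁ h₂
      by_cases h₀ : S.at i = .empty
      · rw [h₀] at hn
        exact iff_of_true (sat_false_empty hn) (sat_empty hn)
      · have ha : (S.unfold i).node.IsAtom := by
          rw [hn]
          exact Node.IsAtom.map ⟨h₀, h₁, h₂⟩ _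
        rw [sat_false_atom ha, sat_atom ha]

end System

/-! ### Disjunctive normal forms -/

/-- A disjunctive normal form holds if the literals satisfy `P`. -/
def DnfHolds {α : Type} (P : α → Prop) (D : List (List α)) : Prop := ∃ c ∈ D, ∀ l ∈ c, P l

section DnfHolds

variable {α : Type} {P : α → Prop}

theorem dnfHolds_meet {D E : List (List α)} :
    DnfHolds P (meet D E) ↔ DnfHolds P D ∧ DnfHolds P E := by
  constructor
  · rintro ⟨c, hc, h⟩
    simp only [meet, List.mem_flatMap, List.mem_map] at hc
    obtain ⟨c₁, h₁, c₂, h₂, rfl⟩ := hc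
    exact ⟨⟨c₁, h₁, fun l hl => h l (by simp [hl])⟩, ⟨c₂, h₂, fun l hl => h l (by simp [hl])⟩⟩
  · rintro ⟨⟨c₁, h₁, h₁'⟩, ⟨c₂, h₂, h₂'⟩⟩
    refine ⟨c₁ ++ c₂, ?_, fun l hl => (List.mem_append.1 hl).elim (h₁' l) (h₂' l)⟩
    simp only [meet, List.mem_flatMap, List.mem_map]
    exact ⟨c₁, h₁, c₂, h₂, rfl⟩

theorem forall_meet {D E : List (List α)} (hD : ∀ c ∈ D, ∀ l ∈ c, P l)
    (hE : ∀ c ∈ E, ∀ l ∈ c, P l) : ∀ c ∈ meet D E, ∀ l ∈ c, P l := by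
  intro c hc l hl
  simp only [meet, List.mem_flatMap, List.mem_map] at hc
  obtain ⟨c₁, h₁, c₂, h₂, rfl⟩ := hc
  exact (List.mem_append.1 hl).elim (hD c₁ h₁ l) (hE c₂ h₂ l)

theorem dnfHolds_append {D E : List (List α)} :
    DnfHolds P (D ++ E) ↔ DnfHolds P D ∨ DnfHolds P E := by
  simp only [DnfHolds, List.mem_append, or_and_right, exists_or]

theorem dnfHolds_nil : ¬ DnfHolds P [] := by simp [DnfHolds]

theorem dnfHolds_singleton {c : List α} : DnfHolds P [c] ↔ ∀ l ∈ c, P l := by simp [DnfHolds]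

theorem dnfHolds_map {β : Type} (f : β → α) (D : List (List β)) :
    DnfHolds P (D.map fun c => c.map f) ↔ DnfHolds (fun b => P (f b)) D := by
  simp [DnfHolds]

theorem dnfHolds_foldr_meet {β : Type} {Q : β → Prop} (f : β → List (List α)) (g : List β)
    (h : ∀ b ∈ g, Q b ↔ DnfHolds P (f b)) :
    (∀ b ∈ g, Q b) ↔ DnfHolds P (g.foldr (fun b D => meet (f b) D) [[]]) := by
  induction g with
  | nil => simp [DnfHolds]
  | cons b g ih =>
    rw [List.foldr_cons, dnfHolds_meet, ← ih fun b' hb' => h b' (List.mem_cons_of_mem _ hb'),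
      ← h b List.mem_cons_self, List.forall_mem_cons]

theorem forall_foldr_meet {β : Type} (f : β → List (List α)) (g : List β)
    (h : ∀ b ∈ g, ∀ c ∈ f b, ∀ l ∈ c, P l) :
    ∀ c ∈ g.foldr (fun b D => meet (f b) D) [[]], ∀ l ∈ c, P l := by
  induction g with
  | nil => simp
  | cons b g ih =>
    exact forall_meet (h b List.mem_cons_self) (ih fun b' hb' => h b' (List.mem_cons_of_mem _ hb'))

end DnfHolds

section Dnf

variable {B : Type} {S : System B}

/-- The literal `l` holds under the interpretation `v` of the atoms. -/
def LitSat (S : System B) (v : Node B (Term B) → Prop) (l : Lit) : Prop :=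
  Sat v true (S.unfold l.2) ↔ l.1 = true

/-- When its bound is exhausted `dnfLit` returns the unsatisfiable form `[]`, whatever the literal;
`ConnDepth` ensures that this case is never reached. Negation needs `sat_false_iff` to exchange the
signs. -/
theorem dnfHolds_dnfLit (v : Node B (Term B) → Prop) {n : ℕ} {l : Lit}
    (h : ConnDepth S n l.2) : LitSat S v l ↔ DnfHolds (LitSat S v) (dnfLit S n l) := by
  induction n generalizing l with
  | zero => exact h.elim
  | succ n ih =>
    obtain ⟨p, i⟩ := l
    have hn := S.node_unfold i
    have h' := h
    unfold ConnDepth at h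
    unfold dnfLit
    split
    · rw [‹S.at i = _›] at hn
      simp [LitSat, dnfHolds_nil, sat_empty hn]
    · rw [‹S.at i = _›] at hn
      simp [LitSat, dnfHolds_singleton, sat_empty hn]
    · rename_i j hj
      rw [hj] at hn h
      rw [← ih h]
      simp only [LitSat]
      rw [sat_neg hn, Bool.not_true, sat_false_iff v h]
      simp only [Bool.not_eq_true', ← Bool.not_eq_true]
      tauto
    · rename_i j k hj
      rw [hj] at hn h
      rw [dnfHolds_append, ← ih h.1, ← ih h.2]
      simp [LitSat, sat_or hn]
    · rename_i j k hj
      rw [hj] at hn h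
      rw [dnfHolds_meet, ← ih h.1, ← ih h.2]
      simp [LitSat, sat_or hn]
    · rw [dnfHolds_singleton, List.forall_mem_singleton]

/-- The literals of the clauses of a normal form are on atoms, and have any property that is
inherited through connectives. -/
theorem forall_dnfLit {G : ℕ → Prop} (hG : ∀ i j, G i → Conn S i j → G j) {n : ℕ} {l : Lit}
    (h : G l.2) : ∀ c ∈ dnfLit S n l, ∀ l' ∈ c, G l'.2 ∧ (S.at l'.2).IsAtom := by
  induction n generalizing l with
  | zero => simp [dnfLit]
  | succ n ih =>
    obtain ⟨p, i⟩ := l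
    unfold dnfLit
    split
    · simp
    · simp
    · exact ih (hG _ _ h (.inl ‹_›))
    · rename_i j k hj
      intro c hc
      exact (List.mem_append.1 hc).elim
        (fun hc => ih (hG _ _ h (.inr (.inl ⟨k, hj⟩))) c hc)
        (fun hc => ih (hG _ _ h (.inr (.inr ⟨j, hj⟩))) c hc)
    · rename_i j k hj
      exact forall_meet (ih (hG _ _ h (.inr (.inl ⟨k, hj⟩))))
        (ih (hG _ _ h (.inr (.inr ⟨j, hj⟩))))
    · rename_i h₁ h₂ h₃ h₄ h₅
      simp only [List.mem_singleton, forall_eq]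
      exact ⟨h, fun e => (Bool.eq_false_or_eq_true _).elim (h₂ e) (h₃ e), h₁,
        fun x y e => (Bool.eq_false_or_eq_true _).elim (h₄ x y e) (h₅ x y e)⟩

theorem dnfHolds_dnf (v : Node B (Term B) → Prop) {g : List Lit}
    (h : ∀ l ∈ g, ConnDepth S (S.length + 1) l.2) :
    (∀ l ∈ g, LitSat S v l) ↔ DnfHolds (LitSat S v) (dnf S g) :=
  dnfHolds_foldr_meet _ g fun l hl => dnfHolds_dnfLit v (h l hl)

theorem forall_dnf {G : ℕ → Prop} (hG : ∀ i j, G i → Conn S i j → G j) {g : List Lit}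
    (h : ∀ l ∈ g, G l.2) : ∀ c ∈ dnf S g, ∀ l ∈ c, G l.2 ∧ (S.at l.2).IsAtom :=
  forall_foldr_meet _ g fun l hl => forall_dnfLit hG (h l hl)

theorem litSat_atom (v : Node B (Term B) → Prop) {l : Lit} (h : (S.at l.2).IsAtom) :
    LitSat S v l ↔ (v ((S.at l.2).map S.unfold) ↔ l.1 = true) := by
  unfold LitSat
  rw [sat_atom (by rw [System.node_unfold]; exact h.map _), System.node_unfold]

end Dnf

/-! ### Well-formed unknowns -/

/-- The unknowns of the kinds given by `G` are well-formed: they satisfy the kinding rules and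
connectives are boundedly nested in them. -/
structure WellFormed {B : Type} (off : ℕ → Finset ℕ) (S : System B) (G : Kind → ℕ → Prop) :
    Prop where
  kinded : ∀ k i, G k i → KindRule off G k (S.at i)
  depth : ∀ k i, G k i → ConnDepth S (S.length + 1) i

/-- The unknowns of the kinds given by `G` are closed under subterms. -/
structure KindClosed {B : Type} (S : System B) (G : Kind → ℕ → Prop) : Prop where
  conn : ∀ k i j, G k i → Conn S i j → G k j
  ofType : ∀ i j, G .field i → S.at i = .ofType j → G .type j
  arrow : ∀ i j k, G .type i → S.at i = .arrow j k → G .type j ∧ G .type k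
  record : ∀ i fs tl, G .type i → S.at i = .record fs tl → ∀ p ∈ fs, G .field p.2

theorem WellFormed.closed {B : Type} {off : ℕ → Finset ℕ} {S : System B} {G : Kind → ℕ → Prop}
    (h : WellFormed off S G) : KindClosed S G where
  conn k i j hi hij := by
    have := h.kinded k i hi
    rcases hij with e | ⟨_, e⟩ | ⟨_, e⟩ <;> rw [e] at this <;> cases k
    exacts [this, this, this.1, this.1, this.2, this.2]
  ofType i j hi e := by
    have := h.kinded _ i hi
    rwa [e] at this
  arrow i j k hi e := by
    have := h.kinded _ i hi
    rwa [e] at this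
  record i fs tl hi e := by
    have := h.kinded _ i hi
    rw [e] at this
    exact this.2.1

theorem Term.Contractive.child {B : Type} {s t : Term B} (h : t.Contractive) (hs : s.Child t) :
    s.Contractive := by
  intro b hb hc n
  obtain ⟨m, hm, hm'⟩ := h (fun m => m.casesOn t b) rfl
    (fun m => by
      cases m with
      | zero => subst hb; exact hs
      | succ m => exact hc m) (n + 1)
  obtain ⟨m, rfl⟩ : ∃ m', m = m' + 1 := ⟨m - 1, by omega⟩
  exact ⟨m, by omega, hm'⟩

theorem kindRule_of_map {B X Y : Type} {off : ℕ → Finset ℕ} {R : Kind → Y → Prop} {f : X → Y}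
    {G : Kind → X → Prop} {k : Kind} {n : Node B X} (h : KindRule off R k (n.map f))
    (hG : ∀ k, ∀ x ∈ n.subterms, R k (f x) → G k x) : KindRule off G k n := by
  cases n <;> cases k <;>
    simp_all [KindRule, Node.map, Node.subterms, Function.comp_def]
  case record fs tl =>
    exact fun a b hab => hG _ _ _ hab (h.2.1 _ _ _ _ hab rfl rfl)

/-- The instance used for correctness. Contractivity passes to subterms, and the relation `R` that
witnesses the kind of a term also witnesses the kinds of its subterms. -/
theorem wellFormed_of_contractive {B : Type} (off : ℕ → Finset ℕ) (S : System B) :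
    WellFormed off S fun k i => (S.unfold i).Contractive ∧ HasKind off k (S.unfold i) where
  kinded k i := by
    rintro ⟨hc, R, hR, hR'⟩
    have := hR' _ _ hR
    rw [System.node_unfold] at this
    refine kindRule_of_map this fun k' j hj hRj => ⟨hc.child ?_, R, hRj, hR'⟩
    unfold Term.Child
    rw [System.node_unfold]
    cases h : S.at i <;> rw [h] at hj <;> simp_all [Node.map, Node.subterms]
    all_goals grind
  depth k i h := connDepth_of_contractive h.1

/-! ### Membership in atoms and in fields -/

section Membership

variable {B C : Type} {interp : B → Set C}

/-- Membership of a value in an atom. -/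
def AtomMem (interp : B → Set C) (d : Dom C) (n : Node B (Term B)) : Prop :=
  match n with
  | .tvar α => Var.ty α ∈ d.tag
  | .basic b => match d with
    | .const c _ => c ∈ interp b
    | _ => False
  | .arrow x y => match d with
    | .func n arg res _ => ∀ i : Fin n, Mem interp (arg i) x → MemOmega interp (res i) y
    | _ => False
  | .record fs tl => match d with
    | .record L val Vr _ =>
        (∀ ℓ : {ℓ // ℓ ∈ L}, MemUndef interp (val ℓ) (fieldOf fs tl ℓ)) ∧
        (∀ ℓ, ℓ ∉ L → MemBot ∅ (fieldOf fs tl ℓ)) ∧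
        (∀ ρ, tl = .row ρ → Var.row ρ ∈ Vr)
    | _ => False
  | _ => False

/-- The three clauses that define `Mem` become one, so that the facts on connectives and normal
forms apply uniformly to all values. -/
theorem mem_eq_sat (d : Dom C) (t : Term B) : Mem interp d t = Sat (AtomMem interp d) true t := by
  cases d
  · rw [Mem.eq_1]
    congr 1
    funext n
    cases n <;> rfl
  · rw [Mem.eq_2]
    congr 1
    funext n
    cases n <;> rfl
  · rw [Mem.eq_3]
    congr 1
    funext n
    cases n <;> rfl

theorem mem_any (d : Dom C) : Mem interp d .any := by
  rw [mem_eq_sat, Term.any, sat_neg (Term.node_mk _)]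
  exact sat_false_empty (Term.node_mk _)

theorem isAtom_undef {X : Type} : (Node.undef : Node B X).IsAtom := by simp [Node.IsAtom]

theorem isAtom_ofType {X : Type} (x : X) : (Node.ofType x : Node B X).IsAtom := by
  simp [Node.IsAtom]

/-- Membership of a value, or of the tagged `⊥`, in an atom. -/
def FldAtomMem (interp : B → Set C) (x : DomUndef C) (n : Node B (Term B)) : Prop :=
  match n with
  | .ofType t => match x with
    | .val d => Mem interp d t
    | .undef _ => False
  | .undef => match x with
    | .val _ => False
    | .undef _ => True
  | .fvar θ => match x with
    | .val d => Var.fld θ ∈ d.tag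
    | .undef V => Var.fld θ ∈ V
  | _ => False

theorem memUndef_eq_sat (x : DomUndef C) (t : Term B) :
    MemUndef interp x t = Sat (FldAtomMem interp x) true t := by
  cases x
  · rw [MemUndef.eq_1]
    congr 1
    funext n
    cases n <;> rfl
  · rw [MemUndef.eq_2, MemBot]
    congr 1
    funext n
    cases n <;> rfl

/-- Membership in a field of a record type of a system. -/
def FldMem (interp : B → Set C) (S : System B) (x : DomUndef C) : Fld → Prop
  | .top => True
  | .absent => ∃ V, x = .undef V
  | .ref i => MemUndef interp x (S.unfold i)

theorem memUndef_undef (x : DomUndef C) :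
    MemUndef interp x .undef ↔ ∃ V, x = .undef V := by
  have : (Term.undef : Term B).node = .undef := Term.node_mk _
  rw [memUndef_eq_sat, sat_atom (by rw [this]; exact isAtom_undef), this]
  cases x <;> simp [FldAtomMem]

theorem memUndef_anyOrUndef (x : DomUndef C) : MemUndef interp x .anyOrUndef := by
  rw [memUndef_eq_sat, Term.anyOrUndef, sat_or (Term.node_mk _), ← memUndef_eq_sat,
    ← memUndef_eq_sat, memUndef_undef]
  cases x with
  | val d =>
    left
    rw [memUndef_eq_sat, sat_atom (by rw [Term.node_mk]; exact isAtom_ofType _), Term.node_mk]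
    exact mem_any d
  | undef V => exact .inr ⟨V, rfl⟩

theorem lookup_map {X Y : Type} (f : X → Y) (fs : List (ℕ × X)) (ℓ : ℕ) :
    (fs.map fun p => (p.1, f p.2)).lookup ℓ = (fs.lookup ℓ).map f := by
  induction fs with
  | nil => rfl
  | cons p fs ih =>
    obtain ⟨ℓ', x⟩ := p
    by_cases h : ℓ == ℓ' <;> simp [List.lookup_cons, h, ih]

/-- Links the field-types of the semantics with the symbolic fields handled by the algorithm. Away
from the explicit labels, open tails and row variables alike impose nothing on the field. -/
theorem memUndef_fieldOf (S : System B) (R : Rec) (x : DomUndef C) (ℓ : ℕ) :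
    MemUndef interp x (fieldOf (R.1.map fun p => (p.1, S.unfold p.2)) R.2 ℓ) ↔
      FldMem interp S x (R.fieldAt ℓ) := by
  obtain ⟨fs, tl⟩ := R
  simp only [fieldOf, Rec.fieldAt, lookup_map]
  cases fs.lookup ℓ with
  | some i => exact Iff.rfl
  | none =>
    cases tl
    · exact memUndef_undef x
    · exact iff_of_true (memUndef_anyOrUndef x) trivial
    · exact iff_of_true (memUndef_anyOrUndef x) trivial

/-- The field of a record value at a label. -/
def rowAt (L : Finset ℕ) (val : {ℓ // ℓ ∈ L} → DomUndef C) (ℓ : ℕ) : DomUndef C :=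
  if h : ℓ ∈ L then val ⟨ℓ, h⟩ else .undef ∅

/-- Membership in a record type of a system. -/
def RecMem (interp : B → Set C) (S : System B) (d : Dom C) (R : Rec) : Prop :=
  AtomMem interp d ((Node.record R.1 R.2).map S.unfold)

/-- With `rowAt` a record value is a total function on labels, and the two conditions for labels
inside and outside `L` merge into one. -/
theorem recMem_record {S : System B} {R : Rec} {L : Finset ℕ}
    {val : {ℓ // ℓ ∈ L} → DomUndef C} {Vr V : Finset Var} :
    RecMem interp S (.record L val Vr V) R ↔
      (∀ ℓ, FldMem interp S (rowAt L val ℓ) (R.fieldAt ℓ)) ∧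
        ∀ ρ, R.2 = .row ρ → Var.row ρ ∈ Vr := by
  simp only [← memUndef_fieldOf]
  have : ∀ t : Term B, MemBot ∅ t ↔ MemUndef interp (.undef ∅ : DomUndef C) t := fun t => by
    rw [MemUndef.eq_2]
  simp only [RecMem, AtomMem, Node.map, this, ← and_assoc]
  refine and_congr_left' ⟨fun h ℓ => ?_, fun h => ⟨fun ℓ => ?_, fun ℓ hℓ => ?_⟩⟩
  · unfold rowAt
    split
    · exact h.1 ⟨ℓ, ‹_›⟩
    · exact h.2 ℓ ‹_›
  · simpa [rowAt] using h ℓ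
  · simpa [rowAt, hℓ] using h ℓ

/-- The same value with another tag. -/
def retag (V : Finset Var) : Dom C → Dom C
  | .const c _ => .const c V
  | .func n arg res _ => .func n arg res V
  | .record L val Vr _ => .record L val Vr V

theorem tag_retag (V : Finset Var) (d : Dom C) : (retag V d).tag = V := by cases d <;> rfl

/-- Membership in types depends on the type variables of the tag only. -/
theorem mem_retag {V : Finset Var} {d : Dom C} (h : ∀ α, Var.ty α ∈ V ↔ Var.ty α ∈ d.tag)
    (t : Term B) : Mem interp (retag V d) t ↔ Mem interp d t := by
  rw [mem_eq_sat, mem_eq_sat]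
  suffices AtomMem interp (retag V d) = AtomMem interp d by rw [this]
  funext n
  cases n <;> cases d <;> first | rfl | exact propext (h _)

/-- The goal `g` holds at the value `d`. -/
def GoalMem (interp : B → Set C) (S : System B) (d : Dom C) (g : List Lit) : Prop :=
  ∀ l ∈ g, (Mem interp d (S.unfold l.2) ↔ l.1 = true)

theorem goalMem_iff {S : System B} {d : Dom C} {g : List Lit} :
    GoalMem interp S d g ↔ ∀ l ∈ g, LitSat S (AtomMem interp d) l := by
  simp only [GoalMem, mem_eq_sat, LitSat]

/-- The conjunction `g` of fields holds at `x`. -/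
def FldGoalMem (interp : B → Set C) (S : System B) (x : DomUndef C) (g : FldGoal) : Prop :=
  ∀ l ∈ g, (FldMem interp S x l.2 ↔ l.1 = true)

end Membership

/-! ### Results of runs -/

/-- The run terminates with the result `b`. -/
def Run.Is (x : Run Bool) (b : Bool) : Prop := ∃ k, x = some (b, k)

namespace Run

variable {x y : Run Bool} {b : Bool}

theorem is_ret {b' : Bool} : (ret b').Is b ↔ b' = b := by simp [Is, ret]

theorem is_tick {n : ℕ} : (x.tick n).Is b ↔ x.Is b := by
  rcases x with _ | ⟨b', c⟩ <;> simp [Is, tick]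

theorem is_or_true : (x.or y).Is true ↔ x.Is true ∨ x.Is false ∧ y.Is true := by
  rcases x with _ | ⟨_ | _, c⟩
  · simp [Is, Run.or]
  · refine is_tick.trans ?_
    simp [Is]
  · simp [Is, Run.or]

theorem is_or_false : (x.or y).Is false ↔ x.Is false ∧ y.Is false := by
  rcases x with _ | ⟨_ | _, c⟩
  · simp [Is, Run.or]
  · refine is_tick.trans ?_
    simp [Is]
  · simp [Is, Run.or]

theorem is_and_true : (x.and y).Is true ↔ x.Is true ∧ y.Is true := by
  rcases x with _ | ⟨_ | _, c⟩
  · simp [Is, Run.and]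
  · simp [Is, Run.and]
  · refine is_tick.trans ?_
    simp [Is]

theorem is_and_false : (x.and y).Is false ↔ x.Is false ∨ x.Is true ∧ y.Is false := by
  rcases x with _ | ⟨_ | _, c⟩
  · simp [Is, Run.and]
  · simp [Is, Run.and]
  · refine is_tick.trans ?_
    simp [Is]

variable {α : Type} {l : List α} {f : α → Run Bool}

theorem is_all_true : (all l f).Is true ↔ ∀ a ∈ l, (f a).Is true := by
  induction l with
  | nil => simp [all, is_ret]
  | cons a l ih =>
    rw [List.forall_mem_cons, ← ih]
    exact is_and_true

/-- Only this direction holds: a failing element does not determine the result, because an earlier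
one may not terminate. -/
theorem exists_of_is_all_false (h : (all l f).Is false) : ∃ a ∈ l, (f a).Is false := by
  induction l with
  | nil => simp [all, is_ret] at h
  | cons a l ih =>
    rcases is_and_false.1 h with h | ⟨-, h⟩
    · exact ⟨a, List.mem_cons_self, h⟩
    · obtain ⟨a', ha', h⟩ := ih h
      exact ⟨a', List.mem_cons_of_mem _ ha', h⟩

theorem is_any_false : (any l f).Is false ↔ ∀ a ∈ l, (f a).Is false := by
  induction l with
  | nil => simp [any, is_ret]
  | cons a l ih =>
    rw [List.forall_mem_cons, ← ih]
    exact is_or_false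

theorem exists_of_is_any_true (h : (any l f).Is true) : ∃ a ∈ l, (f a).Is true := by
  induction l with
  | nil => simp [any, is_ret] at h
  | cons a l ih =>
    rcases is_or_true.1 h with h | ⟨-, h⟩
    · exact ⟨a, List.mem_cons_self, h⟩
    · obtain ⟨a', ha', h⟩ := ih h
      exact ⟨a', List.mem_cons_of_mem _ ha', h⟩

end Run

section Step

variable {B C : Type} {interp : B → Set C} {off : ℕ → Finset ℕ} {S : System B}
  {G : Kind → ℕ → Prop}

/-! ### Emptiness of conjunctions of fields -/

/-- If the field is an unknown, then it is one of the well-formed unknowns `G`. -/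
def GoodFld (G : Kind → ℕ → Prop) : Fld → Prop
  | .ref i => G .field i
  | _ => True

theorem dnfHolds_dnfFld (hG : WellFormed off S G) (x : DomUndef C) {g : FldGoal}
    (h : ∀ l ∈ g, GoodFld G l.2) :
    FldGoalMem interp S x g ↔
      DnfHolds (fun l : Bool × Fld => FldMem interp S x l.2 ↔ l.1 = true) (dnfFld S g) := by
  refine dnfHolds_foldr_meet _ g fun l hl => ?_
  have hl := h l hl
  obtain ⟨p, f⟩ := l
  cases f with
  | top => cases p <;> simp [dnfFldLit, FldMem, dnfHolds_nil, dnfHolds_singleton]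
  | absent => simp [dnfFldLit, dnfHolds_singleton]
  | ref i =>
    simp only [dnfFldLit]
    rw [dnfHolds_map]
    have := dnfHolds_dnfLit (FldAtomMem interp x) (l := (p, i)) (hG.depth _ _ hl)
    unfold LitSat at this
    simp only [← memUndef_eq_sat] at this
    exact this

theorem forall_dnfFld (hG : KindClosed S G) {g : FldGoal} (h : ∀ l ∈ g, GoodFld G l.2) :
    ∀ c ∈ dnfFld S g, ∀ l ∈ c,
      l.2 = .absent ∨ ∃ i, l.2 = .ref i ∧ G .field i ∧ (S.at i).IsAtom := by
  refine forall_foldr_meet _ g fun l hl => ?_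
  have hl := h l hl
  obtain ⟨p, f⟩ := l
  cases f with
  | top => cases p <;> simp [dnfFldLit]
  | absent => simp [dnfFldLit]
  | ref i =>
    simp only [dnfFldLit, List.mem_map]
    rintro _ ⟨c, hc, rfl⟩ l hl'
    obtain ⟨l', hl'', rfl⟩ := List.mem_map.1 hl'
    exact .inr ⟨l'.2, rfl, forall_dnfLit (hG.conn .field) (l := (p, i)) hl c hc l' hl''⟩

theorem mem_fvarsOf {p : Bool} {c : FldGoal} {θ : ℕ} :
    θ ∈ fvarsOf S p c ↔ ∃ i, (p, Fld.ref i) ∈ c ∧ S.at i = .fvar θ := by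
  simp only [fvarsOf, List.mem_filterMap]
  constructor
  · rintro ⟨⟨q, f⟩, hl, h⟩
    cases f with
    | ref i => (cases hi : S.at i <;> simp_all); grind
    | _ => simp at h
  · rintro ⟨i, hl, h⟩
    exact ⟨_, hl, by simp [h]⟩

theorem undefIn_iff {p : Bool} {c : FldGoal} : undefIn S p c = true ↔
    (p, Fld.absent) ∈ c ∨ ∃ i, (p, Fld.ref i) ∈ c ∧ S.at i = .undef := by
  simp only [undefIn, List.any_eq_true]
  constructor
  · rintro ⟨⟨q, f⟩, hl, h⟩
    cases f with
    | ref i => (cases hi : S.at i <;> simp_all); exact .inr ⟨i, hl, hi⟩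
    | _ => simp_all
  · rintro (hl | ⟨i, hl, h⟩)
    · exact ⟨_, hl, by simp⟩
    · exact ⟨_, hl, by simp [h]⟩

theorem mem_typesOf {l : Lit} {c : FldGoal} :
    l ∈ typesOf S c ↔ ∃ i, (l.1, Fld.ref i) ∈ c ∧ S.at i = .ofType l.2 := by
  simp only [typesOf, List.mem_filterMap]
  constructor
  · rintro ⟨⟨q, f⟩, hl, h⟩
    cases f with
    | ref i => (cases hi : S.at i <;> simp_all); grind
    | _ => simp at h
  · rintro ⟨i, hl, h⟩
    exact ⟨_, hl, by simp [h]⟩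

theorem fldMem_ref {x : DomUndef C} {i : ℕ} (h : (S.at i).IsAtom) :
    FldMem interp S x (.ref i) ↔ FldAtomMem interp x ((S.at i).map S.unfold) := by
  rw [FldMem, memUndef_eq_sat, sat_atom (by rw [System.node_unfold]; exact h.map _),
    System.node_unfold]

theorem fldAtomMem_undef {x : DomUndef C} :
    FldAtomMem interp x .undef ↔ ∃ V, x = .undef V := by
  cases x <;> simp [FldAtomMem]

/-- A clause of fields holds if the field variables, `⊥` and the types in it do. -/
theorem fldClause_iff (hG : WellFormed off S G) {x : DomUndef C} {c : FldGoal}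
    (hc : ∀ l ∈ c, l.2 = .absent ∨ ∃ i, l.2 = .ref i ∧ G .field i ∧ (S.at i).IsAtom) :
    (∀ l ∈ c, (FldMem interp S x l.2 ↔ l.1 = true)) ↔
      (∀ p, ∀ θ ∈ fvarsOf S p c, (FldAtomMem interp x (.fvar θ) ↔ p = true)) ∧
      (∀ p, undefIn S p c = true → ((∃ V, x = .undef V) ↔ p = true)) ∧
      ∀ l ∈ typesOf S c, (FldAtomMem interp x (.ofType (S.unfold l.2)) ↔ l.1 = true) := by
  have hat : ∀ p i, (p, Fld.ref i) ∈ c → G .field i ∧ (S.at i).IsAtom := by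
    intro p i hl
    obtain h | ⟨j, h, h'⟩ := hc _ hl
    · simp at h
    · cases h
      exact h'
  constructor
  · intro h
    refine ⟨fun p θ hθ => ?_, fun p hp => ?_, fun l hl => ?_⟩
    · obtain ⟨i, hl, hi⟩ := mem_fvarsOf.1 hθ
      have := h _ hl
      rwa [fldMem_ref (hat _ _ hl).2, hi] at this
    · obtain hl | ⟨i, hl, hi⟩ := undefIn_iff.1 hp
      · exact h _ hl
      · have := h _ hl
        rwa [fldMem_ref (hat _ _ hl).2, hi, Node.map, fldAtomMem_undef] at this
    · obtain ⟨i, hl, hi⟩ := mem_typesOf.1 hl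
      have := h _ hl
      rwa [fldMem_ref (hat _ _ hl).2, hi] at this
  · rintro ⟨h₁, h₂, h₃⟩ ⟨p, f⟩ hl
    obtain rfl | ⟨i, rfl, hi, ha⟩ := hc _ hl
    · exact h₂ p (undefIn_iff.2 (.inl hl))
    · rw [fldMem_ref ha]
      have hk := hG.kinded _ _ hi
      cases hn : S.at i with
      | fvar θ => exact h₁ p θ (mem_fvarsOf.2 ⟨i, hl, hn⟩)
      | undef => exact fldAtomMem_undef.trans (h₂ p (undefIn_iff.2 (.inr ⟨i, hl, hn⟩)))
      | ofType j => exact h₃ (p, j) (mem_typesOf.2 ⟨i, hl, hn⟩)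
      | empty => exact absurd hn ha.1
      | neg j => exact absurd hn (ha.2.1 j)
      | or j k => exact absurd hn (ha.2.2 j k)
      | _ => rw [hn] at hk; exact hk.elim

theorem forall_typesOf (hG : KindClosed S G) {c : FldGoal}
    (hc : ∀ l ∈ c, l.2 = .absent ∨ ∃ i, l.2 = .ref i ∧ G .field i ∧ (S.at i).IsAtom) :
    ∀ l ∈ typesOf S c, G .type l.2 := by
  intro l hl
  obtain ⟨i, hl, hi⟩ := mem_typesOf.1 hl
  obtain h | ⟨j, h, hj, -⟩ := hc _ hl
  · simp at h
  · cases h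
    exact hG.ofType _ _ hj hi

/-- The values among the fields of `x` satisfy `P`. -/
def DomUndef.All (P : Dom C → Prop) (x : DomUndef C) : Prop := ∀ d, x = .val d → P d

variable (interp S G) in
/-- A positive answer of the test on a goal excludes the values satisfying `P` from the goal. -/
def TestSound (P : Dom C → Prop) (test : List Lit → Run Bool) : Prop :=
  ∀ g, (∀ l ∈ g, G .type l.2) → (test g).Is true → ∀ d, P d → ¬ GoalMem interp S d g

variable (interp S G) in
/-- A negative answer of the test on a goal is witnessed by a value. -/
def TestComplete (test : List Lit → Run Bool) : Prop :=
  ∀ g, (∀ l ∈ g, G .type l.2) → (test g).Is false → ∃ d, GoalMem interp S d g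

/-- If no field variable clashes, a positive answer excludes `⊥` (through a negated `⊥` or a
positive type) and also excludes values (through a positive `⊥` or emptiness of the types). The
predicate `P` later limits the height of the values considered. -/
theorem fldEmpty_sound (hG : WellFormed off S G) {P : Dom C → Prop} {test : List Lit → Run Bool}
    (hT : TestSound interp S G P test) {g : FldGoal} (hg : ∀ l ∈ g, GoodFld G l.2)
    (h : (fldEmpty S test g).Is true) {x : DomUndef C} (hx : x.All P) :
    ¬ FldGoalMem interp S x g := by
  rw [dnfHolds_dnfFld hG x hg]
  rintro ⟨c, hc, hxc⟩
  have hat := forall_dnfFld hG.closed hg c hc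
  rw [fldClause_iff hG hat] at hxc
  obtain ⟨h₁, h₂, h₃⟩ := hxc
  rw [fldEmpty, Run.is_tick, Run.is_all_true] at h
  have h := h c hc
  simp only [Run.is_or_true, Run.is_and_true, Run.is_ret] at h
  rcases h with h | ⟨-, hneg, hpos⟩
  · simp only [List.any_eq_true, decide_eq_true_eq] at h
    obtain ⟨θ, ht, hf⟩ := h
    have := (h₁ _ θ hf).1 ((h₁ _ θ ht).2 rfl)
    simp at this
  · cases x with
    | undef V =>
      rw [Bool.or_eq_true] at hneg
      rcases hneg with h | h
      · have := (h₂ _ h).1 ⟨V, rfl⟩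
        simp at this
      · simp only [List.any_eq_true] at h
        obtain ⟨l, hl, hp⟩ := h
        exact (h₃ l hl).2 hp
    | val d =>
      rcases hpos with h | ⟨-, h⟩
      · obtain ⟨V, hV⟩ := (h₂ _ h).2 rfl
        cases hV
      · exact hT _ (forall_typesOf hG.closed hat) h d (hx d rfl) h₃

/-- Either `⊥` is not excluded, and a tagged `⊥` is the witness, or the test on types provides a
value. In both cases the tag is adjusted to contain exactly the field variables that occur
positively. -/
theorem fldEmpty_complete (hG : WellFormed off S G) {test : List Lit → Run Bool}
    (hT : TestComplete (C := C) interp S G test) {g : FldGoal} (hg : ∀ l ∈ g, GoodFld G l.2)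
    (h : (fldEmpty S test g).Is false) : ∃ x : DomUndef C, FldGoalMem interp S x g := by
  classical
  rw [fldEmpty, Run.is_tick] at h
  obtain ⟨c, hc, h⟩ := Run.exists_of_is_all_false h
  have hat := forall_dnfFld hG.closed hg c hc
  simp only [Run.is_or_false, Run.is_and_false, Run.is_ret] at h
  obtain ⟨hθ, h⟩ := h
  simp only [List.any_eq_false, decide_eq_true_eq] at hθ
  let W : Finset Var := (fvarsOf S true c).toFinset.image .fld
  have hW : ∀ θ, Var.fld θ ∈ W ↔ θ ∈ fvarsOf S true c := by simp [W]
  have hW' : ∀ p, ∀ θ ∈ fvarsOf S p c, (Var.fld θ ∈ W ↔ p = true) := by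
    rintro (_ | _) θ h
    · simpa [hW] using fun h' => hθ θ h' h
    · simpa [hW] using h
  rcases h with h | ⟨-, hpos, h⟩
  · rw [Bool.or_eq_false_iff, List.any_eq_false] at h
    refine ⟨.undef W, (dnfHolds_dnfFld hG _ hg).2 ⟨c, hc, (fldClause_iff hG hat).2
      ⟨hW', fun p hp => ?_, fun l hl => ?_⟩⟩⟩
    · cases p
      · exact absurd hp (by simp [h.1])
      · simp
    · simpa [FldAtomMem] using h.2 l hl
  · obtain ⟨d, hd⟩ := hT _ (forall_typesOf hG.closed hat) h
    -- Only the field variables of the tag are replaced, so the value stays in the same types.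
    let V : Finset Var := (d.tag.filter fun v => ∀ θ, v ≠ .fld θ) ∪ W
    have hV : ∀ α, Var.ty α ∈ V ↔ Var.ty α ∈ d.tag := by simp [V, W]
    have hV' : ∀ θ, Var.fld θ ∈ V ↔ Var.fld θ ∈ W := by simp [V]
    refine ⟨.val (retag V d), (dnfHolds_dnfFld hG _ hg).2 ⟨c, hc, (fldClause_iff hG hat).2
      ⟨fun p θ hp => ?_, fun p hp => ?_, fun l hl => ?_⟩⟩⟩
    · simp only [FldAtomMem, tag_retag, hV']
      exact hW' p θ hp
    · cases p
      · simp
      · exact absurd hp (by simp [hpos])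
    · simp only [FldAtomMem, mem_retag hV]
      exact hd l hl

/-! ### The procedure `Φ` -/

/-- The tail `tl'` does not separate a negative record type from the positive part. -/
def TailCond (tl : Tail) (Vp : List ℕ) (tl' : Tail) : Prop :=
  tl' = .opened ∨ tl' = tl ∨ ∃ ρ ∈ Vp, tl' = .row ρ

theorem fldGoalMem_append_singleton {x : DomUndef C} {g : FldGoal} {f : Fld} :
    FldGoalMem interp S x (g ++ [(false, f)]) ↔
      FldGoalMem interp S x g ∧ ¬ FldMem interp S x f := by
  simp only [FldGoalMem, List.mem_append, List.mem_singleton, or_imp, forall_and, forall_eq]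
  simp

theorem forall_getD {α : Type} {P : α → Prop} {l : List α} {a : α} (h : ∀ b ∈ l, P b)
    (ha : P a) (k : ℕ) : P (l.getD k a) := by
  rcases Nat.lt_or_ge k l.length with hk | hk
  · simpa [hk] using h _ (List.getElem_mem hk)
  · simpa [hk] using ha

/-- The fields of the record part satisfy `P`, as do the fields of the negative record types. -/
theorem forall_set_append {P : Fld → Prop} {R : List FldGoal} {Q : List Fld} {k : ℕ}
    (hR : ∀ g ∈ R, ∀ l ∈ g, P l.2) (hQ : ∀ f ∈ Q, P f) (hP : P .top) :
    (∀ l ∈ R.getD k [] ++ [(false, Q.getD k .top)], P l.2) ∧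
      ∀ g ∈ R.set k (R.getD k [] ++ [(false, Q.getD k .top)]), ∀ l ∈ g, P l.2 := by
  have : ∀ l ∈ R.getD k [] ++ [(false, Q.getD k .top)], P l.2 := by
    intro l hl
    rcases List.mem_append.1 hl with hl | hl
    · exact forall_getD (P := fun g : FldGoal => ∀ l ∈ g, P l.2) hR (by simp) k l hl
    · rw [List.mem_singleton.1 hl]
      exact forall_getD hQ hP k
  refine ⟨this, fun g hg => ?_⟩
  rcases List.mem_or_eq_of_mem_set hg with hg | rfl
  · exact hR g hg
  · exact this

/-- If `x` leaves a negative type at some label `k`, follow the branch of the search for `k`: the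
refined field still contains `x k`, so its test cannot have succeeded and the recursive call must
have. When the types are exhausted, `Φ` is false. -/
theorem phi_sound {P : DomUndef C → Prop} {test : FldGoal → Run Bool}
    (hT : ∀ g, (∀ l ∈ g, GoodFld G l.2) → (test g).Is true → ∀ x, P x →
      ¬ FldGoalMem interp S x g) {tl : Tail} {Vp : List ℕ} {N : List (List Fld × Tail)}
    {R : List FldGoal} (hR : ∀ g ∈ R, ∀ l ∈ g, GoodFld G l.2)
    (hN : ∀ Q ∈ N, ∀ f ∈ Q.1, GoodFld G f) (h : (phi test tl Vp N R).Is true)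
    {x : ℕ → DomUndef C} (hx : ∀ k, P (x k))
    (hxR : ∀ k < R.length, FldGoalMem interp S (x k) (R.getD k [])) :
    ∃ Q ∈ N, TailCond tl Vp Q.2 ∧ ∀ k < R.length, FldMem interp S (x k) (Q.1.getD k .top) := by
  induction N generalizing R with
  | nil => simp [phi, Run.is_tick, Run.is_ret] at h
  | cons Q N ih =>
    obtain ⟨Q, tl'⟩ := Q
    have hN' := fun Q hQ => hN Q (List.mem_cons_of_mem _ hQ)
    rw [phi, Run.is_tick] at h
    split_ifs at h with hc
    · by_cases hxQ : ∀ k < R.length, FldMem interp S (x k) (Q.getD k .top)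
      · exact ⟨_, List.mem_cons_self, hc, hxQ⟩
      · push Not at hxQ
        obtain ⟨k, hk, hkQ⟩ := hxQ
        have hg := forall_set_append (k := k) hR (hN _ List.mem_cons_self) trivial
        have hkg := fldGoalMem_append_singleton.2 ⟨hxR k hk, hkQ⟩
        have h := Run.is_all_true.1 h k (List.mem_range.2 hk)
        rcases Run.is_or_true.1 h with h | ⟨-, h⟩
        · exact absurd hkg (hT _ hg.1 h _ (hx k))
        · obtain ⟨Q', hQ', hc', h'⟩ := ih hg.2 hN' h fun j hj => by
            rw [List.length_set] at hj
            by_cases hjk : k = j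
            · subst hjk
              rw [List.getD_eq_getElem?_getD, List.getElem?_set_self hk]
              exact hkg
            · rw [List.getD_eq_getElem?_getD, List.getElem?_set_ne hjk,
                ← List.getD_eq_getElem?_getD]
              exact hxR j hj
          rw [List.length_set] at h'
          exact ⟨Q', List.mem_cons_of_mem _ hQ', hc', h'⟩
    · obtain ⟨Q', hQ', hc'⟩ := ih hR hN' h hxR
      exact ⟨Q', List.mem_cons_of_mem _ hQ', hc'⟩

/-- A negative answer selects a label for each relevant negative type. The invariant is that every
field of `R` remains inhabited; once all choices are made, elements are picked independently at the
labels. This is why the fields must be tested before `Φ` is run. -/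
theorem phi_complete {test : FldGoal → Run Bool}
    (hT : ∀ g, (∀ l ∈ g, GoodFld G l.2) → (test g).Is false →
      ∃ x : DomUndef C, FldGoalMem interp S x g) {tl : Tail} {Vp : List ℕ}
    {N : List (List Fld × Tail)} {R : List FldGoal} (hR : ∀ g ∈ R, ∀ l ∈ g, GoodFld G l.2)
    (hN : ∀ Q ∈ N, ∀ f ∈ Q.1, GoodFld G f) (h : (phi test tl Vp N R).Is false)
    (hne : ∀ g ∈ R, ∃ x : DomUndef C, FldGoalMem interp S x g) :
    ∃ x : ℕ → DomUndef C, (∀ k < R.length, FldGoalMem interp S (x k) (R.getD k [])) ∧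
      ∀ Q ∈ N, TailCond tl Vp Q.2 →
        ∃ k < R.length, ¬ FldMem interp S (x k) (Q.1.getD k .top) := by
  induction N generalizing R with
  | nil =>
    have : ∀ k, ∃ x : DomUndef C, k < R.length → FldGoalMem interp S x (R.getD k []) := by
      intro k
      by_cases hk : k < R.length
      · obtain ⟨x, hx⟩ := hne _ (List.getElem_mem hk)
        exact ⟨x, fun _ => by simpa [hk] using hx⟩
      · exact ⟨.undef ∅, fun h => absurd h hk⟩
    choose x hx using this
    exact ⟨x, hx, by simp⟩
  | cons Q N ih =>
    obtain ⟨Q, tl'⟩ := Q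
    have hN' := fun Q hQ => hN Q (List.mem_cons_of_mem _ hQ)
    rw [phi, Run.is_tick] at h
    split_ifs at h with hc
    · obtain ⟨k, hk, h⟩ := Run.exists_of_is_all_false h
      have hk := List.mem_range.1 hk
      have hg := forall_set_append (k := k) hR (hN _ List.mem_cons_self) trivial
      obtain ⟨h₁, h₂⟩ := Run.is_or_false.1 h
      obtain ⟨x, hx, hx'⟩ := ih hg.2 hN' h₂ fun g hg' => by
        rcases List.mem_or_eq_of_mem_set hg' with hg' | rfl
        · exact hne g hg'
        · exact hT _ hg.1 h₁
      simp only [List.length_set] at hx hx'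
      have hk' := hx k hk
      rw [List.getD_eq_getElem?_getD, List.getElem?_set_self hk] at hk'
      have hk' := fldGoalMem_append_singleton.1 hk'
      refine ⟨x, fun j hj => ?_, ?_⟩
      · by_cases hjk : k = j
        · subst hjk
          exact hk'.1
        · have := hx j hj
          rwa [List.getD_eq_getElem?_getD, List.getElem?_set_ne hjk,
            ← List.getD_eq_getElem?_getD] at this
      · rw [List.forall_mem_cons]
        exact ⟨fun _ => ⟨k, hk, hk'.2⟩, hx'⟩
    · obtain ⟨x, hx, hx'⟩ := ih hR hN' h hne
      refine ⟨x, hx, ?_⟩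
      rw [List.forall_mem_cons]
      exact ⟨fun hc' => absurd hc' hc, hx'⟩

end Step

section Step

variable {B C : Type} {interp : B → Set C} {off : ℕ → Finset ℕ} {S : System B}
  {G : Kind → ℕ → Prop}

/-! ### Emptiness of record parts -/

/-- The fields of the record type are among the well-formed unknowns `G`. -/
def GoodRec (G : Kind → ℕ → Prop) (R : Rec) : Prop := ∀ p ∈ R.1, G .field p.2

theorem mem_of_lookup {X : Type} {fs : List (ℕ × X)} {ℓ : ℕ} {x : X}
    (h : fs.lookup ℓ = some x) : (ℓ, x) ∈ fs := by
  induction fs with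
  | nil => simp at h
  | cons p fs ih =>
    obtain ⟨ℓ', y⟩ := p
    by_cases he : ℓ = ℓ'
    · subst he
      simp_all
    · have he' : (ℓ == ℓ') = false := by simpa using he
      simp only [List.lookup_cons, he'] at h
      exact List.mem_cons_of_mem _ (ih h)

theorem goodFld_fieldAt {R : Rec} (h : GoodRec G R) (ℓ : ℕ) : GoodFld G (R.fieldAt ℓ) := by
  unfold Rec.fieldAt
  cases hl : R.1.lookup ℓ with
  | some i => exact h _ (mem_of_lookup hl)
  | none => cases R.2 <;> trivial

/-- The field of a record type at a label that is not explicit. -/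
def Tail.fld : Tail → Fld
  | .closed => .absent
  | _ => .top

theorem fieldAt_of_not_mem {R : Rec} {ℓ : ℕ} (h : ℓ ∉ R.1.map Prod.fst) :
    R.fieldAt ℓ = R.2.fld := by
  have : R.1.lookup ℓ = none := by
    cases hl : R.1.lookup ℓ with
    | none => rfl
    | some i => exact absurd (List.mem_map_of_mem (mem_of_lookup hl)) h
  unfold Rec.fieldAt
  rw [this]
  cases R.2 <;> rfl

/-- The labels explicit in some of the record types. -/
def labelsOf (P : List Rec) : List ℕ := (P.flatMap fun R => R.1.map Prod.fst).dedup

/-- The tail of the conjunction of the record types, apart from row variables. -/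
def tailOf (P : List Rec) : Tail := if P.any fun R => R.2 = .closed then .closed else .opened

/-- The row variables that are tails of the record types. -/
def rowVarsOf (P : List Rec) : List ℕ := (P.filterMap fun R => match R.2 with
    | .row ρ => some ρ
    | _ => none).dedup

theorem mem_rowVarsOf {P : List Rec} {ρ : ℕ} : ρ ∈ rowVarsOf P ↔ ∃ R ∈ P, R.2 = .row ρ := by
  simp only [rowVarsOf, List.mem_dedup, List.mem_filterMap]
  refine exists_congr fun R => and_congr_right fun _ => ?_
  cases R.2 <;> simp

theorem tailOf_cases (P : List Rec) :
    (tailOf P = .closed ∧ ∃ R ∈ P, R.2 = .closed) ∨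
      (tailOf P = .opened ∧ ∀ R ∈ P, R.2 ≠ .closed) := by
  unfold tailOf
  split_ifs with h
  · exact .inl ⟨rfl, by simpa using h⟩
  · exact .inr ⟨rfl, fun R hR he => h (List.any_eq_true.2 ⟨R, hR, by simpa using he⟩)⟩

theorem fieldAt_of_not_mem_labelsOf {P : List Rec} {R : Rec} (hR : R ∈ P) {ℓ : ℕ}
    (h : ℓ ∉ labelsOf P) : R.fieldAt ℓ = R.2.fld :=
  fieldAt_of_not_mem fun hℓ => h (List.mem_dedup.2 (List.mem_flatMap.2 ⟨R, hR, hℓ⟩))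

theorem nodup_labelsOf (P : List Rec) : (labelsOf P).Nodup := List.nodup_dedup _

/-- Gives names to the local definitions of `recordEmpty`. -/
theorem is_recordEmpty {test : List Lit → Run Bool} {P N : List Rec} {b : Bool} :
    (recordEmpty S test P N).Is b ↔ (Run.or
      (Run.any ((labelsOf (P ++ N)).map fun ℓ => P.map fun R => (true, R.fieldAt ℓ))
        (fldEmpty S test))
      (phi (fldEmpty S test) (tailOf P) (rowVarsOf P)
        (N.map fun R => ((labelsOf (P ++ N)).map R.fieldAt, R.2))
        ((labelsOf (P ++ N)).map fun ℓ => P.map fun R => (true, R.fieldAt ℓ)))).Is b :=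
  Iff.rfl

theorem fldGoalMem_fieldAt {x : DomUndef C} {P : List Rec} {ℓ : ℕ} :
    FldGoalMem interp S x (P.map fun R => (true, R.fieldAt ℓ)) ↔
      ∀ R ∈ P, FldMem interp S x (R.fieldAt ℓ) := by
  simp only [FldGoalMem, List.forall_mem_map, iff_true]

/-- `Φ` yields a negative type that contains the value at all listed labels. The condition on its
tail settles the rest: a closed tail is matched by a closed positive type, and a row variable by a
positive type with the same one. -/
theorem recordEmpty_sound (hG : WellFormed off S G) {Q : Dom C → Prop}
    {test : List Lit → Run Bool} (hT : TestSound interp S G Q test) {P N : List Rec}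
    (hP : ∀ R ∈ P, GoodRec G R) (hN : ∀ R ∈ N, GoodRec G R)
    (h : (recordEmpty S test P N).Is true) {L : Finset ℕ} {val : {ℓ // ℓ ∈ L} → DomUndef C}
    {Vr V : Finset Var} (hval : ∀ ℓ, (val ℓ).All Q)
    (hmem : ∀ R ∈ P, RecMem interp S (.record L val Vr V) R) :
    ∃ R ∈ N, RecMem interp S (.record L val Vr V) R := by
  have hval : ∀ ℓ, (rowAt L val ℓ).All Q := by
    intro ℓ
    unfold rowAt
    split
    · exact hval _
    · rintro d ⟨⟩
  simp only [recMem_record] at hmem ⊢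
  rw [is_recordEmpty] at h
  have hgood : ∀ g ∈ (labelsOf (P ++ N)).map (fun ℓ => P.map fun R => (true, R.fieldAt ℓ)),
      ∀ l ∈ g, GoodFld G l.2 := by
    simp only [List.mem_map]
    rintro _ ⟨ℓ, -, rfl⟩ l hl
    obtain ⟨R, hR, rfl⟩ := List.mem_map.1 hl
    exact goodFld_fieldAt (hP R hR) ℓ
  rcases Run.is_or_true.1 h with h | ⟨-, h⟩
  · obtain ⟨g, hg, h⟩ := Run.exists_of_is_any_true h
    have hg' := hgood g hg
    obtain ⟨ℓ, -, rfl⟩ := List.mem_map.1 hg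
    exact absurd (fldGoalMem_fieldAt.2 fun R hR => (hmem R hR).1 ℓ)
      (fldEmpty_sound hG hT hg' h (hval ℓ))
  · obtain ⟨Q, hQ, hc, hx⟩ := phi_sound (P := DomUndef.All Q)
      (fun g hg h x hx => fldEmpty_sound hG hT hg h hx) hgood (by
        simp only [List.mem_map]
        rintro _ ⟨R, hR, rfl⟩ f hf
        obtain ⟨ℓ, -, rfl⟩ := List.mem_map.1 hf
        exact goodFld_fieldAt (hN R hR) ℓ) h
      (x := fun k => rowAt L val ((labelsOf (P ++ N)).getD k 0)) (fun k => hval _)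
      (fun k hk => by
        have hk : k < (labelsOf (P ++ N)).length := by simpa using hk
        simp only [List.getD_eq_getElem?_getD, List.getElem?_map, List.getElem?_eq_getElem hk,
          Option.map_some, Option.getD_some]
        exact fldGoalMem_fieldAt.2 fun R hR => (hmem R hR).1 _)
    obtain ⟨R, hR, rfl⟩ := List.mem_map.1 hQ
    refine ⟨R, hR, fun ℓ => ?_, fun ρ hρ => ?_⟩
    · by_cases hℓ : ℓ ∈ labelsOf (P ++ N)
      · obtain ⟨k, hk, rfl⟩ := List.getElem_of_mem hℓ
        have := hx k (by simpa using hk)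
        simpa [hk] using this
      · rw [fieldAt_of_not_mem_labelsOf (List.mem_append_right _ hR) hℓ]
        dsimp only at hc
        cases hR2 : R.2 with
        | closed =>
          rw [hR2] at hc
          rcases tailOf_cases P with ⟨-, R', hR', he⟩ | ⟨ht, -⟩
          · have := (hmem R' hR').1 ℓ
            rwa [fieldAt_of_not_mem_labelsOf (List.mem_append_left _ hR') hℓ, he] at this
          · simp [TailCond, ht] at hc
        | _ => trivial
    · dsimp only at hc
      rw [hρ] at hc
      rcases hc with h | h | ⟨ρ', h', h⟩
      · cases h
      · rcases tailOf_cases P with ⟨ht, -⟩ | ⟨ht, -⟩ <;> rw [ht] at h <;> cases h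
      · cases h
        obtain ⟨R', hR', he⟩ := mem_rowVarsOf.1 h'
        exact (hmem R' hR').2 ρ he

theorem rowAt_restrict {L : Finset ℕ} {y : ℕ → DomUndef C} (h : ∀ ℓ ∉ L, y ℓ = .undef ∅) (ℓ : ℕ) :
    rowAt L (fun ℓ => y ℓ) ℓ = y ℓ := by
  unfold rowAt
  split
  · rfl
  · exact (h ℓ ‹_›).symm

/-- The fields found by `Φ` refute the negative types that pass the tail test. The others are
refuted together and at no expense: the row tag contains the positive row variables only, and if no
positive type is closed, one fresh label carries a value. -/
theorem recordEmpty_complete (hG : WellFormed off S G) {test : List Lit → Run Bool}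
    (hT : TestComplete (C := C) interp S G test) {P N : List Rec}
    (hP : ∀ R ∈ P, GoodRec G R) (hN : ∀ R ∈ N, GoodRec G R)
    (h : (recordEmpty S test P N).Is false) :
    ∃ (L : Finset ℕ) (val : {ℓ // ℓ ∈ L} → DomUndef C) (Vr : Finset Var), ∀ V,
      (∀ R ∈ P, RecMem interp S (.record L val Vr V) R) ∧
        ∀ R ∈ N, ¬ RecMem interp S (.record L val Vr V) R := by
  rw [is_recordEmpty] at h
  have hgood : ∀ g ∈ (labelsOf (P ++ N)).map (fun ℓ => P.map fun R => (true, R.fieldAt ℓ)),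
      ∀ l ∈ g, GoodFld G l.2 := by
    simp only [List.mem_map]
    rintro _ ⟨ℓ, -, rfl⟩ l hl
    obtain ⟨R, hR, rfl⟩ := List.mem_map.1 hl
    exact goodFld_fieldAt (hP R hR) ℓ
  obtain ⟨h₁, h₂⟩ := Run.is_or_false.1 h
  obtain ⟨x, hx, hx'⟩ := phi_complete (C := C)
    (fun g hg h => fldEmpty_complete hG hT hg h) hgood (by
      simp only [List.mem_map]
      rintro _ ⟨R, hR, rfl⟩ f hf
      obtain ⟨ℓ, -, rfl⟩ := List.mem_map.1 hf
      exact goodFld_fieldAt (hN R hR) ℓ) h₂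
    fun g hg => fldEmpty_complete hG hT (hgood g hg) (Run.is_any_false.1 h₁ g hg)
  simp only [List.length_map] at hx hx'
  obtain ⟨ℓ₀, hℓ₀⟩ := Infinite.exists_notMem_finset (labelsOf (P ++ N)).toFinset
  have hℓ₀ : ℓ₀ ∉ labelsOf (P ++ N) := by simpa using hℓ₀
  let y : ℕ → DomUndef C := fun ℓ =>
    if ℓ ∈ labelsOf (P ++ N) then x ((labelsOf (P ++ N)).idxOf ℓ)
    -- The empty relation serves as an arbitrary value; it is not `⊥`, which is all that is needed
    -- to leave the closed negative types.
    else if tailOf P = .opened ∧ ℓ = ℓ₀ then .val (.func 0 Fin.elim0 Fin.elim0 ∅)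
    else .undef ∅
  have hy : ∀ ℓ ∉ insert ℓ₀ (labelsOf (P ++ N)).toFinset, y ℓ = .undef ∅ := by
    intro ℓ hℓ
    simp only [Finset.mem_insert, List.mem_toFinset, not_or] at hℓ
    simp [y, hℓ]
  refine ⟨insert ℓ₀ (labelsOf (P ++ N)).toFinset, fun ℓ => y ℓ,
    (rowVarsOf P).toFinset.image .row, fun V => ?_⟩
  simp only [recMem_record, rowAt_restrict hy]
  constructor
  · refine fun R hR => ⟨fun ℓ => ?_, fun ρ hρ => ?_⟩
    · by_cases hℓ : ℓ ∈ labelsOf (P ++ N)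
      · have hk := List.idxOf_lt_length_iff.2 hℓ
        have := hx _ hk
        simp only [List.getD_eq_getElem?_getD, List.getElem?_map, List.getElem?_idxOf hℓ,
          Option.map_some, Option.getD_some] at this
        simp only [y, if_pos hℓ]
        exact fldGoalMem_fieldAt.1 this R hR
      · rw [fieldAt_of_not_mem_labelsOf (List.mem_append_left _ hR) hℓ]
        cases hR2 : R.2 with
        | closed =>
          have ht : tailOf P ≠ .opened := by
            rcases tailOf_cases P with ⟨ht, -⟩ | ⟨-, h⟩
            · simp [ht]
            · exact absurd hR2 (h R hR)
          exact ⟨∅, by simp [y, hℓ, ht]⟩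
        | _ => trivial
    · simpa using mem_rowVarsOf.2 ⟨R, hR, hρ⟩
  · rintro R hR ⟨hf, hr⟩
    by_cases hc : TailCond (tailOf P) (rowVarsOf P) R.2
    · obtain ⟨k, hk, hk'⟩ := hx' _ (List.mem_map_of_mem hR) hc
      have := hf (labelsOf (P ++ N))[k]
      simp only [y, if_pos (List.getElem_mem hk), (nodup_labelsOf _).idxOf_getElem] at this
      simp only [List.getD_eq_getElem?_getD, List.getElem?_map, List.getElem?_eq_getElem hk,
        Option.map_some, Option.getD_some] at hk'
      exact hk' this
    · simp only [TailCond, not_or] at hc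
      cases hR2 : R.2 with
      | closed =>
        have ht : tailOf P = .opened := by
          rcases tailOf_cases P with ⟨ht, -⟩ | ⟨ht, -⟩
          · exact absurd (hR2.trans ht.symm) hc.2.1
          · exact ht
        have := hf ℓ₀
        rw [fieldAt_of_not_mem_labelsOf (List.mem_append_right _ hR) hℓ₀, hR2] at this
        obtain ⟨W, hW⟩ := this
        simp [y, hℓ₀, ht] at hW
      | opened => exact hc.1 hR2
      | row ρ =>
        have := hr ρ hR2
        simp only [Finset.mem_image, List.mem_toFinset, Var.row.injEq, exists_eq_right] at this
        exact hc.2.2 ⟨ρ, this, hR2⟩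

/-! ### Emptiness of arrow parts -/

/-- The two sides of the arrow are among the well-formed unknowns `G`. -/
def GoodArrow (G : Kind → ℕ → Prop) (a : ℕ × ℕ) : Prop := G .type a.1 ∧ G .type a.2

/-- Membership in an arrow type of a system. -/
def ArrowMem (interp : B → Set C) (S : System B) (d : Dom C) (a : ℕ × ℕ) : Prop :=
  AtomMem interp d ((Node.arrow a.1 a.2).map S.unfold)

theorem mem_of_mem_splits {α : Type} {l : List α} {p : List α × List α} (hp : p ∈ splits l) :
    ∀ a, a ∈ l ↔ a ∈ p.1 ∨ a ∈ p.2 := by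
  induction l generalizing p with
  | nil => simp_all [splits]
  | cons b l ih =>
    simp only [splits, List.mem_flatMap, List.mem_cons, List.not_mem_nil, or_false] at hp
    obtain ⟨q, hq, rfl | rfl⟩ := hp <;> intro a <;> simp only [List.mem_cons, ih hq a] <;> tauto

theorem exists_mem_splits {α : Type} (A : α → Prop) (l : List α) :
    ∃ p ∈ splits l, (∀ a ∈ p.1, ¬ A a) ∧ ∀ a ∈ p.2, A a := by
  induction l with
  | nil => exact ⟨([], []), by simp [splits]⟩
  | cons b l ih =>
    obtain ⟨p, hp, h₁, h₂⟩ := ih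
    by_cases hb : A b
    · refine ⟨(p.1, b :: p.2), ?_, h₁, List.forall_mem_cons.2 ⟨hb, h₂⟩⟩
      simp only [splits, List.mem_flatMap]
      exact ⟨p, hp, by simp⟩
    · refine ⟨(b :: p.1, p.2), ?_, List.forall_mem_cons.2 ⟨hb, h₁⟩, h₂⟩
      simp only [splits, List.mem_flatMap]
      exact ⟨p, hp, by simp⟩

theorem goalMem_cons_map {d : Dom C} {b : Bool} {i : ℕ} {l : List (ℕ × ℕ)} {f : ℕ × ℕ → ℕ} :
    GoalMem interp S d ((b, i) :: l.map fun q => (!b, f q)) ↔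
      (Mem interp d (S.unfold i) ↔ b = true) ∧
        ∀ q ∈ l, (Mem interp d (S.unfold (f q)) ↔ (!b) = true) := by
  simp only [GoalMem, List.forall_mem_cons, List.forall_mem_map]

theorem forall_cons_map {H : ℕ → Prop} {b b' : Bool} {i : ℕ} {l : List (ℕ × ℕ)}
    {f : ℕ × ℕ → ℕ} (hi : H i) (hl : ∀ q ∈ l, H (f q)) :
    ∀ l' ∈ ((b, i) :: l.map fun q => (b', f q) : List Lit), H l'.2 := by
  simp only [List.forall_mem_cons, List.forall_mem_map]
  exact ⟨hi, hl⟩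

/-- Suppose that a pair of the relation violates the selected negative arrow, and split the positive
arrows according to whether their domain contains the argument. For this splitting, one test
excludes the argument and the other excludes the result. -/
theorem arrowEmpty_sound {Q : Dom C → Prop} {test : List Lit → Run Bool}
    (hT : TestSound interp S G Q test) {P N : List (ℕ × ℕ)} (hP : ∀ a ∈ P, GoodArrow G a)
    (hN : ∀ a ∈ N, GoodArrow G a) (h : (arrowEmpty test P N).Is true) {n : ℕ}
    {arg : Fin n → Dom C} {res : Fin n → DomOmega C} {V : Finset Var} (harg : ∀ i, Q (arg i))
    (hres : ∀ i d, res i = .val d → Q d)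
    (hmem : ∀ a ∈ P, ArrowMem interp S (.func n arg res V) a) :
    ∃ a ∈ N, ArrowMem interp S (.func n arg res V) a := by
  obtain ⟨a, ha, h⟩ := Run.exists_of_is_any_true h
  refine ⟨a, ha, ?_⟩
  by_contra hcon
  simp only [ArrowMem, AtomMem, Node.map] at hmem hcon
  push Not at hcon
  obtain ⟨i, hi₁, hi₂⟩ := hcon
  obtain ⟨p, hp, h₁, h₂⟩ := exists_mem_splits
    (fun q : ℕ × ℕ => Mem interp (arg i) (S.unfold q.1)) P
  have hin := mem_of_mem_splits hp
  have h := Run.is_all_true.1 h p hp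
  simp only [Run.is_or_true, Run.is_and_true, Run.is_tick, Run.is_ret] at h
  rcases h with h | ⟨-, hne, h⟩
  · refine hT _ (forall_cons_map (hN a ha).1 fun q hq => (hP q ((hin q).2 (.inl hq))).1) h _
      (harg i) (goalMem_cons_map.2 ⟨by simpa using hi₁, fun q hq => by simpa using h₁ q hq⟩)
  · have hres' : ∀ q ∈ p.2, MemOmega interp (res i) (S.unfold q.2) := fun q hq =>
      hmem q ((hin q).2 (.inr hq)) i (h₂ q hq)
    have hres := hres i
    cases hr : res i with
    | omega =>
      -- Some positive arrow applies to the argument, so the result cannot be `Ω`; this is the role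
      -- of the condition that `p.2` is nonempty.
      cases hp2 : p.2 with
      | nil => simp [hp2] at hne
      | cons q l =>
        have := hres' q (by simp [hp2])
        rw [hr, MemOmega.eq_2] at this
        exact this
    | val d =>
      rw [hr] at hi₂
      rw [MemOmega.eq_1] at hi₂
      refine hT _ (forall_cons_map (hN a ha).2 fun q hq => (hP q ((hin q).2 (.inr hq))).2) h d
        (hres d hr) (goalMem_cons_map.2 ⟨by simpa using hi₂, fun q hq => ?_⟩)
      have := hres' q hq
      rw [hr, MemOmega.eq_1] at this
      simpa using this

/-- Each negative arrow has a splitting on which the tests fail, hence a pair that violates it and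
respects all positive arrows. The relation made of all these pairs refutes every negative arrow at
once. -/
theorem arrowEmpty_complete {test : List Lit → Run Bool}
    (hT : TestComplete (C := C) interp S G test) {P N : List (ℕ × ℕ)}
    (hP : ∀ a ∈ P, GoodArrow G a) (hN : ∀ a ∈ N, GoodArrow G a)
    (h : (arrowEmpty test P N).Is false) :
    ∃ (n : ℕ) (arg : Fin n → Dom C) (res : Fin n → DomOmega C), ∀ V,
      (∀ a ∈ P, ArrowMem interp S (.func n arg res V) a) ∧
        ∀ a ∈ N, ¬ ArrowMem interp S (.func n arg res V) a := by
  have key : ∀ a : Fin N.length, ∃ (d : Dom C) (w : DomOmega C),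
      Mem interp d (S.unfold (N.get a).1) ∧ ¬ MemOmega interp w (S.unfold (N.get a).2) ∧
      ∀ q ∈ P, Mem interp d (S.unfold q.1) → MemOmega interp w (S.unfold q.2) := by
    intro a
    have ha := N.get_mem a
    obtain ⟨p, hp, h⟩ := Run.exists_of_is_all_false (Run.is_any_false.1 h _ ha)
    have hin := mem_of_mem_splits hp
    simp only [Run.is_or_false, Run.is_and_false, Run.is_tick, Run.is_ret] at h
    obtain ⟨h₁, h₂⟩ := h
    obtain ⟨d, hd⟩ := hT _
      (forall_cons_map (hN _ ha).1 fun q hq => (hP q ((hin q).2 (.inl hq))).1) h₁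
    obtain ⟨hd₁, hd₂⟩ := goalMem_cons_map.1 hd
    have hd₂ : ∀ q ∈ p.1, ¬ Mem interp d (S.unfold q.1) := by simpa using hd₂
    rcases h₂ with h₂ | ⟨-, h₂⟩
    · have hp2 : p.2 = [] := by simpa using h₂
      -- No positive arrow has `d` in its domain, so `Ω` is allowed as the result, and it lies in no
      -- type.
      refine ⟨d, .omega, by simpa using hd₁, by rw [MemOmega.eq_2]; exact id, fun q hq hdq => ?_⟩
      have := (hin q).1 hq
      rw [hp2] at this
      exact absurd hdq (hd₂ q (by simpa using this))
    · obtain ⟨d', hd'⟩ := hT _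
        (forall_cons_map (hN _ ha).2 fun q hq => (hP q ((hin q).2 (.inr hq))).2) h₂
      obtain ⟨hd₁', hd₂'⟩ := goalMem_cons_map.1 hd'
      refine ⟨d, .val d', by simpa using hd₁, by rw [MemOmega.eq_1]; simpa using hd₁',
        fun q hq hdq => ?_⟩
      rw [MemOmega.eq_1]
      rcases (hin q).1 hq with hq | hq
      · exact absurd hdq (hd₂ q hq)
      · simpa using hd₂' q hq
  choose arg res h₁ h₂ h₃ using key
  refine ⟨N.length, arg, res, fun V => ⟨fun a ha i => h₃ i a ha, fun a ha hcon => ?_⟩⟩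
  obtain ⟨i, rfl⟩ := List.get_of_mem ha
  exact h₂ i (hcon i (h₁ i))

end Step

section Step

variable {B C : Type} {interp : B → Set C} {off : ℕ → Finset ℕ} {S : System B}
  {G : Kind → ℕ → Prop}

/-! ### Emptiness of clauses -/

theorem mem_nodesOf {p : Bool} {c : List Lit} {n : Node B ℕ} :
    n ∈ nodesOf S p c ↔ ∃ i, (p, i) ∈ c ∧ S.at i = n := by
  simp only [nodesOf, List.mem_map, List.mem_filter, decide_eq_true_eq]
  constructor
  · rintro ⟨⟨q, i⟩, ⟨hl, rfl⟩, h⟩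
    exact ⟨i, hl, h⟩
  · rintro ⟨i, hl, h⟩
    exact ⟨(p, i), ⟨hl, rfl⟩, h⟩

theorem mem_tvarsOf {ns : List (Node B ℕ)} {α : ℕ} : α ∈ tvarsOf ns ↔ .tvar α ∈ ns := by
  simp only [tvarsOf, List.mem_filterMap]
  constructor
  · rintro ⟨n, hn, h⟩
    cases n <;> simp_all
  · exact fun h => ⟨_, h, rfl⟩

theorem mem_basicsOf {ns : List (Node B ℕ)} {b : B} : b ∈ basicsOf ns ↔ .basic b ∈ ns := by
  simp only [basicsOf, List.mem_filterMap]
  constructor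
  · rintro ⟨n, hn, h⟩
    cases n <;> simp_all
  · exact fun h => ⟨_, h, rfl⟩

theorem mem_arrowsOf {ns : List (Node B ℕ)} {a : ℕ × ℕ} :
    a ∈ arrowsOf ns ↔ .arrow a.1 a.2 ∈ ns := by
  simp only [arrowsOf, List.mem_filterMap]
  constructor
  · rintro ⟨n, hn, h⟩
    cases n <;> simp_all
    cases h
    exact hn
  · exact fun h => ⟨_, h, rfl⟩

theorem mem_recordsOf {ns : List (Node B ℕ)} {R : Rec} :
    R ∈ recordsOf ns ↔ .record R.1 R.2 ∈ ns := by
  simp only [recordsOf, List.mem_filterMap]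
  constructor
  · rintro ⟨n, hn, h⟩
    cases n <;> simp_all
    cases h
    exact hn
  · exact fun h => ⟨_, h, rfl⟩

/-- A clause holds if the type variables, basic types, arrows and records in it do. -/
theorem clause_iff (hG : WellFormed off S G) {d : Dom C} {c : List Lit}
    (hc : ∀ l ∈ c, G .type l.2 ∧ (S.at l.2).IsAtom) :
    GoalMem interp S d c ↔ ∀ p,
      (∀ α ∈ tvarsOf (nodesOf S p c), (Var.ty α ∈ d.tag ↔ p = true)) ∧
      (∀ b ∈ basicsOf (nodesOf S p c), (AtomMem interp d (.basic b) ↔ p = true)) ∧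
      (∀ a ∈ arrowsOf (nodesOf S p c), (ArrowMem interp S d a ↔ p = true)) ∧
      (∀ R ∈ recordsOf (nodesOf S p c), (RecMem interp S d R ↔ p = true)) := by
  simp only [mem_tvarsOf, mem_basicsOf, mem_arrowsOf, mem_recordsOf]
  have hnode : GoalMem interp S d c ↔
      ∀ p, ∀ n ∈ nodesOf S p c, (AtomMem interp d (n.map S.unfold) ↔ p = true) := by
    rw [goalMem_iff]
    constructor
    · intro h p n hn
      obtain ⟨i, hi, rfl⟩ := mem_nodesOf.1 hn
      exact (litSat_atom _ (hc _ hi).2).1 (h _ hi)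
    · rintro h ⟨p, i⟩ hl
      exact (litSat_atom _ (hc _ hl).2).2 (h p _ (mem_nodesOf.2 ⟨i, hl, rfl⟩))
  rw [hnode]
  refine forall_congr' fun p => ⟨fun h => ⟨fun α hα => h _ hα, fun b hb => h _ hb,
    fun a ha => h _ ha, fun R hR => h _ hR⟩, fun ⟨h₁, h₂, h₃, h₄⟩ n hn => ?_⟩
  obtain ⟨i, hi, hin⟩ := mem_nodesOf.1 hn
  have hk := hG.kinded _ _ (hc _ hi).1
  have ha := (hc _ hi).2
  rw [hin] at hk ha
  cases n with
  | tvar α => exact h₁ α hn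
  | basic b => exact h₂ b hn
  | arrow i j => exact h₃ (i, j) hn
  | record fs tl => exact h₄ (fs, tl) hn
  | empty => exact absurd rfl ha.1
  | neg j => exact absurd rfl (ha.2.1 j)
  | or j k => exact absurd rfl (ha.2.2 j k)
  | _ => exact hk.elim

theorem goodArrow_of_mem (hG : KindClosed S G) {c : List Lit}
    (hc : ∀ l ∈ c, G .type l.2 ∧ (S.at l.2).IsAtom) {p : Bool} :
    ∀ a ∈ arrowsOf (nodesOf S p c), GoodArrow G a := by
  intro a ha
  obtain ⟨i, hi, he⟩ := mem_nodesOf.1 (mem_arrowsOf.1 ha)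
  exact hG.arrow _ _ _ (hc _ hi).1 he

theorem goodRec_of_mem (hG : KindClosed S G) {c : List Lit}
    (hc : ∀ l ∈ c, G .type l.2 ∧ (S.at l.2).IsAtom) {p : Bool} :
    ∀ R ∈ recordsOf (nodesOf S p c), GoodRec G R := by
  intro R hR
  obtain ⟨i, hi, he⟩ := mem_nodesOf.1 (mem_recordsOf.1 hR)
  exact hG.record _ _ _ (hc _ hi).1 he

/-- The components of the value satisfy `Q`. -/
def Dom.AllParts (Q : Dom C → Prop) : Dom C → Prop
  | .const _ _ => True
  | .func _ arg res _ => (∀ i, Q (arg i)) ∧ ∀ i d, res i = .val d → Q d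
  | .record _ val _ _ => ∀ ℓ, (val ℓ).All Q

/-- The function `emp` decides emptiness of conjunctions of possibly negated basic types. -/
def DecidesBasic (interp : B → Set C) (emp : List B × List B → Bool) : Prop :=
  ∀ P N : List B, emp (P, N) = true ↔ (⋂ b ∈ P, interp b) \ (⋃ b ∈ N, interp b) = ∅

variable {emp : List B × List B → Bool}

/-- A value has one sort. Positive atoms of the other sorts cannot contain it, so the corresponding
lists are empty and the test for its own sort applies. -/
theorem clauseEmpty_sound (hG : WellFormed off S G) (hemp : DecidesBasic interp emp)
    {Q : Dom C → Prop} {test : List Lit → Run Bool} (hT : TestSound interp S G Q test)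
    {c : List Lit} (hc : ∀ l ∈ c, G .type l.2 ∧ (S.at l.2).IsAtom)
    (h : (clauseEmpty S emp test c).Is true) {d : Dom C} (hd : d.AllParts Q) :
    ¬ GoalMem interp S d c := by
  rw [clause_iff hG hc]
  intro hm
  obtain ⟨p₁, p₂, p₃, p₄⟩ := hm true
  obtain ⟨n₁, n₂, n₃, n₄⟩ := hm false
  simp only [iff_true, Bool.false_eq_true, iff_false] at p₁ p₂ p₃ p₄ n₁ n₂ n₃ n₄
  simp only [clauseEmpty, Run.is_or_true, Run.is_and_true, Run.is_ret] at h
  have hnoB : (∀ b, ¬ AtomMem interp d (.basic b)) → basicsOf (nodesOf S true c) = [] := fun h =>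
    List.eq_nil_iff_forall_not_mem.2 fun b hb => h b (p₂ b hb)
  have hnoA : (∀ a, ¬ ArrowMem interp S d a) → arrowsOf (nodesOf S true c) = [] := fun h =>
    List.eq_nil_iff_forall_not_mem.2 fun a ha => h a (p₃ a ha)
  have hnoR : (∀ R, ¬ RecMem interp S d R) → recordsOf (nodesOf S true c) = [] := fun h =>
    List.eq_nil_iff_forall_not_mem.2 fun R hR => h R (p₄ R hR)
  rcases h with h | ⟨-, hB, hA, hR⟩
  · simp only [List.any_eq_true, decide_eq_true_eq] at h
    obtain ⟨α, h₁, h₂⟩ := h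
    exact n₁ α h₂ (p₁ α h₁)
  · cases d with
    | const k V =>
      rw [hnoA fun a => id, hnoR fun R => id] at hB
      simp only [List.isEmpty_nil, Bool.not_true, Bool.or_self, Bool.false_or] at hB
      have := (hemp _ _).1 hB
      refine Set.eq_empty_iff_forall_notMem.1 this k ⟨Set.mem_iInter₂.2 p₂, fun hk => ?_⟩
      obtain ⟨b, hb, hk⟩ := Set.mem_iUnion₂.1 hk
      exact n₂ b hb hk
    | func n arg res V =>
      rw [hnoB fun b => id, hnoR fun R => id] at hA
      simp only [List.isEmpty_nil, Bool.not_true, Bool.or_self, Bool.false_eq_true, false_or,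
        true_and] at hA
      obtain ⟨a, ha, h⟩ := arrowEmpty_sound hT (goodArrow_of_mem hG.closed hc) (goodArrow_of_mem hG.closed hc) hA
        hd.1 hd.2 p₃
      exact n₃ a ha h
    | record L val Vr V =>
      rw [hnoB fun b => id, hnoA fun a => id] at hR
      simp only [List.isEmpty_nil, Bool.not_true, Bool.or_self, Bool.false_eq_true, false_or,
        true_and] at hR
      obtain ⟨R, hR, h⟩ := recordEmpty_sound hG hT (goodRec_of_mem hG.closed hc) (goodRec_of_mem hG.closed hc) hR
        hd p₄
      exact n₄ R hR h

theorem clauseEmpty_complete (hG : WellFormed off S G) (hemp : DecidesBasic interp emp)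
    {test : List Lit → Run Bool} (hT : TestComplete (C := C) interp S G test)
    {c : List Lit} (hc : ∀ l ∈ c, G .type l.2 ∧ (S.at l.2).IsAtom)
    (h : (clauseEmpty S emp test c).Is false) : ∃ d : Dom C, GoalMem interp S d c := by
  simp only [clause_iff hG hc, Bool.forall_bool, iff_true, Bool.false_eq_true, iff_false]
  simp only [clauseEmpty, Run.is_or_false, Run.is_and_false, Run.is_ret] at h
  obtain ⟨hα, h⟩ := h
  simp only [List.any_eq_false, decide_eq_true_eq] at hα
  -- The tag consists of the positive type variables; no clash of signs means that it avoids the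
  -- negative ones. It can be put on a witness of any sort.
  let V : Finset Var := (tvarsOf (nodesOf S true c)).toFinset.image .ty
  have hV : ∀ α, Var.ty α ∈ V ↔ α ∈ tvarsOf (nodesOf S true c) := by simp [V]
  have hp : ∀ α ∈ tvarsOf (nodesOf S true c), Var.ty α ∈ V := fun α h => (hV α).2 h
  have hn : ∀ α ∈ tvarsOf (nodesOf S false c), Var.ty α ∉ V := fun α h h' =>
    hα α ((hV α).1 h') h
  simp only [Bool.or_eq_false_iff, Bool.not_eq_false', List.isEmpty_iff] at h
  rcases h with ⟨⟨hA, hR⟩, hB⟩ | ⟨-, ⟨⟨hB, hR⟩, h⟩ | ⟨-, ⟨hB, hA⟩, h⟩⟩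
  · have hne := mt (hemp _ _).2 (Bool.eq_false_iff.1 hB)
    obtain ⟨k, hk, hk'⟩ := Set.nonempty_iff_ne_empty.2 hne
    refine ⟨.const k V, ⟨hn, fun b hb hkb => hk' (Set.mem_iUnion₂.2 ⟨b, hb, hkb⟩), fun a _ => id,
      fun R _ => id⟩, hp, Set.mem_iInter₂.1 hk, by simp [hA], by simp [hR]⟩
  · obtain ⟨n, arg, res, h⟩ := arrowEmpty_complete hT (goodArrow_of_mem hG.closed hc)
      (goodArrow_of_mem hG.closed hc) h
    exact ⟨.func n arg res V, ⟨hn, fun b _ => id, (h V).2, fun R _ => id⟩, hp, by simp [hB],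
      (h V).1, by simp [hR]⟩
  · obtain ⟨L, val, Vr, h⟩ := recordEmpty_complete hG hT (goodRec_of_mem hG.closed hc)
      (goodRec_of_mem hG.closed hc) h
    exact ⟨.record L val Vr V, ⟨hn, fun b _ => id, fun a _ => id, (h V).2⟩, hp, by simp [hB],
      by simp [hA], (h V).1⟩

/-! ### Correctness of the algorithm -/

/-- The value is built in at most `h` levels. -/
def HeightLE : ℕ → Dom C → Prop
  | 0, _ => False
  | h + 1, d => d.AllParts (HeightLE h)

theorem Dom.AllParts.mono {P Q : Dom C → Prop} (hPQ : ∀ d, P d → Q d) {d : Dom C}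
    (h : d.AllParts P) : d.AllParts Q := by
  cases d with
  | const => trivial
  | func => exact ⟨fun i => hPQ _ (h.1 i), fun i d hd => hPQ _ (h.2 i d hd)⟩
  | record => exact fun ℓ d hd => hPQ _ (h ℓ d hd)

theorem heightLE_mono {h h' : ℕ} (hh : h ≤ h') {d : Dom C} (hd : HeightLE h d) :
    HeightLE h' d := by
  induction h generalizing h' d with
  | zero => exact hd.elim
  | succ h ih =>
    obtain ⟨h', rfl⟩ : ∃ k, h' = k + 1 := ⟨h' - 1, by omega⟩
    exact Dom.AllParts.mono (fun d => ih (by omega)) hd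

theorem exists_uniform_bound {ι : Type} [Finite ι] (p : ι → ℕ → Prop)
    (hp : ∀ i, Monotone (p i)) (h : ∀ i, ∃ n, p i n) : ∃ n, ∀ i, p i n := by
  choose f hf using h
  obtain ⟨n, hn⟩ := (Set.finite_range f).bddAbove
  exact ⟨n, fun i => hp i (hn ⟨i, rfl⟩) (hf i)⟩

/-- A value has finitely many components, so their heights have a common bound; the mutual recursor
carries this through results and fields. -/
theorem exists_heightLE (d : Dom C) : ∃ h, HeightLE h d := by
  refine Dom.rec (motive_1 := fun d => ∃ h, HeightLE h d)
    (motive_2 := fun x => ∃ h, x.All (HeightLE h))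
    (motive_3 := fun w => ∃ h, ∀ d, w = .val d → HeightLE h d)
    (fun c V => ⟨1, trivial⟩) ?_ ?_ ?_ ?_ ?_ ?_ d
  · intro n arg res V h₁ h₂
    obtain ⟨a, ha⟩ := exists_uniform_bound (fun i h => HeightLE h (arg i))
      (fun i h h' hh => heightLE_mono hh) h₁
    obtain ⟨b, hb⟩ := exists_uniform_bound (fun i h => ∀ d, res i = .val d → HeightLE h d)
      (fun i h h' hh H d hd => heightLE_mono hh (H d hd)) h₂
    exact ⟨max a b + 1, fun i => heightLE_mono (le_max_left _ _) (ha i),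
      fun i d hd => heightLE_mono (le_max_right _ _) (hb i d hd)⟩
  · intro L val Vr V h
    obtain ⟨a, ha⟩ := exists_uniform_bound (fun ℓ h => (val ℓ).All (HeightLE h))
      (fun i h h' hh H d hd => heightLE_mono hh (H d hd)) h
    exact ⟨a + 1, ha⟩
  · rintro d ⟨h, hd⟩
    refine ⟨h, ?_⟩
    rintro _ ⟨⟩
    exact hd
  · exact fun V => ⟨0, by rintro d ⟨⟩⟩
  · rintro d ⟨h, hd⟩
    refine ⟨h, ?_⟩
    rintro _ ⟨⟩
    exact hd
  · exact ⟨0, by rintro d ⟨⟩⟩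

theorem goalMem_iff_exists (hG : WellFormed off S G) {g : List Lit}
    (hg : ∀ l ∈ g, G .type l.2) (d : Dom C) :
    GoalMem interp S d g ↔ ∃ c ∈ dnf S g, GoalMem interp S d c := by
  simp only [goalMem_iff]
  exact dnfHolds_dnf _ fun l hl => hG.depth _ _ (hg l hl)

theorem goalMem_congr {g h : List Lit} (hgh : (∀ l ∈ h, l ∈ g) ∧ ∀ l ∈ g, l ∈ h) (d : Dom C) :
    GoalMem interp S d g ↔ GoalMem interp S d h :=
  ⟨fun H l hl => H l (hgh.1 l hl), fun H l hl => H l (hgh.2 l hl)⟩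

/-- The induction is on the height of values, not on the depth of recursion, which is what
legitimates circular answers: a goal under test is met again only below a constructor, that is, for
values of smaller height. -/
theorem typeEmpty_sound (hG : WellFormed off S G) (hemp : DecidesBasic interp emp) {h n : ℕ}
    {hyps : List (List Lit)} {g : List Lit}
    (hrun : (typeEmpty S emp n hyps g).Is true)
    (hhyps : ∀ g ∈ hyps, ∀ d : Dom C, HeightLE h d → ¬ GoalMem interp S d g)
    (hg : ∀ l ∈ g, G .type l.2) : ∀ d : Dom C, HeightLE h d → ¬ GoalMem interp S d g := by
  induction h generalizing n hyps g with
  | zero => exact fun d hd => hd.elim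
  | succ h ih =>
    intro d hd hm
    have hlow : ∀ g ∈ hyps, ∀ d : Dom C, HeightLE h d → ¬ GoalMem interp S d g :=
      fun g hg d hd => hhyps g hg d (heightLE_mono (Nat.le_succ h) hd)
    -- The same run, read one height lower, shows that `g` has no value of height at most `h`, so
    -- `g` may join the hypotheses of the inner tests.
    have hself := ih hrun hlow hg
    cases n with
    | zero => simp [typeEmpty, Run.Is] at hrun
    | succ n =>
      rw [typeEmpty, Run.is_tick] at hrun
      split_ifs at hrun with hc
      · obtain ⟨g', hg', he⟩ := hc
        exact hhyps g' hg' d hd ((goalMem_congr he d).1 hm)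
      · rw [Run.is_tick, Run.is_all_true] at hrun
        obtain ⟨c, hc, hm⟩ := (goalMem_iff_exists hG hg d).1 hm
        refine clauseEmpty_sound hG hemp (Q := HeightLE h) ?_
          (forall_dnf (hG.closed.conn .type) hg c hc) (hrun c hc) hd hm
        intro g' hg' hrun'
        refine ih hrun' ?_ hg'
        rw [List.forall_mem_cons]
        exact ⟨hself, hlow⟩

/-- No assumption on `hyps` is needed: a goal found in `hyps` yields the answer `true`, and negative
answers are built from negative answers of subgoals. -/
theorem typeEmpty_complete (hG : WellFormed off S G) (hemp : DecidesBasic interp emp) {n : ℕ}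
    {hyps : List (List Lit)} {g : List Lit} (hrun : (typeEmpty S emp n hyps g).Is false)
    (hg : ∀ l ∈ g, G .type l.2) : ∃ d : Dom C, GoalMem interp S d g := by
  induction n generalizing hyps g with
  | zero => simp [typeEmpty, Run.Is] at hrun
  | succ n ih =>
    rw [typeEmpty, Run.is_tick] at hrun
    split_ifs at hrun with hc
    · simp [Run.is_ret] at hrun
    · rw [Run.is_tick] at hrun
      obtain ⟨c, hc, hrun⟩ := Run.exists_of_is_all_false hrun
      obtain ⟨d, hd⟩ := clauseEmpty_complete hG hemp (fun g' hg' hrun' => ih hrun' hg')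
        (forall_dnf (hG.closed.conn .type) hg c hc) hrun
      exact ⟨d, (goalMem_iff_exists hG hg d).2 ⟨c, hc, hd⟩⟩

/-- If the algorithm terminates, then its answer is correct. -/
theorem subtypeAlg_correct (hemp : DecidesBasic interp emp) {i j : ℕ}
    (hi : IsType off (S.unfold i)) (hj : IsType off (S.unfold j)) {n : ℕ} {b : Bool}
    (h : (subtypeAlg S emp n i j).Is b) :
    b = true ↔ IsSubtype interp (S.unfold i) (S.unfold j) := by
  have hG := wellFormed_of_contractive off S
  have hg : ∀ l ∈ ([(true, i), (false, j)] : List Lit),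
      (S.unfold l.2).Contractive ∧ HasKind off .type (S.unfold l.2) := by
    simp [hi.contractive, hi.kinded, hj.contractive, hj.kinded]
  have hiff : IsSubtype interp (S.unfold i) (S.unfold j) ↔
      ∀ d, ¬ GoalMem interp S d [(true, i), (false, j)] := by
    simp [IsSubtype, GoalMem]
  rw [hiff]
  cases b
  · obtain ⟨d, hd⟩ := typeEmpty_complete (C := C) hG hemp h hg
    exact iff_of_false (by simp) fun H => H d hd
  · refine iff_of_true rfl fun d => ?_
    obtain ⟨k, hk⟩ := exists_heightLE d
    exact typeEmpty_sound hG hemp h (by simp) hg d hk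

end Step

/-! ### Termination of the algorithm -/

/-- The two runs terminate and are equal. -/
def Agree (x y : Run Bool) : Prop := ∃ r, x = some r ∧ y = some r

namespace Agree

variable {x x' y y' : Run Bool}

theorem ret (b : Bool) : Agree (Run.ret b) (Run.ret b) := ⟨_, rfl, rfl⟩

theorem tick (n : ℕ) (h : Agree x y) : Agree (x.tick n) (y.tick n) := by
  obtain ⟨r, rfl, rfl⟩ := h
  exact ⟨_, rfl, rfl⟩

theorem or (h : Agree x y) (h' : Agree x' y') : Agree (x.or x') (y.or y') := by
  obtain ⟨⟨_ | _, c⟩, rfl, rfl⟩ := h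
  · exact h'.tick c
  · exact ⟨_, rfl, rfl⟩

theorem and (h : Agree x y) (h' : Agree x' y') : Agree (x.and x') (y.and y') := by
  obtain ⟨⟨_ | _, c⟩, rfl, rfl⟩ := h
  · exact ⟨_, rfl, rfl⟩
  · exact h'.tick c

theorem all {α : Type} {f f' : α → Run Bool} {l : List α} (h : ∀ a ∈ l, Agree (f a) (f' a)) :
    Agree (Run.all l f) (Run.all l f') := by
  induction l with
  | nil => exact ret _
  | cons a l ih => exact (h a List.mem_cons_self).and (ih fun b hb => h b (List.mem_cons_of_mem _ hb))

theorem any {α : Type} {f f' : α → Run Bool} {l : List α} (h : ∀ a ∈ l, Agree (f a) (f' a)) :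
    Agree (Run.any l f) (Run.any l f') := by
  induction l with
  | nil => exact ret _
  | cons a l ih => exact (h a List.mem_cons_self).or (ih fun b hb => h b (List.mem_cons_of_mem _ hb))

end Agree

-- Runs with tests that agree

section Agree

variable {B : Type} {S : System B} {G : Kind → ℕ → Prop} {test test' : List Lit → Run Bool}

variable (G) in
/-- The two tests agree on goals on the unknowns given by `G`. -/
def TestAgree (test test' : List Lit → Run Bool) : Prop :=
  ∀ g, (∀ l ∈ g, G .type l.2) → Agree (test g) (test' g)

theorem agree_fldEmpty (hG : KindClosed S G) (hT : TestAgree G test test') {g : FldGoal}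
    (hg : ∀ l ∈ g, GoodFld G l.2) : Agree (fldEmpty S test g) (fldEmpty S test' g) :=
  .tick _ <| .all fun c hc => .or (.ret _) <| .and (.ret _) <| .or (.ret _) <|
    hT _ (forall_typesOf hG (forall_dnfFld hG hg c hc))

theorem agree_phi {test test' : FldGoal → Run Bool}
    (hT : ∀ g, (∀ l ∈ g, GoodFld G l.2) → Agree (test g) (test' g)) {tl : Tail} {Vp : List ℕ}
    {N : List (List Fld × Tail)} {R : List FldGoal} (hR : ∀ g ∈ R, ∀ l ∈ g, GoodFld G l.2)
    (hN : ∀ Q ∈ N, ∀ f ∈ Q.1, GoodFld G f) :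
    Agree (phi test tl Vp N R) (phi test' tl Vp N R) := by
  induction N generalizing R with
  | nil => exact .tick _ (.ret _)
  | cons Q N ih =>
    have hN' := fun Q hQ => hN Q (List.mem_cons_of_mem _ hQ)
    rw [phi, phi]
    refine .tick _ ?_
    split
    · refine .all fun k _ => ?_
      have hg := forall_set_append (k := k) hR (hN _ List.mem_cons_self) trivial
      exact .or (hT _ hg.1) (ih hg.2 hN')
    · exact ih hR hN'

theorem agree_recordEmpty (hG : KindClosed S G) (hT : TestAgree G test test') {P N : List Rec}
    (hP : ∀ R ∈ P, GoodRec G R) (hN : ∀ R ∈ N, GoodRec G R) :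
    Agree (recordEmpty S test P N) (recordEmpty S test' P N) := by
  have hgood : ∀ g ∈ (labelsOf (P ++ N)).map (fun ℓ => P.map fun R => (true, R.fieldAt ℓ)),
      ∀ l ∈ g, GoodFld G l.2 := by
    simp only [List.mem_map]
    rintro _ ⟨ℓ, -, rfl⟩ l hl
    obtain ⟨R, hR, rfl⟩ := List.mem_map.1 hl
    exact goodFld_fieldAt (hP R hR) ℓ
  have hf : ∀ g, (∀ l ∈ g, GoodFld G l.2) → Agree (fldEmpty S test g) (fldEmpty S test' g) :=
    fun g hg => agree_fldEmpty hG hT hg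
  refine .or (.any fun g hg => hf g (hgood g hg)) (agree_phi hf hgood ?_)
  simp only [List.mem_map]
  rintro _ ⟨R, hR, rfl⟩ f hf
  obtain ⟨ℓ, -, rfl⟩ := List.mem_map.1 hf
  exact goodFld_fieldAt (hN R hR) ℓ

theorem agree_arrowEmpty (hT : TestAgree G test test') {P N : List (ℕ × ℕ)}
    (hP : ∀ a ∈ P, GoodArrow G a) (hN : ∀ a ∈ N, GoodArrow G a) :
    Agree (arrowEmpty test P N) (arrowEmpty test' P N) := by
  refine .any fun a ha => .all fun p hp => ?_
  have hin := mem_of_mem_splits hp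
  exact .or (.tick _ (hT _ (forall_cons_map (hN _ ha).1 fun q hq =>
    (hP q ((hin q).2 (.inl hq))).1))) <| .and (.ret _) <|
    .tick _ (hT _ (forall_cons_map (hN _ ha).2 fun q hq => (hP q ((hin q).2 (.inr hq))).2))

theorem agree_clauseEmpty (emp : List B × List B → Bool) (hG : KindClosed S G)
    (hT : TestAgree G test test') {c : List Lit}
    (hc : ∀ l ∈ c, G .type l.2 ∧ (S.at l.2).IsAtom) :
    Agree (clauseEmpty S emp test c) (clauseEmpty S emp test' c) :=
  .or (.ret _) <| .and (.ret _) <|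
    .and (.or (.ret _) (agree_arrowEmpty hT (goodArrow_of_mem hG hc) (goodArrow_of_mem hG hc)))
      (.or (.ret _) (agree_recordEmpty hG hT (goodRec_of_mem hG hc) (goodRec_of_mem hG hc)))

end Agree

-- Finiteness of the goals under test

section Termination

variable {B : Type} {S : System B} (emp : List B × List B → Bool)

/-- The sets of literals on the unknowns in `u` that are not under test. -/
def untested (u : Finset ℕ) (hyps : List (List Lit)) : Finset (Finset Lit) :=
  (Finset.univ ×ˢ u).powerset \ (hyps.map List.toFinset).toFinset

/-- A goal that is not assumed empty is a new set of literals, so testing its subgoals leaves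
strictly fewer sets untested. The single run `r` for all large `n` makes the result independent of
the depth bound. -/
theorem exists_typeEmpty {u : Finset ℕ} (hu : KindClosed S fun _ i => i ∈ u) {m : ℕ}
    {hyps : List (List Lit)} {g : List Lit} (hg : ∀ l ∈ g, l.2 ∈ u)
    (hm : (untested u hyps).card ≤ m) :
    ∃ r, ∀ n, m + 1 ≤ n → typeEmpty S emp n hyps g = some r := by
  induction m using Nat.strong_induction_on generalizing hyps g with | _ m IH
  by_cases hc : ∃ h ∈ hyps, (∀ l ∈ h, l ∈ g) ∧ ∀ l ∈ g, l ∈ h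
  · refine ⟨(true, 1 + hyps.length + 0), fun n hn => ?_⟩
    obtain ⟨n, rfl⟩ : ∃ k, n = k + 1 := ⟨n - 1, by omega⟩
    rw [typeEmpty, if_pos hc]
    rfl
  · have hmem : g.toFinset ∈ untested u hyps := by
      refine Finset.mem_sdiff.2 ⟨Finset.mem_powerset.2 fun l hl => ?_, fun h => hc ?_⟩
      · exact Finset.mem_product.2 ⟨Finset.mem_univ _, hg l (List.mem_toFinset.1 hl)⟩
      · obtain ⟨h, hh, he⟩ := List.mem_map.1 (List.mem_toFinset.1 h)
        refine ⟨h, hh, fun l hl => ?_, fun l hl => ?_⟩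
        · rw [← List.mem_toFinset, ← he]
          exact List.mem_toFinset.2 hl
        · rw [← List.mem_toFinset, he]
          exact List.mem_toFinset.2 hl
    have hlt : (untested u (g :: hyps)).card < (untested u hyps).card := by
      refine Finset.card_lt_card ⟨fun F hF => ?_, fun h => ?_⟩
      · simp only [untested, Finset.mem_sdiff, List.map_cons, List.toFinset_cons,
          Finset.mem_insert, not_or] at hF ⊢
        exact ⟨hF.1, hF.2.2⟩
      · have := h hmem
        simp [untested] at this
    obtain _ | m := m
    · omega
    · have : ∀ g' : List Lit, ∃ r, (∀ l ∈ g', l.2 ∈ u) → ∀ n, m + 1 ≤ n →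
          typeEmpty S emp n (g :: hyps) g' = some r := by
        intro g'
        by_cases hg' : ∀ l ∈ g', l.2 ∈ u
        · obtain ⟨r, hr⟩ := IH m (Nat.lt_succ_self m) (hyps := g :: hyps) hg' (by omega)
          exact ⟨r, fun _ => hr⟩
        · exact ⟨(true, 0), fun h => absurd h hg'⟩
      choose T hT using this
      -- Replacing the inner test by its stable results `T` gives a run in which `n` no longer
      -- appears.
      have hag : ∀ n, m + 1 ≤ n → Agree
          (Run.all (dnf S g) (clauseEmpty S emp (typeEmpty S emp n (g :: hyps))))
          (Run.all (dnf S g) (clauseEmpty S emp fun g' => some (T g'))) := fun n hn =>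
        .all fun c hc => agree_clauseEmpty emp hu (fun g' hg' => ⟨T g', hT g' hg' n hn, rfl⟩)
          (forall_dnf (hu.conn .type) hg c hc)
      obtain ⟨r, -, hr⟩ := hag (m + 1) le_rfl
      refine ⟨(r.1, 1 + hyps.length + (dnfSize (dnf S g) + r.2)), fun n hn => ?_⟩
      · obtain ⟨n, rfl⟩ : ∃ k, n = k + 1 := ⟨n - 1, by omega⟩
        obtain ⟨r', h₁, h₂⟩ := hag n (by omega)
        rw [typeEmpty, if_neg hc, h₁, ← h₂, hr]
        rfl

/-- All unknowns that occur in right-hand sides, together with `i` and `j`, form a closed set. Kinds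
are ignored. -/
theorem exists_kindClosed (S : System B) (i j : ℕ) :
    ∃ u : Finset ℕ, i ∈ u ∧ j ∈ u ∧ KindClosed S fun _ k => k ∈ u := by
  have key : ∀ k, ∀ k' ∈ (S.at k).subterms, k' ∈ S.flatMap Node.subterms := by
    intro k k' hk'
    rcases Nat.lt_or_ge k S.length with hk | hk
    · refine List.mem_flatMap.2 ⟨S.at k, ?_, hk'⟩
      simp [System.at, hk]
    · simp [System.at, hk, Node.subterms] at hk'
  refine ⟨insert i (insert j (S.flatMap Node.subterms).toFinset), by simp, by simp, ?_, ?_, ?_, ?_⟩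
  all_goals simp only [Finset.mem_insert, List.mem_toFinset]
  · rintro - k k' - (h | ⟨_, h⟩ | ⟨_, h⟩) <;> exact .inr (.inr (key k _ (by simp [h, Node.subterms])))
  · exact fun k k' _ h => .inr (.inr (key k _ (by simp [h, Node.subterms])))
  · exact fun k _ _ _ h => ⟨.inr (.inr (key k _ (by simp [h, Node.subterms]))),
      .inr (.inr (key k _ (by simp [h, Node.subterms])))⟩
  · exact fun k _ _ _ h p hp => .inr (.inr (key k _ (by
      rw [h]
      exact List.mem_map_of_mem hp)))

/-- Neither contractivity nor kinding is required, so the search over depth bounds in the decision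
procedure is total on all systems. -/
theorem exists_subtypeAlg (S : System B) (i j : ℕ) :
    ∃ r n₀, ∀ n, n₀ ≤ n → subtypeAlg S emp n i j = some r := by
  obtain ⟨u, hi, hj, hu⟩ := exists_kindClosed S i j
  obtain ⟨r, hr⟩ := exists_typeEmpty emp hu (hyps := []) (g := [(true, i), (false, j)])
    (by simp [hi, hj]) le_rfl
  exact ⟨r, _, hr⟩

end Termination

/-! ### Computability of higher-order functions

Elements of a type are represented by natural numbers, and functions by the codes of partial
recursive functions acting on representations. -/

/-- A representation of the elements of `X` by natural numbers. -/
class Coded (X : Type) where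
  Codes : ℕ → X → Prop

/-- The function `f` is realized by a partial recursive function on representations. -/
def Effective {X Y : Type} [Coded X] [Coded Y] (f : X → Y) : Prop :=
  ∃ g : ℕ →. ℕ, Partrec g ∧ ∀ n x, Coded.Codes n x → ∃ m ∈ g n, Coded.Codes m (f x)

instance {X Y : Type} [Coded X] [Coded Y] : Coded (X × Y) where
  Codes n p := Coded.Codes n.unpair.1 p.1 ∧ Coded.Codes n.unpair.2 p.2

/-- A function may have many codes, or none; a code must respond correctly to every representation
of an argument. -/
instance {X Y : Type} [Coded X] [Coded Y] : Coded (X → Y) where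
  Codes e f := ∀ n x, Coded.Codes n x →
    ∃ m ∈ (Denumerable.ofNat Nat.Partrec.Code e).eval n, Coded.Codes m (f x)

/-- The representation is the encoding. -/
class Encoded (X : Type) [Primcodable X] [Coded X] : Prop where
  codes_iff (n : ℕ) (x : X) : Coded.Codes n x ↔ n = Encodable.encode x

/-- The representation of the elements of an encoded type by their codes. -/
abbrev Coded.ofEncodable (X : Type) [Encodable X] : Coded X where
  Codes n x := n = Encodable.encode x

instance : Coded ℕ := .ofEncodable ℕ
instance : Coded Bool := .ofEncodable Bool
instance {X : Type} [Primcodable X] : Coded (List X) := .ofEncodable (List X)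
instance {X : Type} [Primcodable X] : Coded (Option X) := .ofEncodable (Option X)
instance : Coded Tail := .ofEncodable Tail
instance {B X : Type} [Primcodable B] [Primcodable X] : Coded (Node B X) := .ofEncodable (Node B X)

instance : Encoded ℕ := ⟨fun _ _ => Iff.rfl⟩
instance : Encoded Bool := ⟨fun _ _ => Iff.rfl⟩
instance {X : Type} [Primcodable X] : Encoded (List X) := ⟨fun _ _ => Iff.rfl⟩
instance {X : Type} [Primcodable X] : Encoded (Option X) := ⟨fun _ _ => Iff.rfl⟩
instance : Encoded Tail := ⟨fun _ _ => Iff.rfl⟩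
instance {B X : Type} [Primcodable B] [Primcodable X] : Encoded (Node B X) := ⟨fun _ _ => Iff.rfl⟩

instance {X Y : Type} [Primcodable X] [Coded X] [Encoded X] [Primcodable Y] [Coded Y] [Encoded Y] :
    Encoded (X × Y) where
  codes_iff n p := by
    rw [show Coded.Codes n p ↔ Coded.Codes n.unpair.1 p.1 ∧ Coded.Codes n.unpair.2 p.2 from
      Iff.rfl, Encoded.codes_iff, Encoded.codes_iff, Encodable.encode_prod_val]
    constructor
    · rintro ⟨h₁, h₂⟩
      rw [← h₁, ← h₂, Nat.pair_unpair]
    · rintro rfl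
      simp

/-- Fields of record types are encoded as optional optional unknowns. -/
def Fld.equiv : Fld ≃ Option (Option ℕ) where
  toFun
    | .top => none
    | .absent => some none
    | .ref i => some (some i)
  invFun
    | none => .top
    | some none => .absent
    | some (some i) => .ref i
  left_inv f := by cases f <;> rfl
  right_inv o := by rcases o with _ | _ | _ <;> rfl

instance : Primcodable Fld := Primcodable.ofEquiv _ Fld.equiv
instance : Coded Fld := .ofEncodable Fld
instance : Encoded Fld := ⟨fun _ _ => Iff.rfl⟩

namespace Effective

variable {Γ X Y : Type} [Coded Γ] [Coded X] [Coded Y]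

theorem id : Effective fun γ : Γ => γ := ⟨_, Partrec.some, fun n _ h => ⟨n, by simp, h⟩⟩

theorem comp {f : X → Y} {a : Γ → X} (hf : Effective f) (ha : Effective a) :
    Effective fun γ => f (a γ) := by
  obtain ⟨g, hg, hf⟩ := hf
  obtain ⟨g', hg', ha⟩ := ha
  refine ⟨fun n => (g' n).bind g, hg'.bind (hg.comp Computable.snd).to₂, fun n γ h => ?_⟩
  obtain ⟨m, hm, hma⟩ := ha n γ h
  obtain ⟨k, hk, hkf⟩ := hf m _ hma
  exact ⟨k, Part.mem_bind hm hk, hkf⟩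

theorem pair {a : Γ → X} {b : Γ → Y} (ha : Effective a) (hb : Effective b) :
    Effective fun γ => (a γ, b γ) := by
  obtain ⟨g, hg, ha⟩ := ha
  obtain ⟨g', hg', hb⟩ := hb
  refine ⟨fun n => (g n).bind fun m => (g' n).map fun k => Nat.pair m k,
    hg.bind (Partrec.map (hg'.comp Computable.fst)
      (Primrec₂.natPair.to_comp.comp (Computable.snd.comp Computable.fst) Computable.snd).to₂).to₂,
    fun n γ h => ?_⟩
  obtain ⟨m, hm, hma⟩ := ha n γ h
  obtain ⟨k, hk, hkb⟩ := hb n γ h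
  refine ⟨Nat.pair m k, Part.mem_bind hm (Part.mem_map _ hk), ?_⟩
  constructor <;> simpa

theorem fst {a : Γ → X × Y} (ha : Effective a) : Effective fun γ => (a γ).1 :=
  comp (f := fun p : X × Y => p.1) ⟨_, Computable.fst.comp Computable.unpair,
    fun n _ h => ⟨n.unpair.1, by simp, h.1⟩⟩ ha

theorem snd {a : Γ → X × Y} (ha : Effective a) : Effective fun γ => (a γ).2 :=
  comp (f := fun p : X × Y => p.2) ⟨_, Computable.snd.comp Computable.unpair,
    fun n _ h => ⟨n.unpair.2, by simp, h.2⟩⟩ ha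

/-- The universal partial recursive function evaluates the code of `f γ`. -/
theorem app {f : Γ → X → Y} {a : Γ → X} (hf : Effective f) (ha : Effective a) :
    Effective fun γ => f γ (a γ) := by
  refine comp (f := fun p : (X → Y) × X => p.1 p.2)
    ⟨fun n => (Denumerable.ofNat Nat.Partrec.Code n.unpair.1).eval n.unpair.2, ?_,
      fun n p h => h.1 _ _ h.2⟩ (pair hf ha)
  exact Nat.Partrec.Code.eval_part.comp
    ((Computable.ofNat _).comp (Computable.fst.comp Computable.unpair))
    (Computable.snd.comp Computable.unpair)

/-- The s-m-n theorem: currying the program at a representation of `γ` computes a code of the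
function `f γ`. -/
theorem lam {f : Γ → X → Y} (hf : Effective fun p : Γ × X => f p.1 p.2) :
    Effective fun γ x => f γ x := by
  obtain ⟨g, hg, hf⟩ := hf
  obtain ⟨c, rfl⟩ := Nat.Partrec.Code.exists_code.1 (Partrec.nat_iff.1 hg)
  refine ⟨fun n => Part.some (Encodable.encode (c.curry n)), Computable.encode.comp
    (Nat.Partrec.Code.primrec₂_curry.to_comp.comp (Computable.const c) Computable.id),
    fun n γ hγ => ⟨_, Part.mem_some _, fun m x hx => ?_⟩⟩
  rw [Denumerable.ofNat_encode, Nat.Partrec.Code.eval_curry]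
  exact hf _ (γ, x) ⟨by simpa, by simpa⟩

theorem of_computable [Primcodable X] [Encoded X] [Primcodable Y] [Encoded Y] {f : X → Y}
    (hf : Computable f) : Effective f := by
  refine ⟨_, Partrec.nat_iff.2 hf, fun n x hx => ?_⟩
  rw [Encoded.codes_iff] at hx
  subst hx
  exact ⟨Encodable.encode (f x), by simp, (Encoded.codes_iff _ _).2 rfl⟩

/-- The way back from realizability: on encoded types representations are unique, so the realizer
computes `f` itself. -/
theorem computable [Primcodable X] [Encoded X] [Primcodable Y] [Encoded Y] {f : X → Y}
    (hf : Effective f) : Computable f := by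
  obtain ⟨g, hg, hf⟩ := hf
  refine Computable.encode_iff.1 ((hg.comp Computable.encode).of_eq fun x => ?_)
  obtain ⟨m, hm, hmf⟩ := hf _ x ((Encoded.codes_iff _ _).2 rfl)
  rw [Encoded.codes_iff] at hmf
  subst hmf
  exact Part.eq_some_iff.2 hm

theorem const [Primcodable X] [Encoded X] (x : X) : Effective fun _ : Γ => x :=
  ⟨_, Computable.const (Encodable.encode x), fun _ _ _ =>
    ⟨_, Part.mem_some _, (Encoded.codes_iff _ _).2 rfl⟩⟩

theorem comp₁ {X Y : Type} [Primcodable X] [Coded X] [Encoded X] [Primcodable Y] [Coded Y]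
    [Encoded Y] {f : X → Y} (hf : Primrec f) {a : Γ → X} (ha : Effective a) :
    Effective fun γ => f (a γ) :=
  (of_computable hf.to_comp).comp ha

theorem comp₂ {X Y Z : Type} [Primcodable X] [Coded X] [Encoded X] [Primcodable Y] [Coded Y]
    [Encoded Y] [Primcodable Z] [Coded Z] [Encoded Z] {f : X → Y → Z} (hf : Primrec₂ f)
    {a : Γ → X} {b : Γ → Y} (ha : Effective a) (hb : Effective b) :
    Effective fun γ => f (a γ) (b γ) :=
  (of_computable (f := fun p : X × Y => f p.1 p.2) hf.to_comp).comp (ha.pair hb)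

/-- The type `Y` may be a function type. This is essential for `phi`, whose recursion changes the
argument `R`, and for `typeEmpty`, whose recursive calls are handed over as a test. -/
theorem natRec {n : Γ → ℕ} {z : Γ → Y} {s : Γ → ℕ → Y → Y} (hn : Effective n) (hz : Effective z)
    (hs : Effective fun p : (Γ × ℕ) × Y => s p.1.1 p.1.2 p.2) :
    Effective fun γ => (Nat.rec (z γ) (s γ) (n γ) : Y) := by
  obtain ⟨gn, hgn, hn⟩ := hn
  obtain ⟨gz, hgz, hz⟩ := hz
  obtain ⟨gs, hgs, hs⟩ := hs
  refine ⟨fun m => (gn m).bind fun k =>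
    Nat.rec (gz m) (fun j r => r.bind fun y => gs (Nat.pair (Nat.pair m j) y)) k, ?_, ?_⟩
  · refine hgn.bind (Partrec.nat_rec (f := fun p : ℕ × ℕ => p.2) (g := fun p : ℕ × ℕ => gz p.1)
      (h := fun (p : ℕ × ℕ) (q : ℕ × ℕ) => gs (Nat.pair (Nat.pair p.1 q.1) q.2))
      Computable.snd (hgz.comp Computable.fst) ?_).to₂
    have : Primrec fun p : (ℕ × ℕ) × ℕ × ℕ => Nat.pair (Nat.pair p.1.1 p.2.1) p.2.2 :=
      Primrec₂.natPair.comp (Primrec₂.natPair.comp (Primrec.fst.comp Primrec.fst)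
        (Primrec.fst.comp Primrec.snd)) (Primrec.snd.comp Primrec.snd)
    exact hgs.comp this.to_comp
  · intro m γ hγ
    obtain ⟨k, hk, hkn⟩ := hn m γ hγ
    have hkn : k = n γ := hkn
    subst hkn
    suffices ∀ j : ℕ, ∃ r ∈ (Nat.rec (gz m) (fun j r => r.bind fun y =>
        gs (Nat.pair (Nat.pair m j) y)) j : Part ℕ), Coded.Codes r (Nat.rec (z γ) (s γ) j : Y) by
      obtain ⟨r, hr, hr'⟩ := this (n γ)
      exact ⟨r, Part.mem_bind hk hr, hr'⟩
    intro j
    induction j with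
    | zero => exact hz m γ hγ
    | succ j ih =>
      obtain ⟨r, hr, hr'⟩ := ih
      obtain ⟨q, hq, hq'⟩ := hs (Nat.pair (Nat.pair m j) r) ((γ, j), _)
        ⟨⟨by simpa, by simp [Coded.Codes]⟩, by simpa⟩
      exact ⟨q, Part.mem_bind hr hq, hq'⟩

theorem optionElim [Primcodable X] [Encoded X] {o : Γ → Option X} {z : Γ → Y} {s : Γ → X → Y}
    (ho : Effective o) (hz : Effective z) (hs : Effective fun p : Γ × X => s p.1 p.2) :
    Effective fun γ => (o γ).elim (z γ) (s γ) := by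
  obtain ⟨go, hgo, ho⟩ := ho
  obtain ⟨gz, hgz, hz⟩ := hz
  obtain ⟨gs, hgs, hs⟩ := hs
  refine ⟨fun m => (go m).bind fun k =>
    -- The encoding of `none` is `0`, and that of `some x` is the code of `x` plus one.
    bif k == 0 then gz m else gs (Nat.pair m (k - 1)), ?_, ?_⟩
  · refine hgo.bind (Partrec.cond (c := fun p : ℕ × ℕ => p.2 == 0)
      (f := fun p => gz p.1) (g := fun p => gs (Nat.pair p.1 (p.2 - 1)))
      (Primrec.beq.comp Primrec.snd (Primrec.const 0)).to_comp
      (hgz.comp Computable.fst) (hgs.comp (Primrec.to_comp ?_))).to₂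
    exact Primrec₂.natPair.comp Primrec.fst
      (Primrec.nat_sub.comp Primrec.snd (Primrec.const 1))
  · intro m γ hγ
    obtain ⟨k, hk, hko⟩ := ho m γ hγ
    have hko : k = Encodable.encode (o γ) := hko
    cases h : o γ with
    | none =>
      rw [h] at hko
      obtain ⟨r, hr, hr'⟩ := hz m γ hγ
      refine ⟨r, Part.mem_bind hk ?_, by simpa [h] using hr'⟩
      simpa [hko] using hr
    | some x =>
      rw [h] at hko
      obtain ⟨r, hr, hr'⟩ := hs (Nat.pair m (Encodable.encode x)) (γ, x)
        ⟨by simpa, by simpa using (Encoded.codes_iff _ _).2 rfl⟩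
      refine ⟨r, Part.mem_bind hk ?_, by simpa [h] using hr'⟩
      simpa [hko] using hr

theorem cond {c : Γ → Bool} {a b : Γ → Y} (hc : Effective c) (ha : Effective a)
    (hb : Effective b) : Effective fun γ => bif c γ then a γ else b γ := by
  have h : Effective fun γ => (bif c γ then some true else none).elim (b γ) fun _ => a γ :=
    optionElim (comp₁ (f := fun b => bif b then some true else none) (Primrec.dom_bool _) hc) hb
      (ha.comp (fst id))
  convert h using 2 with γ
  cases c γ <;> rfl

end Effective

-- Effective operations on lists

set_option linter.unusedSectionVars false

/-- A fold is a loop over positions; reading beyond the end leaves the accumulator unchanged. Thus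
recursion on lists reduces to `Effective.natRec`. -/
theorem foldl_eq_natRec {α β : Type} (f : β → α → β) (z : β) (l : List α) :
    l.foldl f z = Nat.rec z (fun k y => (l[k]?).elim y (f y)) l.length := by
  suffices ∀ n, Nat.rec z (fun k y => (l[k]?).elim y (f y)) n = (l.take n).foldl f z by
    rw [this, List.take_length]
  intro n
  induction n with
  | zero => simp
  | succ n ih =>
    rw [List.take_add_one, List.foldl_append, ← ih]
    cases h : l[n]? <;> simp [h]

namespace Effective

variable {Γ X X' Y : Type} [Coded Γ] [Coded X] [Coded X'] [Coded Y] [Primcodable X] [Encoded X]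
  [Primcodable X'] [Encoded X']

theorem foldr {l : Γ → List X} {z : Γ → Y} {s : Γ → X → Y → Y} (hl : Effective l)
    (hz : Effective z) (hs : Effective fun p : (Γ × X) × Y => s p.1.1 p.1.2 p.2) :
    Effective fun γ => (l γ).foldr (s γ) (z γ) := by
  have hr : Effective fun γ => (l γ).reverse := comp₁ Primrec.list_reverse hl
  have h := natRec (s := fun γ k y => ((l γ).reverse[k]?).elim y fun a => s γ a y)
    (comp₁ Primrec.list_length hr) hz
    (optionElim (comp₂ Primrec.list_getElem? (hr.comp id.fst.fst) id.fst.snd) id.snd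
      (hs.comp (pair (pair id.fst.fst.fst id.snd) id.fst.snd)))
  convert h using 2 with γ
  rw [← List.foldl_reverse, foldl_eq_natRec]

variable {l l' : Γ → List X} {a b : Γ → X}

theorem cons (ha : Effective a) (hl : Effective l) : Effective fun γ => a γ :: l γ :=
  comp₂ Primrec.list_cons ha hl

theorem append (hl : Effective l) (hl' : Effective l') : Effective fun γ => l γ ++ l' γ :=
  comp₂ Primrec.list_append hl hl'

theorem length (hl : Effective l) : Effective fun γ => (l γ).length :=
  comp₁ Primrec.list_length hl

theorem map {s : Γ → X → X'} (hl : Effective l) (hs : Effective fun p : Γ × X => s p.1 p.2) :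
    Effective fun γ => (l γ).map (s γ) := by
  simp only [List.map_eq_foldr]
  exact foldr hl (const _) (cons (hs.comp id.fst) id.snd)

theorem flatMap {s : Γ → X → List X'} (hl : Effective l)
    (hs : Effective fun p : Γ × X => s p.1 p.2) : Effective fun γ => (l γ).flatMap (s γ) := by
  have h := foldr (s := fun γ a r => s γ a ++ r) (z := fun _ => []) hl (const _) (append (hs.comp id.fst) id.snd)
  convert h using 2 with γ
  induction l γ with
  | nil => rfl
  | cons a l ih => simp [ih]

theorem filterMap {s : Γ → X → Option X'} (hl : Effective l)
    (hs : Effective fun p : Γ × X => s p.1 p.2) : Effective fun γ => (l γ).filterMap (s γ) := by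
  have h := foldr (s := fun γ a r => (s γ a).elim r fun b => b :: r) (z := fun _ => []) hl
    (const _) (optionElim (hs.comp id.fst) id.snd (cons id.snd id.fst.snd))
  convert h using 2 with γ
  induction l γ with
  | nil => rfl
  | cons a l ih => cases h : s γ a <;> simp [ih, h]

theorem filter {s : Γ → X → Bool} (hl : Effective l)
    (hs : Effective fun p : Γ × X => s p.1 p.2) : Effective fun γ => (l γ).filter (s γ) := by
  have h := foldr (s := fun γ a r => bif s γ a then a :: r else r) (z := fun _ => []) hl
    (const _) (cond (hs.comp id.fst) (cons id.fst.snd id.snd) id.snd)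
  convert h using 2 with γ
  induction l γ with
  | nil => rfl
  | cons a l ih => cases h : s γ a <;> simp [ih, h]

theorem and {p q : Γ → Bool} (hp : Effective p) (hq : Effective q) :
    Effective fun γ => p γ && q γ :=
  comp₂ Primrec.and hp hq

theorem or {p q : Γ → Bool} (hp : Effective p) (hq : Effective q) :
    Effective fun γ => p γ || q γ :=
  comp₂ Primrec.or hp hq

theorem not {p : Γ → Bool} (hp : Effective p) : Effective fun γ => !p γ :=
  comp₁ Primrec.not hp

theorem any {s : Γ → X → Bool} (hl : Effective l)
    (hs : Effective fun p : Γ × X => s p.1 p.2) : Effective fun γ => (l γ).any (s γ) := by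
  have h := foldr (s := fun γ a r => s γ a || r) (z := fun _ => false) hl (const _) (or (hs.comp id.fst) id.snd)
  convert h using 2 with γ
  induction l γ with
  | nil => rfl
  | cons a l ih => simp [ih]

theorem all {s : Γ → X → Bool} (hl : Effective l)
    (hs : Effective fun p : Γ × X => s p.1 p.2) : Effective fun γ => (l γ).all (s γ) := by
  have h := foldr (s := fun γ a r => s γ a && r) (z := fun _ => true) hl (const _) (and (hs.comp id.fst) id.snd)
  convert h using 2 with γ
  induction l γ with
  | nil => rfl
  | cons a l ih => simp [ih]

theorem eq [DecidableEq X] (ha : Effective a) (hb : Effective b) :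
    Effective fun γ => decide (a γ = b γ) :=
  comp₂ Primrec.eq.decide ha hb

theorem mem [DecidableEq X] (ha : Effective a) (hl : Effective l) :
    Effective fun γ => decide (a γ ∈ l γ) := by
  have h := any (s := fun γ b => decide (a γ = b)) hl (eq (ha.comp id.fst) id.snd)
  convert h using 2 with γ
  rw [Bool.eq_iff_iff]
  simp

theorem isEmpty (hl : Effective l) : Effective fun γ => (l γ).isEmpty := by
  have h := eq (length hl) (const 0)
  convert h using 2 with γ
  rw [Bool.eq_iff_iff]
  simp

theorem ite {c : Γ → Prop} [DecidablePred c] {u v : Γ → Y} (hc : Effective fun γ => decide (c γ))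
    (hu : Effective u) (hv : Effective v) : Effective fun γ => if c γ then u γ else v γ := by
  have h := cond hc hu hv
  convert h using 2 with γ
  exact (Bool.cond_decide _ _ _).symm

theorem dedup [DecidableEq X] (hl : Effective l) : Effective fun γ => (l γ).dedup := by
  have h := foldr (s := fun _ a r => if a ∈ r then r else a :: r) (z := fun _ => []) hl (const _)
    (ite (mem id.fst.snd id.snd) id.snd (cons id.fst.snd id.snd))
  convert h using 2 with γ
  induction l γ with
  | nil => rfl
  | cons a l ih =>
    rw [List.foldr_cons, ← ih]
    by_cases ha : a ∈ l <;> simp [ha]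

theorem lookup {k : Γ → ℕ} {l : Γ → List (ℕ × X)} (hk : Effective k) (hl : Effective l) :
    Effective fun γ => (l γ).lookup (k γ) := by
  have h := foldr (s := fun γ a r => if k γ = a.1 then some a.2 else r) (z := fun _ => none) hl
    (const _) (ite (eq (hk.comp id.fst.fst) id.fst.snd.fst)
      (comp₁ Primrec.option_some id.fst.snd.snd) id.snd)
  convert h using 2 with γ
  induction l γ with
  | nil => rfl
  | cons a l ih =>
    obtain ⟨i, x⟩ := a
    by_cases hi : k γ = i
    · simp [hi]
    · simp [List.lookup_cons, hi, ih, beq_eq_false_iff_ne.2 hi]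

theorem getD {k : Γ → ℕ} (d : X) (hl : Effective l) (hk : Effective k) :
    Effective fun γ => (l γ).getD (k γ) d :=
  comp₂ (Primrec.list_getD d) hl hk

theorem set {k : Γ → ℕ} (hl : Effective l) (hk : Effective k) (ha : Effective a) :
    Effective fun γ => (l γ).set (k γ) (a γ) :=
  comp₂ (f := fun l (p : ℕ × X) => l.set p.1 p.2) Primrec.list_set hl (pair hk ha)

theorem range {k : Γ → ℕ} (hk : Effective k) : Effective fun γ => List.range (k γ) :=
  comp₁ Primrec.list_range hk

theorem add {m n : Γ → ℕ} (hm : Effective m) (hn : Effective n) : Effective fun γ => m γ + n γ :=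
  comp₂ Primrec.nat_add hm hn

theorem sum {l : Γ → List ℕ} (hl : Effective l) : Effective fun γ => (l γ).sum :=
  foldr hl (const 0) (add id.fst.snd id.snd)

theorem some (ha : Effective a) : Effective fun γ => Option.some (a γ) :=
  comp₁ Primrec.option_some ha

end Effective

/-! ### Computability of the algorithm -/

-- Primitive recursive destructors of layers, fields and tails

section Views

theorem primrec_getLeft? {X Y : Type} [Primcodable X] [Primcodable Y] :
    Primrec (Sum.getLeft? : X ⊕ Y → Option X) :=
  (Primrec.sumCasesOn (f := fun s : X ⊕ Y => s) (g := fun _ x => some x)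
    (h := fun _ _ => (none : Option X)) Primrec.id
    (Primrec.option_some.comp Primrec.snd).to₂ (Primrec.const none).to₂).of_eq fun s => by
      cases s <;> rfl

theorem primrec_getRight? {X Y : Type} [Primcodable X] [Primcodable Y] :
    Primrec (Sum.getRight? : X ⊕ Y → Option Y) :=
  (Primrec.sumCasesOn (f := fun s : X ⊕ Y => s) (g := fun _ _ => (none : Option Y))
    (h := fun _ y => some y) Primrec.id
    (Primrec.const none).to₂ (Primrec.option_some.comp Primrec.snd).to₂).of_eq fun s => by
      cases s <;> rfl

variable {B X : Type} [Primcodable B] [Primcodable X]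

def Node.neg? : Node B X → Option X
  | .neg x => some x
  | _ => none

def Node.or? : Node B X → Option (X × X)
  | .or x y => some (x, y)
  | _ => none

def Node.tvar? : Node B X → Option ℕ
  | .tvar α => some α
  | _ => none

def Node.basic? : Node B X → Option B
  | .basic b => some b
  | _ => none

def Node.arrow? : Node B X → Option (X × X)
  | .arrow x y => some (x, y)
  | _ => none

def Node.record? : Node B X → Option (List (ℕ × X) × Tail)
  | .record fs tl => some (fs, tl)
  | _ => none

def Node.fvar? : Node B X → Option ℕ
  | .fvar θ => some θ
  | _ => none

def Node.ofType? : Node B X → Option X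
  | .ofType x => some x
  | _ => none

def Node.isEmpty : Node B X → Bool
  | .empty => true
  | _ => false

def Node.isUndef : Node B X → Bool
  | .undef => true
  | _ => false

theorem Node.primrec_equiv : Primrec (Node.equiv B X) := Primrec.of_equiv

theorem Node.primrec_neg? : Primrec (Node.neg? : Node B X → Option X) :=
  (Primrec.option_bind₁ primrec_getLeft? |>.comp <| Primrec.option_bind₁ primrec_getRight? |>.comp <|
    Primrec.option_bind₁ primrec_getLeft? |>.comp <| primrec_getLeft?.comp
      Node.primrec_equiv).of_eq fun n => by cases n <;> rfl

theorem Node.primrec_or? : Primrec (Node.or? : Node B X → Option (X × X)) :=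
  (Primrec.option_bind₁ primrec_getRight? |>.comp <| Primrec.option_bind₁ primrec_getLeft? |>.comp <|
    Primrec.option_bind₁ primrec_getLeft? |>.comp <| primrec_getLeft?.comp
      Node.primrec_equiv).of_eq fun n => by cases n <;> rfl

theorem Node.primrec_isEmpty : Primrec (Node.isEmpty : Node B X → Bool) :=
  (Primrec.option_isSome.comp <| Primrec.option_bind₁ primrec_getLeft? |>.comp <|
    Primrec.option_bind₁ primrec_getLeft? |>.comp <|
    Primrec.option_bind₁ primrec_getLeft? |>.comp <| primrec_getLeft?.comp
      Node.primrec_equiv).of_eq fun n => by cases n <;> rfl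

theorem Node.primrec_tvar? : Primrec (Node.tvar? : Node B X → Option ℕ) :=
  (Primrec.option_bind₁ primrec_getRight? |>.comp <|
    Primrec.option_bind₁ primrec_getRight? |>.comp <|
    Primrec.option_bind₁ primrec_getLeft? |>.comp <| primrec_getLeft?.comp
      Node.primrec_equiv).of_eq fun n => by cases n <;> rfl

theorem Node.primrec_basic? : Primrec (Node.basic? : Node B X → Option B) :=
  (Primrec.option_bind₁ primrec_getLeft? |>.comp <| Primrec.option_bind₁ primrec_getRight? |>.comp <|
    primrec_getLeft?.comp Node.primrec_equiv).of_eq fun n => by cases n <;> rfl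

theorem Node.primrec_arrow? : Primrec (Node.arrow? : Node B X → Option (X × X)) :=
  (Primrec.option_bind₁ primrec_getRight? |>.comp <|
    Primrec.option_bind₁ primrec_getRight? |>.comp <|
    primrec_getLeft?.comp Node.primrec_equiv).of_eq fun n => by cases n <;> rfl

theorem Node.primrec_record? :
    Primrec (Node.record? : Node B X → Option (List (ℕ × X) × Tail)) :=
  (Primrec.option_bind₁ primrec_getLeft? |>.comp <| Primrec.option_bind₁ primrec_getLeft? |>.comp <|
    primrec_getRight?.comp Node.primrec_equiv).of_eq fun n => by cases n <;> rfl

theorem Node.primrec_fvar? : Primrec (Node.fvar? : Node B X → Option ℕ) :=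
  (Primrec.option_bind₁ primrec_getRight? |>.comp <| Primrec.option_bind₁ primrec_getLeft? |>.comp <|
    primrec_getRight?.comp Node.primrec_equiv).of_eq fun n => by cases n <;> rfl

theorem Node.primrec_isUndef : Primrec (Node.isUndef : Node B X → Bool) :=
  (Primrec.option_isSome.comp <| Primrec.option_bind₁ primrec_getLeft? |>.comp <|
    Primrec.option_bind₁ primrec_getRight? |>.comp <|
    primrec_getRight?.comp Node.primrec_equiv).of_eq fun n => by cases n <;> rfl

theorem Node.primrec_ofType? : Primrec (Node.ofType? : Node B X → Option X) :=
  (Primrec.option_bind₁ primrec_getRight? |>.comp <|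
    Primrec.option_bind₁ primrec_getRight? |>.comp <|
    primrec_getRight?.comp Node.primrec_equiv).of_eq fun n => by cases n <;> rfl

def Fld.ref? : Fld → Option ℕ
  | .ref i => some i
  | _ => none

theorem Fld.primrec_ref? : Primrec Fld.ref? :=
  ((Primrec.option_bind₁ Primrec.id).comp (Primrec.of_equiv (e := Fld.equiv))).of_eq fun f => by
    cases f <;> rfl

theorem Fld.primrec_ref : Primrec Fld.ref :=
  (Primrec.of_equiv_symm (e := Fld.equiv)).comp (Primrec.option_some.comp Primrec.option_some)

def Tail.row? : Tail → Option ℕ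
  | .row ρ => some ρ
  | _ => none

theorem Tail.primrec_row? : Primrec Tail.row? :=
  ((Primrec.option_bind₁ Primrec.id).comp (Primrec.of_equiv (e := Tail.equiv))).of_eq fun f => by
    cases f <;> rfl

theorem Tail.primrec_row : Primrec Tail.row :=
  (Primrec.of_equiv_symm (e := Tail.equiv)).comp (Primrec.option_some.comp Primrec.option_some)

end Views

set_option linter.unusedSectionVars false

namespace Effective

-- Effectiveness of normal forms

section Normal

variable {Γ B : Type} [Coded Γ] [Primcodable B]

theorem meet {X : Type} [Primcodable X] [Coded X] [Encoded X] {D E : Γ → List (List X)}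
    (hD : Effective D) (hE : Effective E) : Effective fun γ => meet (D γ) (E γ) := by
  have : Effective fun p : List (List X) × List (List X) => RowTypes.meet p.1 p.2 := by
    unfold RowTypes.meet
    apply_rules [id, fst, snd, flatMap, map, append]
  exact this.comp (pair hD hE)

theorem dnfSize {X : Type} [Primcodable X] [Coded X] [Encoded X] {D : Γ → List (List X)}
    (hD : Effective D) : Effective fun γ => dnfSize (D γ) := by
  have : Effective fun D : List (List X) => RowTypes.dnfSize D := by
    unfold RowTypes.dnfSize
    apply_rules [id, sum, map, add, const, length, snd]
  exact this.comp hD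

theorem at' {S : Γ → System B} {i : Γ → ℕ} (hS : Effective S) (hi : Effective i) :
    Effective fun γ => (S γ).at (i γ) :=
  getD _ hS hi

/-- Recursion on the bound with values in functions of the literal; the pattern matching is
expressed by the destructors, so that each step is visibly effective. -/
theorem dnfLit_eq_natRec (S : System B) (n : ℕ) :
    RowTypes.dnfLit S n = Nat.rec (fun _ => []) (fun _ r l =>
      (S.at l.2).neg?.elim
        ((S.at l.2).or?.elim
          (bif (S.at l.2).isEmpty then (bif l.1 then [] else [[]]) else [[l]])
          fun q => bif l.1 then r (true, q.1) ++ r (true, q.2)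
            else RowTypes.meet (r (false, q.1)) (r (false, q.2)))
        fun j => r (!l.1, j)) n := by
  induction n with
  | zero => rfl
  | succ n ih =>
    dsimp only
    rw [← ih]
    funext ⟨p, i⟩
    conv_lhs => unfold RowTypes.dnfLit
    cases S.at i <;> cases p <;> rfl

theorem dnfLit {S : Γ → System B} {n : Γ → ℕ} {l : Γ → Lit} (hS : Effective S) (hn : Effective n)
    (hl : Effective l) : Effective fun γ => dnfLit (S γ) (n γ) (l γ) := by
  have : Effective fun p : System B × ℕ => RowTypes.dnfLit p.1 p.2 := by
    simp only [dnfLit_eq_natRec]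
    apply natRec
    · exact id.snd
    · exact lam (const _)
    · apply lam
      have hat : Effective fun p : (((System B × ℕ) × ℕ) × (Lit → List (List Lit))) × Lit =>
          p.1.1.1.1.at p.2.2 := at' id.fst.fst.fst.fst id.snd.snd
      apply optionElim
      · exact comp₁ Node.primrec_neg? hat
      · apply optionElim
        · exact comp₁ Node.primrec_or? hat
        · apply_rules [cond, const, cons, id, snd, fst, comp₁ Node.primrec_isEmpty hat]
        · exact cond id.fst.snd.fst
            (append (app id.fst.fst.snd (pair (const true) id.snd.fst))
              (app id.fst.fst.snd (pair (const true) id.snd.snd)))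
            (meet (app id.fst.fst.snd (pair (const false) id.snd.fst))
              (app id.fst.fst.snd (pair (const false) id.snd.snd)))
      · exact app id.fst.fst.snd (pair (not id.fst.snd.fst) id.snd)
  exact (this.comp (hS.pair hn)).app hl

theorem dnf {S : Γ → System B} {g : Γ → List Lit} (hS : Effective S) (hg : Effective g) :
    Effective fun γ => dnf (S γ) (g γ) := by
  have : Effective fun p : System B × List Lit => RowTypes.dnf p.1 p.2 := by
    unfold RowTypes.dnf
    apply_rules [foldr, id, fst, snd, meet, dnfLit, add, length, const]
  exact this.comp (hS.pair hg)

theorem dnfFldLit_eq (S : System B) (l : Bool × Fld) : RowTypes.dnfFldLit S l =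
    l.2.ref?.elim (bif decide (l.2 = .top) then (bif l.1 then [[]] else []) else [[l]])
      fun i => (RowTypes.dnfLit S (S.length + 1) (l.1, i)).map fun c =>
        c.map fun l => (l.1, .ref l.2) := by
  obtain ⟨p, f⟩ := l
  cases f <;> cases p <;> rfl

theorem dnfFld {S : Γ → System B} {g : Γ → FldGoal} (hS : Effective S) (hg : Effective g) :
    Effective fun γ => dnfFld (S γ) (g γ) := by
  have : Effective fun p : System B × FldGoal => RowTypes.dnfFld p.1 p.2 := by
    unfold RowTypes.dnfFld
    simp only [dnfFldLit_eq]
    refine foldr id.snd (const _) (meet (optionElim (comp₁ Fld.primrec_ref? id.fst.snd.snd)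
      (cond (eq id.fst.snd.snd (const _)) (cond id.fst.snd.fst (const _) (const _))
        (cons (cons id.fst.snd (const _)) (const _))) ?_) id.snd)
    refine map (dnfLit id.fst.fst.fst.fst (add (length id.fst.fst.fst.fst) (const 1))
      (pair id.fst.fst.snd.fst id.snd)) (map id.snd (pair id.snd.fst
        (comp₁ Fld.primrec_ref id.snd.snd)))
  exact this.comp (hS.pair hg)

theorem fvarsOf {S : Γ → System B} {p : Γ → Bool} {c : Γ → FldGoal} (hS : Effective S)
    (hp : Effective p) (hc : Effective c) : Effective fun γ => fvarsOf (S γ) (p γ) (c γ) := by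
  have h : Effective fun p : System B × Bool × FldGoal => p.2.2.filterMap fun l =>
      l.2.ref?.elim none fun i => (p.1.at i).fvar?.elim none fun θ =>
        if l.1 = p.2.1 then Option.some θ else none := by
    apply_rules [filterMap, id, fst, snd, optionElim, comp₁ Fld.primrec_ref?, const,
      comp₁ Node.primrec_fvar?, at', eq, ite, some]
  have : Effective fun p : System B × Bool × FldGoal => RowTypes.fvarsOf p.1 p.2.1 p.2.2 := by
    convert h using 2 with p
    refine congrFun (congrArg _ (funext fun ⟨b, f⟩ => ?_)) _
    cases f with
    | ref i => cases h : p.1.at i <;> simp [Fld.ref?, h, Node.fvar?]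
    | _ => rfl
  exact this.comp (hS.pair (hp.pair hc))

theorem undefIn {S : Γ → System B} {p : Γ → Bool} {c : Γ → FldGoal} (hS : Effective S)
    (hp : Effective p) (hc : Effective c) : Effective fun γ => undefIn (S γ) (p γ) (c γ) := by
  have h : Effective fun p : System B × Bool × FldGoal => p.2.2.any fun l =>
      l.2.ref?.elim (decide (l.2 = .absent) && decide (l.1 = p.2.1)) fun i =>
        (p.1.at i).isUndef && decide (l.1 = p.2.1) := by
    apply_rules [any, id, fst, snd, optionElim, comp₁ Fld.primrec_ref?, const,
      comp₁ Node.primrec_isUndef, at', eq, and]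
  have : Effective fun p : System B × Bool × FldGoal => RowTypes.undefIn p.1 p.2.1 p.2.2 := by
    convert h using 2 with p
    refine congrArg (List.any p.2.2) (funext fun ⟨b, f⟩ => ?_)
    cases f with
    | ref i => cases h : p.1.at i <;> simp [Fld.ref?, h, Node.isUndef, Bool.beq_eq_decide_eq]
    | _ => simp [Fld.ref?, Bool.beq_eq_decide_eq]
  exact this.comp (hS.pair (hp.pair hc))

theorem typesOf {S : Γ → System B} {c : Γ → FldGoal} (hS : Effective S) (hc : Effective c) :
    Effective fun γ => typesOf (S γ) (c γ) := by
  have h : Effective fun p : System B × FldGoal => p.2.filterMap fun l =>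
      l.2.ref?.elim none fun i => (p.1.at i).ofType?.elim none fun j => Option.some (l.1, j) := by
    apply_rules [filterMap, id, fst, snd, optionElim, comp₁ Fld.primrec_ref?, const,
      comp₁ Node.primrec_ofType?, at', some, pair]
  have : Effective fun p : System B × FldGoal => RowTypes.typesOf p.1 p.2 := by
    convert h using 2 with p
    refine congrFun (congrArg _ (funext fun ⟨b, f⟩ => ?_)) _
    cases f with
    | ref i => cases h : p.1.at i <;> simp [Fld.ref?, h, Node.ofType?]
    | _ => rfl
  exact this.comp (hS.pair hc)

end Normal

-- Effectiveness of the combinators of runs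

section Runs

variable {Γ : Type} [Coded Γ]

theorem tick {k : Γ → ℕ} {x : Γ → Run Bool} (hk : Effective k) (hx : Effective x) :
    Effective fun γ => Run.tick (k γ) (x γ) := by
  have h := optionElim (z := fun _ => (none : Run Bool))
    (s := fun γ p => Option.some (p.1, k γ + p.2)) hx (const _)
    (some (pair id.snd.fst (add (hk.comp id.fst) id.snd.snd)))
  convert h using 2 with γ
  cases x γ <;> rfl

theorem ret {b : Γ → Bool} (hb : Effective b) : Effective fun γ => Run.ret (b γ) :=
  some (pair hb (const 0))

theorem runOr {x y : Γ → Run Bool} (hx : Effective x) (hy : Effective y) :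
    Effective fun γ => Run.or (x γ) (y γ) := by
  have h := optionElim (z := fun _ => (none : Run Bool))
    (s := fun γ p => bif p.1 then x γ else (y γ).tick p.2) hx (const _)
    (cond id.snd.fst (hx.comp id.fst) (tick id.snd.snd (hy.comp id.fst)))
  convert h using 2 with γ
  rcases h : x γ with _ | ⟨_ | _, k⟩ <;> simp [Run.or]

theorem runAnd {x y : Γ → Run Bool} (hx : Effective x) (hy : Effective y) :
    Effective fun γ => Run.and (x γ) (y γ) := by
  have h := optionElim (z := fun _ => (none : Run Bool))
    (s := fun γ p => bif p.1 then (y γ).tick p.2 else x γ) hx (const _)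
    (cond id.snd.fst (tick id.snd.snd (hy.comp id.fst)) (hx.comp id.fst))
  convert h using 2 with γ
  rcases h : x γ with _ | ⟨_ | _, k⟩ <;> simp [Run.and]

theorem runAll {X : Type} [Primcodable X] [Coded X] [Encoded X] {l : Γ → List X}
    {f : Γ → X → Run Bool} (hl : Effective l) (hf : Effective fun p : Γ × X => f p.1 p.2) :
    Effective fun γ => Run.all (l γ) (f γ) :=
  foldr hl (const _) (runAnd (hf.comp id.fst) id.snd)

theorem runAny {X : Type} [Primcodable X] [Coded X] [Encoded X] {l : Γ → List X}
    {f : Γ → X → Run Bool} (hl : Effective l) (hf : Effective fun p : Γ × X => f p.1 p.2) :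
    Effective fun γ => Run.any (l γ) (f γ) :=
  foldr hl (const _) (runOr (hf.comp id.fst) id.snd)

end Runs

-- Effectiveness of the emptiness tests

section Procedures

variable {Γ B : Type} [Coded Γ] [Primcodable B]

theorem fldEmpty {S : Γ → System B} {t : Γ → List Lit → Run Bool} {g : Γ → FldGoal}
    (hS : Effective S) (ht : Effective t) (hg : Effective g) :
    Effective fun γ => fldEmpty (S γ) (t γ) (g γ) := by
  have hS' : Effective fun p : Γ × FldGoal => S p.1 := hS.comp id.fst
  refine tick (add (const 1) (dnfSize (dnfFld hS hg))) (runAll (dnfFld hS hg) ?_)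
  exact runOr (ret (any (fvarsOf hS' (const true) id.snd)
      (mem id.snd (fvarsOf (hS'.comp id.fst) (const false) id.fst.snd))))
    (runAnd (ret (or (undefIn hS' (const false) id.snd) (any (typesOf hS' id.snd) id.snd.fst)))
      (runOr (ret (undefIn hS' (const true) id.snd))
        (app (ht.comp id.fst) (typesOf hS' id.snd))))

/-- Each negative type transforms the procedure for the remaining ones, as a function of `R`; the
fold is therefore taken in a function type. -/
theorem phi_eq_foldr (test : FldGoal → Run Bool) (tl : Tail) (Vp : List ℕ)
    (N : List (List Fld × Tail)) : RowTypes.phi test tl Vp N =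
      N.foldr (fun Q r R => Run.tick (3 + Vp.length) <|
        bif decide (Q.2 = .opened) || (decide (Q.2 = tl) ||
          Vp.any fun ρ => decide (Q.2 = .row ρ)) then
          Run.all (List.range R.length) fun k =>
            Run.or (test (R.getD k [] ++ [(false, Q.1.getD k .top)]))
              (r (R.set k (R.getD k [] ++ [(false, Q.1.getD k .top)])))
        else r R) fun _ => Run.tick 1 (Run.ret false) := by
  induction N with
  | nil => rfl
  | cons Q N ih =>
    funext R
    rw [List.foldr_cons, ← ih]
    conv_lhs => unfold RowTypes.phi
    congr 1
    by_cases h : Q.2 = .opened ∨ Q.2 = tl ∨ ∃ ρ ∈ Vp, Q.2 = .row ρ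
    · rw [if_pos h, show (decide (Q.2 = .opened) || (decide (Q.2 = tl) ||
        Vp.any fun ρ => decide (Q.2 = .row ρ))) = true by simpa using h]
      rfl
    · rw [if_neg h, show (decide (Q.2 = .opened) || (decide (Q.2 = tl) ||
        Vp.any fun ρ => decide (Q.2 = .row ρ))) = false by simpa using h]
      rfl

theorem phi {test : Γ → FldGoal → Run Bool} {tl : Γ → Tail} {Vp : Γ → List ℕ}
    {N : Γ → List (List Fld × Tail)} {R : Γ → List FldGoal} (ht : Effective test)
    (htl : Effective tl) (hVp : Effective Vp) (hN : Effective N) (hR : Effective R) :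
    Effective fun γ => phi (test γ) (tl γ) (Vp γ) (N γ) (R γ) := by
  have : Effective fun γ => RowTypes.phi (test γ) (tl γ) (Vp γ) (N γ) := by
    simp only [phi_eq_foldr]
    refine foldr hN (lam (const _)) (lam (tick (add (const 3) (length (hVp.comp id.fst.fst.fst)))
      (cond (or (eq id.fst.fst.snd.snd (const _)) (or (eq id.fst.fst.snd.snd
        (htl.comp id.fst.fst.fst)) (any (hVp.comp id.fst.fst.fst)
          (eq id.fst.fst.fst.snd.snd (comp₁ Tail.primrec_row id.snd)))))
        (runAll (range (length id.snd)) ?_) (app id.fst.snd id.snd))))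
    have h : Effective fun p : (((Γ × List Fld × Tail) × (List FldGoal → Run Bool)) ×
        List FldGoal) × ℕ => p.1.2.getD p.2 [] ++ [(false, p.1.1.1.2.1.getD p.2 .top)] :=
      append (getD _ id.fst.snd id.snd)
        (cons (pair (const false) (getD _ id.fst.fst.fst.snd.fst id.snd)) (const _))
    exact runOr (app (ht.comp id.fst.fst.fst.fst) h)
      (app id.fst.fst.snd (set id.fst.snd id.snd h))
  exact this.app hR

theorem fieldAt {R : Γ → Rec} {ℓ : Γ → ℕ} (hR : Effective R) (hl : Effective ℓ) :
    Effective fun γ => (R γ).fieldAt (ℓ γ) := by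
  have h := optionElim (z := fun γ => bif decide ((R γ).2 = .closed) then Fld.absent else Fld.top)
    (s := fun _ i => Fld.ref i) (lookup hl hR.fst)
    (cond (eq hR.snd (const _)) (const _) (const _)) (comp₁ Fld.primrec_ref id.snd)
  convert h using 2 with γ
  generalize R γ = R
  obtain ⟨fs, tl⟩ := R
  unfold Rec.fieldAt
  dsimp only
  cases fs.lookup (ℓ γ) <;> cases tl <;> rfl

theorem labelsOf {P : Γ → List Rec} (hP : Effective P) :
    Effective fun γ => labelsOf (P γ) :=
  dedup (flatMap hP (map id.snd.fst id.snd.fst))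

theorem tailOf {P : Γ → List Rec} (hP : Effective P) : Effective fun γ => tailOf (P γ) :=
  ite (eq (any hP (eq id.snd.snd (const _))) (const true)) (const _) (const _)

theorem rowVarsOf {P : Γ → List Rec} (hP : Effective P) : Effective fun γ => rowVarsOf (P γ) := by
  have h := dedup (filterMap (s := fun _ R => R.2.row?) hP
    (comp₁ Tail.primrec_row? id.snd.snd))
  convert h using 2 with γ
  refine congrArg (fun f => ((P γ).filterMap f).dedup) (funext fun R => ?_)
  rcases R with ⟨_, _ | _ | _⟩ <;> rfl

theorem recordEmpty {S : Γ → System B} {t : Γ → List Lit → Run Bool} {P N : Γ → List Rec}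
    (hS : Effective S) (ht : Effective t) (hP : Effective P) (hN : Effective N) :
    Effective fun γ => recordEmpty (S γ) (t γ) (P γ) (N γ) := by
  have hL := labelsOf (append hP hN)
  have hf : Effective fun γ => RowTypes.fldEmpty (S γ) (t γ) :=
    lam (fldEmpty (hS.comp id.fst) (ht.comp id.fst) id.snd)
  have hR : Effective fun γ => (RowTypes.labelsOf (P γ ++ N γ)).map fun ℓ =>
      (P γ).map fun R => (true, R.fieldAt ℓ) :=
    map hL (map (hP.comp id.fst) (pair (const true) (fieldAt id.snd id.fst.snd)))
  exact runOr (runAny hR (app (hf.comp id.fst) id.snd))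
    (phi hf (tailOf hP) (rowVarsOf hP) (map hN (pair
      (map (hL.comp id.fst) (fieldAt id.fst.snd id.snd)) id.snd.snd)) hR)

theorem splits {X : Type} [Primcodable X] [Coded X] [Encoded X] {l : Γ → List X}
    (hl : Effective l) : Effective fun γ => splits (l γ) := by
  have h := foldr (z := fun _ => [([], [])])
    (s := fun _ (a : X) (r : List (List X × List X)) =>
      r.flatMap fun p => [(a :: p.1, p.2), (p.1, a :: p.2)]) hl (const _)
    (flatMap id.snd (cons (pair (cons id.fst.fst.snd id.snd.fst) id.snd.snd)
      (cons (pair id.snd.fst (cons id.fst.fst.snd id.snd.snd)) (const _))))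
  convert h using 2 with γ
  induction l γ with
  | nil => rfl
  | cons a l ih => rw [RowTypes.splits, ih, List.foldr_cons]

theorem arrowEmpty {t : Γ → List Lit → Run Bool} {P N : Γ → List (ℕ × ℕ)} (ht : Effective t)
    (hP : Effective P) (hN : Effective N) :
    Effective fun γ => arrowEmpty (t γ) (P γ) (N γ) :=
  runAny hN (runAll (splits (hP.comp id.fst)) (runOr
    (tick (const 1) (app (ht.comp id.fst.fst) (cons (pair (const true) id.fst.snd.fst)
      (map id.snd.fst (pair (const false) id.snd.fst)))))
    (runAnd (ret (not (isEmpty id.snd.snd)))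
      (tick (const 1) (app (ht.comp id.fst.fst) (cons (pair (const false) id.fst.snd.snd)
        (map id.snd.snd (pair (const true) id.snd.snd))))))))

theorem nodesOf {S : Γ → System B} {c : Γ → List Lit} (b : Bool) (hS : Effective S)
    (hc : Effective c) : Effective fun γ => nodesOf (S γ) b (c γ) :=
  map (filter hc (eq id.snd.fst (const b))) (at' (hS.comp id.fst) id.snd.snd)

theorem tvarsOf {ns : Γ → List (Node B ℕ)} (hn : Effective ns) :
    Effective fun γ => tvarsOf (ns γ) := by
  have h := filterMap (s := fun _ n => Node.tvar? n) hn (comp₁ Node.primrec_tvar? id.snd)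
  convert h using 2 with γ
  exact congrArg (List.filterMap · (ns γ)) (funext fun n => by cases n <;> rfl)

theorem basicsOf [Coded B] [Encoded B] {ns : Γ → List (Node B ℕ)} (hn : Effective ns) :
    Effective fun γ => basicsOf (ns γ) := by
  have h := filterMap (s := fun _ n => Node.basic? n) hn (comp₁ Node.primrec_basic? id.snd)
  convert h using 2 with γ
  exact congrArg (List.filterMap · (ns γ)) (funext fun n => by cases n <;> rfl)

theorem arrowsOf {ns : Γ → List (Node B ℕ)} (hn : Effective ns) :
    Effective fun γ => arrowsOf (ns γ) := by
  have h := filterMap (s := fun _ n => Node.arrow? n) hn (comp₁ Node.primrec_arrow? id.snd)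
  convert h using 2 with γ
  exact congrArg (List.filterMap · (ns γ)) (funext fun n => by cases n <;> rfl)

theorem recordsOf {ns : Γ → List (Node B ℕ)} (hn : Effective ns) :
    Effective fun γ => recordsOf (ns γ) := by
  have h := filterMap (s := fun _ n => Node.record? n) hn (comp₁ Node.primrec_record? id.snd)
  convert h using 2 with γ
  exact congrArg (List.filterMap · (ns γ)) (funext fun n => by cases n <;> rfl)

variable {emp : List B × List B → Bool}

theorem clauseEmpty (hemp : Computable emp) {S : Γ → System B} {t : Γ → List Lit → Run Bool}
    {c : Γ → List Lit} (hS : Effective S) (ht : Effective t) (hc : Effective c) :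
    Effective fun γ => clauseEmpty (S γ) emp (t γ) (c γ) := by
  let _ : Coded B := .ofEncodable B
  have : Encoded B := ⟨fun _ _ => Iff.rfl⟩
  have hP := nodesOf true hS hc
  have hN := nodesOf false hS hc
  have hB := not (isEmpty (basicsOf hP))
  have hA := not (isEmpty (arrowsOf hP))
  have hR := not (isEmpty (recordsOf hP))
  exact runOr (ret (any (tvarsOf hP) (mem id.snd (tvarsOf (hN.comp id.fst)))))
    (runAnd (ret (or (or hA hR) ((of_computable hemp).comp (pair (basicsOf hP) (basicsOf hN)))))
      (runAnd (runOr (ret (or hB hR)) (arrowEmpty ht (arrowsOf hP) (arrowsOf hN)))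
        (runOr (ret (or hB hA)) (recordEmpty hS ht (recordsOf hP) (recordsOf hN)))))

/-- The recursion produces a function of `hyps` and `g`, and the comparison of goals as sets is
written with Boolean searches. -/
theorem typeEmpty_eq_natRec (S : System B) (emp : List B × List B → Bool) (n : ℕ) :
    RowTypes.typeEmpty S emp n = Nat.rec (fun _ _ => none) (fun _ r hyps g =>
      Run.tick (1 + hyps.length) <|
        bif hyps.any fun h => (h.all fun l => g.any fun a => decide (l = a)) &&
          g.all fun l => h.any fun a => decide (l = a) then Run.ret true
        else Run.tick (RowTypes.dnfSize (RowTypes.dnf S g)) <|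
          Run.all (RowTypes.dnf S g) (RowTypes.clauseEmpty S emp (r (g :: hyps)))) n := by
  induction n with
  | zero => rfl
  | succ n ih =>
    dsimp only
    rw [← ih]
    funext hyps g
    conv_lhs => unfold RowTypes.typeEmpty
    congr 1
    by_cases h : ∃ h ∈ hyps, (∀ l ∈ h, l ∈ g) ∧ ∀ l ∈ g, l ∈ h
    · rw [if_pos h, show (hyps.any fun h => (h.all fun l => g.any fun a => decide (l = a)) &&
        g.all fun l => h.any fun a => decide (l = a)) = true by simpa using h]
      rfl
    · rw [if_neg h, show (hyps.any fun h => (h.all fun l => g.any fun a => decide (l = a)) &&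
        g.all fun l => h.any fun a => decide (l = a)) = false by
          rw [Bool.eq_false_iff]
          simpa using h]
      rfl

theorem subtypeAlg (hemp : Computable emp) :
    Effective fun p : (System B × ℕ × ℕ) × ℕ => subtypeAlg p.1.1 emp p.2 p.1.2.1 p.1.2.2 := by
  have : Effective fun p : (System B × ℕ × ℕ) × ℕ => RowTypes.typeEmpty p.1.1 emp p.2 := by
    simp only [typeEmpty_eq_natRec]
    refine natRec id.snd (lam (lam (const _))) (lam (lam (tick
      (add (const 1) (length id.fst.snd)) (cond (any id.fst.snd (and
        (all id.snd (any id.fst.fst.snd (eq id.fst.snd id.snd)))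
        (all id.fst.snd (any id.fst.snd (eq id.fst.snd id.snd)))))
        (const _) ?_))))
    have hd : Effective fun p : (((((System B × ℕ × ℕ) × ℕ) × ℕ) ×
        (List (List Lit) → List Lit → Run Bool)) × List (List Lit)) × List Lit =>
        RowTypes.dnf p.1.1.1.1.1.1 p.2 := dnf id.fst.fst.fst.fst.fst.fst id.snd
    exact tick (dnfSize hd) (runAll hd (clauseEmpty hemp id.fst.fst.fst.fst.fst.fst.fst
      (app id.fst.fst.fst.snd (cons id.fst.snd id.fst.fst.snd)) id.snd))
  exact (this.app (const _)).app (cons (pair (const true) id.fst.snd.fst)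
    (cons (pair (const false) id.fst.snd.snd) (const _)))

end Procedures

end Effective

end RowTypes

-- Assembly of the theorem

theorem mainTheorem3 {B C : Type} [Primcodable B] (off : ℕ → Finset ℕ) (interp : B → Set C)
    (emp : List B × List B → Bool) (hcomp : Computable emp)
    (hemp : ∀ P N : List B,
      emp (P, N) = true ↔ (⋂ b ∈ P, interp b) \ (⋃ b ∈ N, interp b) = ∅) :
    -- any two types are presented by a finite system of equations
    (∀ t₁ t₂ : Term B, IsType off t₁ → IsType off t₂ →
      ∃ (S : System B) (i j : ℕ), S.unfold i = t₁ ∧ S.unfold j = t₂) ∧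
    -- subtyping is decidable
    (∃ f : System B × ℕ × ℕ → Bool, Computable f ∧
      ∀ (S : System B) (i j : ℕ), IsType off (S.unfold i) → IsType off (S.unfold j) →
        (f (S, i, j) = true ↔ IsSubtype interp (S.unfold i) (S.unfold j))) ∧
    -- the algorithm terminates and decides subtyping
    (∀ (S : System B) (i j : ℕ), IsType off (S.unfold i) → IsType off (S.unfold j) →
      ∃ (b : Bool) (k n₀ : ℕ), (∀ n, n₀ ≤ n → subtypeAlg S emp n i j = some (b, k)) ∧
        (b = true ↔ IsSubtype interp (S.unfold i) (S.unfold j))) ∧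
    -- on monomorphic record types, `Φ` is the monomorphic procedure, step by step
    (∀ (test : FldGoal → Run Bool) (opn : Bool) (N : List (List Fld × Bool)) (R : List FldGoal),
      phi test (Tail.ofBool opn) [] (N.map fun Q => (Q.1, Tail.ofBool Q.2)) R =
        phiMono test opn N R) ∧
    -- whatever the field tests cost, `Φ` on any input behaves as the monomorphic procedure on
    -- record types with the same fields, up to the cost of looking up the tails
    (∀ (tl : Tail) (Vp : List ℕ) (N : List (List Fld × Tail)),
      ∃ (opn : Bool) (N' : List (List Fld × Bool)), N'.map Prod.fst = N.map Prod.fst ∧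
        ∀ (test : FldGoal → Run Bool) (R : List FldGoal) (b : Bool) (c : ℕ),
          phi test tl Vp N R = some (b, c) →
            ∃ c', phiMono test opn N' R = some (b, c') ∧
              c' ≤ c ∧ c ≤ (Vp.length + 1) * c') ∧
    -- the worst-case costs of the two procedures have the same order
    (∃ K : ℕ, ∀ s : ℕ, worstPhiMono s ≠ ⊤ ∧ worstPhiMono s ≤ worstPhi s ∧
      worstPhi s ≤ K * worstPhiMono s) := by
  have hpart : ∀ (S : System B) (i j : ℕ), IsType off (S.unfold i) → IsType off (S.unfold j) →
      ∀ n b k, subtypeAlg S emp n i j = some (b, k) →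
        (b = true ↔ IsSubtype interp (S.unfold i) (S.unfold j)) :=
    fun S i j hi hj n b k h => subtypeAlg_correct hemp hi hj ⟨k, h⟩
  refine ⟨fun t₁ t₂ h₁ h₂ => exists_presentation h₁.regular h₂.regular, ?_, ?_,
    fun test opn N R => phi_ofBool test opn N R, fun tl Vp N => ⟨true, N.map fun Q : List Fld × Tail =>
      (Q.1, decide (Q.2 = .opened ∨ Q.2 = tl ∨ ∃ ρ ∈ Vp, Q.2 = .row ρ)), by simp,
      fun test R b c => costLe_phi_phiMono test tl Vp N R b c⟩,
    16, fun s => ⟨worstPhiMono_ne_top s, worstPhiMono_le s, by exact_mod_cast worstPhi_le s⟩⟩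
  -- The decision procedure tries all depth bounds until one yields an answer. Any answer is correct
  -- on types, whatever the bound at which it was found.
  · let alg (a : System B × ℕ × ℕ) (n : ℕ) : Option Bool :=
      (subtypeAlg a.1 emp n a.2.1 a.2.2).map Prod.fst
    have halg : Computable₂ alg := Computable.option_map (Effective.subtypeAlg hcomp).computable
      (Computable.fst.comp Computable.snd).to₂
    have hdom (a : System B × ℕ × ℕ) : (Nat.rfindOpt (alg a)).Dom := by
      obtain ⟨r, n₀, h⟩ := exists_subtypeAlg emp a.1 a.2.1 a.2.2
      exact Nat.rfindOpt_dom.2 ⟨n₀, r.1, by simp [alg, h n₀ le_rfl]⟩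
    refine ⟨fun a => (Nat.rfindOpt (alg a)).get (hdom a), (Partrec.rfindOpt halg).of_eq fun a =>
      (Part.some_get _).symm, fun S i j hi hj => ?_⟩
    obtain ⟨n, hn⟩ := Nat.rfindOpt_spec (Part.get_mem (hdom (S, i, j)))
    obtain ⟨⟨b, k⟩, h, hb⟩ := Option.map_eq_some_iff.1 hn
    rw [← hpart S i j hi hj n b k h]
    exact iff_of_eq (congrArg (· = true) hb.symm)
  · intro S i j hi hj
    obtain ⟨⟨b, k⟩, n₀, h⟩ := exists_subtypeAlg emp S i j
    exact ⟨b, k, n₀, h, hpart S i j hi hj n₀ b k (h n₀ le_rfl)⟩
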